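/- All manifolds are smooth, finite-dimensional, Hausdorff and second countable. A Kähler manifold $(W,\Omega,J)$ is a manifold with an integrable complex structure $J$ and a closed $J$-invariant $2$-form $\Omega$ such that $(u,v)\mapsto\Omega(Ju,v)$ is positive definite; it is homogeneous if its group of holomorphic isometries (diffeomorphisms preserving $\Omega$ and $J$) acts transitively. A Sasaki manifold $(X,\{\omega,J\})$ is a manifold with a contact form $\omega$ and an integrable CR-structure $J$ on $\ker\omega$ such that $d\omega(J\cdot,\cdot)$ is a positive definite Hermitian form on $\ker\omega$ and such that the flow of the Reeb field $\mathcal A$ (given by $\omega(\mathcal A)=1$, $\iota_{\mathcal A}d\omega=0$) preserves $J$. A pseudo-Hermitian isometry between Sasaki manifolds is a diffeomorphism $f$ with $f^*\omega'=\omega$ and $f_*\circ J=J'\circ f_*$ on $\ker\omega$; $X$ is homogeneous if its pseudo-Hermitian isometries onto itself act transitively. A Sasaki manifold $X$ is regular if $\mathcal A$ is complete and its one-parameter group $T$ of diffeomorphisms (with the Lie group structure $T=\mathbb R/\{t : \varphi_t=\mathrm{id}\}$, where $\varphi_t$ is the flow of $\mathcal A$) acts freely and properly on $X$. The Kähler manifold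 $(W,\Omega,J)$ is a Kähler quotient of $X$ if $X$ is regular and there is a principal $T$-bundle $q:X\to W$ (the Boothby--Wang fibration) such that $q^*\Omega=d\omega$ and $q_*\circ J=J\circ q_*$ on $\ker\omega$. Theorem. Let $(W,\Omega,J)$ be a contractible homogeneous Kähler manifold. Then: (1) there exists a contractible homogeneous Sasaki manifold $(X,\{\omega,J\})$ which has Kähler quotient $(W,\Omega,J)$; (2) for every contractible homogeneous Sasaki manifold $X$ with Kähler quotient $(W,\Omega,J)$, the structure group (fibre) $T$ of the Boothby--Wang fibration $X\to W$ is isomorphic to $\mathbb R$; (3) any two contractible homogeneous Sasaki manifolds with Kähler quotient $(W,\Omega,J)$ are related by a pseudo-Hermitian isometry. -/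

import Mathlib

open scoped Manifold ContDiff

namespace SasakiGeom

/-! ### Differential forms and tensor fields on manifolds modelled on a normed space -/

section Forms

/-- A (not necessarily smooth) differential `k`-form on `M`. -/
abbrev DForm (E : Type*) [NormedAddCommGroup E] [NormedSpace ℝ E] (M : Type*) [TopologicalSpace M]
    [ChartedSpace E M] (k : ℕ) : Type _ :=
  (x : M) → (TangentSpace 𝓘(ℝ, E) x) [⋀^Fin k]→L[ℝ] ℝ

/-- A (not necessarily smooth) vector field on `M`. -/
abbrev VField (E : Type*) [NormedAddCommGroup E] [NormedSpace ℝ E] (M : Type*) [TopologicalSpace M]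
    [ChartedSpace E M] : Type _ :=
  (x : M) → TangentSpace 𝓘(ℝ, E) x

/-- A (not necessarily smooth) field of endomorphisms of the tangent spaces of `M`. -/
abbrev EndField (E : Type*) [NormedAddCommGroup E] [NormedSpace ℝ E] (M : Type*)
    [TopologicalSpace M] [ChartedSpace E M] : Type _ :=
  (x : M) → (TangentSpace 𝓘(ℝ, E) x →L[ℝ] TangentSpace 𝓘(ℝ, E) x)

variable {E : Type*} [NormedAddCommGroup E] [NormedSpace ℝ E]
  {M : Type*} [TopologicalSpace M] [ChartedSpace E M]
  {F : Type*} [NormedAddCommGroup F] [NormedSpace ℝ F]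
  {N : Type*} [TopologicalSpace N] [ChartedSpace F N] {k : ℕ}

/-- The pullback `f^* η` of a differential form. -/
noncomputable def DForm.pullback (f : M → N) (η : DForm F N k) : DForm E M k :=
  fun x => (η (f x)).compContinuousLinearMap (mfderiv 𝓘(ℝ, E) 𝓘(ℝ, F) f x)

/-- The expression of a differential form in the preferred chart around `x₀`, as a form on the
model space; only its values on the (open) target of the chart are meaningful. -/
noncomputable def DForm.inChart (η : DForm E M k) (x₀ : M) : E → E [⋀^Fin k]→L[ℝ] ℝ :=
  DForm.pullback (E := E) (M := E) (extChartAt 𝓘(ℝ, E) x₀).symm η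

/-- A form is smooth if its expressions in charts are smooth. -/
def DForm.IsSmooth (η : DForm E M k) : Prop :=
  ∀ x₀ : M, ContDiffOn ℝ ∞ (η.inChart x₀) (extChartAt 𝓘(ℝ, E) x₀).target

/-- The exterior derivative, computed at `x` in the preferred chart around `x`. -/
noncomputable def DForm.d (η : DForm E M k) : DForm E M (k + 1) := fun x =>
  (extDeriv (η.inChart x) (extChartAt 𝓘(ℝ, E) x x)).compContinuousLinearMap
    (mfderiv 𝓘(ℝ, E) 𝓘(ℝ, E) (extChartAt 𝓘(ℝ, E) x) x)

/-- Smoothness of a vector field. -/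
def VField.IsSmooth [IsManifold 𝓘(ℝ, E) ∞ M] (U : VField E M) : Prop :=
  ContMDiff 𝓘(ℝ, E) 𝓘(ℝ, E).tangent ∞ (fun x => (⟨x, U x⟩ : TangentBundle 𝓘(ℝ, E) M))

/-- The vector field `J U`. -/
noncomputable def EndField.app (J : EndField E M) (U : VField E M) : VField E M := fun x => J x (U x)

/-- Smoothness of a field of endomorphisms, as a section of the bundle of endomorphisms of the
tangent bundle. -/
def EndField.IsSmooth [IsManifold 𝓘(ℝ, E) ∞ M] (J : EndField E M) : Prop :=
  ContMDiff 𝓘(ℝ, E) (𝓘(ℝ, E).prod 𝓘(ℝ, E →L[ℝ] E)) ∞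
    (fun x => Bundle.TotalSpace.mk' (E →L[ℝ] E)
      (E := fun x : M => TangentSpace 𝓘(ℝ, E) x →L[ℝ] TangentSpace 𝓘(ℝ, E) x) x (J x))

/-- The Lie bracket of vector fields. -/
noncomputable abbrev bracket (U V : VField E M) : VField E M :=
  VectorField.mlieBracket 𝓘(ℝ, E) U V

end Forms

/-! ### Kähler manifolds -/

section Kaehler

/-- A Kähler structure `(Ω, J)` on a smooth manifold. The sign convention is that the Kähler
metric is `(u, v) ↦ Ω (J u, v)`. -/
structure KaehlerStructure (E : Type*) [NormedAddCommGroup E] [NormedSpace ℝ E] (W : Type*)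
    [TopologicalSpace W] [ChartedSpace E W] [IsManifold 𝓘(ℝ, E) ∞ W] where
  /-- the Kähler form -/
  Ω : DForm E W 2
  /-- the complex structure -/
  J : EndField E W
  smooth_Ω : Ω.IsSmooth
  smooth_J : J.IsSmooth
  J_sq : ∀ (x : W) (v : TangentSpace 𝓘(ℝ, E) x), J x (J x v) = -v
  /-- integrability of `J`: the Nijenhuis tensor vanishes -/
  integrable : ∀ U V : VField E W, U.IsSmooth → V.IsSmooth → ∀ x : W,
    bracket (J.app U) (J.app V) x - bracket U V x =
      J x (bracket (J.app U) V x + bracket U (J.app V) x)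
  closed : Ω.d = 0
  hermitian : ∀ (x : W) (u v : TangentSpace 𝓘(ℝ, E) x), Ω x ![J x u, J x v] = Ω x ![u, v]
  pos : ∀ (x : W) (u : TangentSpace 𝓘(ℝ, E) x), u ≠ 0 → 0 < Ω x ![J x u, u]

variable {E : Type*} [NormedAddCommGroup E] [NormedSpace ℝ E]
  {W : Type*} [TopologicalSpace W] [ChartedSpace E W] [IsManifold 𝓘(ℝ, E) ∞ W]

/-- The holomorphic isometries `Isom_h(W)`: diffeomorphisms which preserve `J` and `Ω`
(equivalently, `J` and the Kähler metric). -/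
def KaehlerStructure.IsHolomorphicIsometry (K : KaehlerStructure E W)
    (h : W ≃ₘ^∞⟮𝓘(ℝ, E), 𝓘(ℝ, E)⟯ W) : Prop :=
  DForm.pullback h K.Ω = K.Ω ∧
  ∀ (x : W) (v : TangentSpace 𝓘(ℝ, E) x),
    mfderiv 𝓘(ℝ, E) 𝓘(ℝ, E) h x (K.J x v) = K.J (h x) (mfderiv 𝓘(ℝ, E) 𝓘(ℝ, E) h x v)

/-- A Kähler manifold is homogeneous if its holomorphic isometries act transitively. -/
def KaehlerStructure.IsHomogeneous (K : KaehlerStructure E W) : Prop :=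
  ∀ x y : W, ∃ h : W ≃ₘ^∞⟮𝓘(ℝ, E), 𝓘(ℝ, E)⟯ W, K.IsHolomorphicIsometry h ∧ h x = y

end Kaehler

/-! ### Sasaki manifolds -/

section Sasaki

/-- A Sasaki structure, that is, a standard pseudo-Hermitian structure `{ω, J}` with its Reeb
field `𝒜`. The complex structure `J` on `ker ω` is extended to all tangent vectors by `J 𝒜 = 0`.
Positivity of the Levi form makes `ω` a contact form. -/
structure SasakiStructure (F : Type*) [NormedAddCommGroup F] [NormedSpace ℝ F] (X : Type*)
    [TopologicalSpace X] [ChartedSpace F X] [IsManifold 𝓘(ℝ, F) ∞ X] where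
  /-- the contact form `ω` -/
  form : DForm F X 1
  /-- the complex structure on `ker ω` -/
  J : EndField F X
  /-- the Reeb field -/
  reeb : VField F X
  smooth_form : form.IsSmooth
  smooth_J : J.IsSmooth
  smooth_reeb : reeb.IsSmooth
  form_reeb : ∀ x : X, form x ![reeb x] = 1
  d_form_reeb : ∀ (x : X) (v : TangentSpace 𝓘(ℝ, F) x), form.d x ![reeb x, v] = 0
  J_reeb : ∀ x : X, J x (reeb x) = 0
  J_mem : ∀ (x : X) (v : TangentSpace 𝓘(ℝ, F) x), form x ![J x v] = 0
  J_sq : ∀ (x : X) (v : TangentSpace 𝓘(ℝ, F) x), form x ![v] = 0 → J x (J x v) = -v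
  /-- the Levi form is Hermitian -/
  hermitian : ∀ (x : X) (u v : TangentSpace 𝓘(ℝ, F) x), form x ![u] = 0 → form x ![v] = 0 →
    form.d x ![J x u, J x v] = form.d x ![u, v]
  /-- the Levi form is positive definite -/
  pos : ∀ (x : X) (u : TangentSpace 𝓘(ℝ, F) x), form x ![u] = 0 → u ≠ 0 → 0 < form.d x ![J x u, u]
  /-- the CR-structure `{ker ω, J}` is integrable: `[T^{1,0}, T^{1,0}] ⊆ T^{1,0}` -/
  integrable : ∀ U V : VField F X, U.IsSmooth → V.IsSmooth →
    (∀ x, form x ![U x] = 0) → (∀ x, form x ![V x] = 0) → ∀ x : X,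
      bracket (J.app U) (J.app V) x - bracket U V x =
        J x (bracket (J.app U) V x + bracket U (J.app V) x)
  /-- the (local) flow of the Reeb field preserves `J`: the Lie derivative of `J` along the Reeb
  field vanishes -/
  standard : ∀ U : VField F X, U.IsSmooth → ∀ x : X,
    bracket reeb (J.app U) x = J x (bracket reeb U x)

variable {F : Type*} [NormedAddCommGroup F] [NormedSpace ℝ F]
  {X : Type*} [TopologicalSpace X] [ChartedSpace F X] [IsManifold 𝓘(ℝ, F) ∞ X]
  {F' : Type*} [NormedAddCommGroup F'] [NormedSpace ℝ F']
  {X' : Type*} [TopologicalSpace X'] [ChartedSpace F' X'] [IsManifold 𝓘(ℝ, F') ∞ X']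
  {E : Type*} [NormedAddCommGroup E] [NormedSpace ℝ E]
  {W : Type*} [TopologicalSpace W] [ChartedSpace E W] [IsManifold 𝓘(ℝ, E) ∞ W]

/-- A pseudo-Hermitian isometry: a diffeomorphism `f` with `f^* ω' = ω` and `f_* J = J' f_*`
on `ker ω`. -/
def SasakiStructure.IsPshIsometry (S : SasakiStructure F X) (S' : SasakiStructure F' X')
    (f : X ≃ₘ^∞⟮𝓘(ℝ, F), 𝓘(ℝ, F')⟯ X') : Prop :=
  DForm.pullback f S'.form = S.form ∧
  ∀ (x : X) (v : TangentSpace 𝓘(ℝ, F) x), S.form x ![v] = 0 →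
    mfderiv 𝓘(ℝ, F) 𝓘(ℝ, F') f x (S.J x v) = S'.J (f x) (mfderiv 𝓘(ℝ, F) 𝓘(ℝ, F') f x v)

/-- A Sasaki manifold is homogeneous if its group `Psh(X)` of pseudo-Hermitian transformations
acts transitively. -/
def SasakiStructure.IsHomogeneous (S : SasakiStructure F X) : Prop :=
  ∀ x y : X, ∃ f : X ≃ₘ^∞⟮𝓘(ℝ, F), 𝓘(ℝ, F)⟯ X, S.IsPshIsometry S f ∧ f x = y

/-- `φ` is the global flow of the Reeb field. -/
structure SasakiStructure.IsReebFlow (S : SasakiStructure F X) (φ : Flow ℝ X) : Prop where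
  smooth : ContMDiff (𝓘(ℝ, ℝ).prod 𝓘(ℝ, F)) 𝓘(ℝ, F) ∞ (fun p : ℝ × X => φ p.1 p.2)
  integral : ∀ x : X, IsMIntegralCurve (I := 𝓘(ℝ, F)) (fun t => φ t x) S.reeb

end Sasaki

/-! ### The one-parameter group of a flow -/

section FlowGroup

variable {X : Type*} [TopologicalSpace X]

/-- The times at which a flow is the identity. -/
def periods (φ : Flow ℝ X) : AddSubgroup ℝ where
  carrier := {t | ∀ x, φ t x = x}
  zero_mem' x := φ.map_zero_apply x
  add_mem' {s t} hs ht x := by rw [φ.map_add, ht x, hs x]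
  neg_mem' {t} ht x := by
    have h := φ.map_add (-t) t x
    rw [neg_add_cancel, φ.map_zero_apply, ht x] at h
    exact h.symm

/-- The one-parameter group `T = {φ_t}` of a flow, as the Lie group `ℝ / {t | φ_t = id}`. -/
abbrev FlowGroup (φ : Flow ℝ X) : Type := ℝ ⧸ periods φ

/-- The action of the group `T` of transformations `φ_t`. -/
instance FlowGroup.instAddAction (φ : Flow ℝ X) : AddAction (FlowGroup φ) X where
  vadd g x := Quotient.liftOn' g (fun t => φ t x) (by
    intro s t h
    have h' : -s + t ∈ periods φ := QuotientAddGroup.leftRel_apply.mp h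
    have h2 := φ.map_add s (-s + t) x
    rw [h' x, add_neg_cancel_left] at h2
    exact h2.symm)
  zero_vadd x := φ.map_zero_apply x
  add_vadd g g' x := by
    induction g using QuotientAddGroup.induction_on
    induction g' using QuotientAddGroup.induction_on
    exact φ.map_add _ _ x

theorem FlowGroup.mk_vadd (φ : Flow ℝ X) (t : ℝ) (x : X) :
    ((t : FlowGroup φ) +ᵥ x : X) = φ t x := rfl

end FlowGroup

/-! ### The Boothby-Wang fibration and the Kähler quotient -/

section BoothbyWang

variable {F : Type*} [NormedAddCommGroup F] [NormedSpace ℝ F]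
  {X : Type*} [TopologicalSpace X] [ChartedSpace F X] [IsManifold 𝓘(ℝ, F) ∞ X]
  {E : Type*} [NormedAddCommGroup E] [NormedSpace ℝ E]
  {W : Type*} [TopologicalSpace W] [ChartedSpace E W] [IsManifold 𝓘(ℝ, E) ∞ W]

/-- The Sasaki manifold `X` is regular with Reeb flow `φ`: the Reeb field is complete and its
one-parameter group `T` acts freely and properly. -/
structure SasakiStructure.IsRegular (S : SasakiStructure F X) (φ : Flow ℝ X) : Prop where
  flow : S.IsReebFlow φ
  free : ∀ (g : FlowGroup φ) (x : X), g +ᵥ x = x → g = 0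
  proper : ProperVAdd (FlowGroup φ) X

/-- `q : X → W` is the Boothby-Wang fibration of the regular Sasaki manifold `X` with Reeb flow
`φ` over the Kähler manifold `W`: `q` is the smooth quotient map of the free and proper action
of `T` (and hence a principal `T`-bundle), `q_* : ker ω → TW` is holomorphic, and
`q^* Ω = dω`. -/
structure IsBoothbyWang (S : SasakiStructure F X) (φ : Flow ℝ X) (K : KaehlerStructure E W)
    (q : X → W) : Prop where
  regular : S.IsRegular φ
  smooth : ContMDiff 𝓘(ℝ, F) 𝓘(ℝ, E) ∞ q
  surjective : Function.Surjective q
  submersion : ∀ x : X, Function.Surjective (mfderiv 𝓘(ℝ, F) 𝓘(ℝ, E) q x)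
  fibres : ∀ x y : X, q x = q y ↔ ∃ g : FlowGroup φ, g +ᵥ x = y
  holomorphic : ∀ (x : X) (v : TangentSpace 𝓘(ℝ, F) x), S.form x ![v] = 0 →
    mfderiv 𝓘(ℝ, F) 𝓘(ℝ, E) q x (S.J x v) = K.J (q x) (mfderiv 𝓘(ℝ, F) 𝓘(ℝ, E) q x v)
  curvature : DForm.pullback q K.Ω = S.form.d

/-- The Kähler manifold `W` is the Kähler quotient of the Sasaki manifold `X`. -/
def HasKaehlerQuotient (S : SasakiStructure F X) (K : KaehlerStructure E W) : Prop :=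
  ∃ (φ : Flow ℝ X) (q : X → W), IsBoothbyWang S φ K q

end BoothbyWang

end SasakiGeom

open SasakiGeom

universe u v u₁ v₁ u₂ v₂

set_option linter.unusedSectionVars false

/-! Contractibility makes the Kähler form exact: Ω = dθ. Then dt + θ on ℝ × W is a contact form with
Reeb field ∂/∂t and differential the pullback of Ω. Lifting J to its kernel reduces every Sasaki
axiom to the corresponding Kähler one (`LineProd.sasaki`). If h is a holomorphic isometry of W, then
h^*θ − θ is closed, hence equal to some df, and (t, x) ↦ (t − f x + c, h x) preserves dt + θ. The
free constant c moves points along the fibres, so homogeneity of W passes to the product.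

Conversely, let q : X → W be any Boothby–Wang fibration with X contractible. Since dω = q^*Ω =
q^*dθ, the form ω − q^*θ is closed, so ω = df + q^*θ for a function f
(`IsBoothbyWang.exists_potential`). As ω(𝒜) = 1, f grows at unit speed along Reeb orbits: f (φ_t x)
= f x + t. Hence no t ≠ 0 is a period, and T ≅ ℝ. Moreover (f, q) identifies X with ℝ × W and ω with
dt + θ. Matching two such identifications gives a diffeomorphism over W that preserves the contact
forms; it respects J because a horizontal vector is determined by its projection to W.

The analytic input is the Poincaré lemma on a contractible manifold
(`DForm.IsSmooth.exists_primitive`). A contraction is a priori only continuous, so Whitney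
approximation (`exists_contMDiff_eqOn`) first makes it smooth; then the homotopy operator ∫₀¹ ι_∂t
G^*η dt yields a primitive. -/

namespace SasakiGeom

open Set Filter Topology

/-! ### Derivatives of charts and of their inverses. -/

section ChartDerivatives

variable {E : Type*} [NormedAddCommGroup E] [NormedSpace ℝ E]
  {M : Type*} [TopologicalSpace M] [ChartedSpace E M] [IsManifold 𝓘(ℝ, E) ∞ M]

theorem contMDiffAt_extChartAt_symm {x₀ : M} {y : E} (hy : y ∈ (extChartAt 𝓘(ℝ, E) x₀).target) :
    ContMDiffAt 𝓘(ℝ, E) 𝓘(ℝ, E) ∞ (extChartAt 𝓘(ℝ, E) x₀).symm y :=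
  (contMDiffOn_extChartAt_symm x₀).contMDiffAt ((isOpen_extChartAt_target x₀).mem_nhds hy)

theorem mdifferentiableAt_extChartAt_symm {x₀ : M} {y : E}
    (hy : y ∈ (extChartAt 𝓘(ℝ, E) x₀).target) :
    MDifferentiableAt 𝓘(ℝ, E) 𝓘(ℝ, E) (extChartAt 𝓘(ℝ, E) x₀).symm y :=
  (contMDiffAt_extChartAt_symm hy).mdifferentiableAt (by simp)

theorem mdifferentiableAt_extChartAt_of_mem {x₀ x : M} (hx : x ∈ (extChartAt 𝓘(ℝ, E) x₀).source) :
    MDifferentiableAt 𝓘(ℝ, E) 𝓘(ℝ, E) (extChartAt 𝓘(ℝ, E) x₀) x :=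
  mdifferentiableAt_extChartAt (by simpa using hx)

theorem mfderiv_extChartAt_comp_symm {x₀ : M} {y : E} (hy : y ∈ (extChartAt 𝓘(ℝ, E) x₀).target) :
    (mfderiv 𝓘(ℝ, E) 𝓘(ℝ, E) (extChartAt 𝓘(ℝ, E) x₀) ((extChartAt 𝓘(ℝ, E) x₀).symm y)).comp
      (mfderiv 𝓘(ℝ, E) 𝓘(ℝ, E) (extChartAt 𝓘(ℝ, E) x₀).symm y) =
      ContinuousLinearMap.id ℝ (TangentSpace 𝓘(ℝ, E) y) := by
  have := mfderiv_extChartAt_comp_mfderivWithin_extChartAt_symm (I := 𝓘(ℝ, E)) hy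
  simpa only [modelWithCornersSelf_coe, range_id, mfderivWithin_univ] using this

theorem mfderiv_extChartAt_symm_comp {x₀ x : M} (hx : x ∈ (extChartAt 𝓘(ℝ, E) x₀).source) :
    (mfderiv 𝓘(ℝ, E) 𝓘(ℝ, E) (extChartAt 𝓘(ℝ, E) x₀).symm (extChartAt 𝓘(ℝ, E) x₀ x)).comp
      (mfderiv 𝓘(ℝ, E) 𝓘(ℝ, E) (extChartAt 𝓘(ℝ, E) x₀) x) =
      ContinuousLinearMap.id ℝ (TangentSpace 𝓘(ℝ, E) x) := by
  have := mfderivWithin_extChartAt_symm_comp_mfderiv_extChartAt' (I := 𝓘(ℝ, E)) hx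
  simpa only [modelWithCornersSelf_coe, range_id, mfderivWithin_univ] using this

/-- The derivative of the inverse of the chart at `x₀`, as a map of the model space. -/
noncomputable def chartSymmDeriv (x₀ : M) (y : E) : E →L[ℝ] E :=
  mfderiv 𝓘(ℝ, E) 𝓘(ℝ, E) (extChartAt 𝓘(ℝ, E) x₀).symm y

/-- The derivative of the chart at `x₀`, as a map of the model space. -/
noncomputable def chartDeriv (x₀ x : M) : E →L[ℝ] E :=
  mfderiv 𝓘(ℝ, E) 𝓘(ℝ, E) (extChartAt 𝓘(ℝ, E) x₀) x

theorem chartDeriv_chartSymmDeriv {x₀ : M} {y : E} (hy : y ∈ (extChartAt 𝓘(ℝ, E) x₀).target)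
    (v : E) : chartDeriv x₀ ((extChartAt 𝓘(ℝ, E) x₀).symm y) (chartSymmDeriv x₀ y v) = v :=
  congrArg (fun A : E →L[ℝ] E => A v) (mfderiv_extChartAt_comp_symm hy)

theorem chartSymmDeriv_chartDeriv {x₀ x : M} (hx : x ∈ (extChartAt 𝓘(ℝ, E) x₀).source)
    (v : E) : chartSymmDeriv x₀ (extChartAt 𝓘(ℝ, E) x₀ x) (chartDeriv x₀ x v) = v :=
  congrArg (fun A : E →L[ℝ] E => A v) (mfderiv_extChartAt_symm_comp hx)

end ChartDerivatives

/-! ### Smooth dependence of the pullback of an alternating form on the form and the map. -/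

section AlternatingSmooth

variable {E : Type*} [NormedAddCommGroup E] [NormedSpace ℝ E]
  {F : Type*} [NormedAddCommGroup F] [NormedSpace ℝ F] {k : ℕ}

/-- Alternatization of continuous multilinear forms, as a continuous linear map. -/
noncomputable def alternatizationCLM (E : Type*) [NormedAddCommGroup E] [NormedSpace ℝ E] (k : ℕ) :
    ContinuousMultilinearMap ℝ (fun _ : Fin k => E) ℝ →L[ℝ] E [⋀^Fin k]→L[ℝ] ℝ :=
  LinearMap.mkContinuous
    { toFun := ContinuousMultilinearMap.alternatization
      map_add' := fun f g => map_add _ f g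
      map_smul' := fun c f => by
        ext v
        simp only [ContinuousMultilinearMap.alternatization_apply_apply,
          smul_apply, ContinuousAlternatingMap.smul_apply,
          RingHom.id_apply, Finset.smul_sum]
        exact Finset.sum_congr rfl fun σ _ => smul_comm _ _ _ }
    (k.factorial : ℝ) (fun f => by
      refine ContinuousAlternatingMap.opNorm_le_bound _ (by positivity) fun v => ?_
      have : ∀ σ : Equiv.Perm (Fin k), ‖Equiv.Perm.sign σ • f (v ∘ σ)‖ ≤ ‖f‖ * ∏ i, ‖v i‖ := by
        intro σ
        have h1 : ‖Equiv.Perm.sign σ • f (v ∘ σ)‖ = ‖f (v ∘ σ)‖ := by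
          rcases Int.units_eq_one_or (Equiv.Perm.sign σ) with h | h <;> simp [h]
        rw [h1]
        refine (f.le_opNorm _).trans_eq ?_
        congr 1
        exact Equiv.prod_comp σ (fun i => ‖v i‖)
      calc ‖ContinuousMultilinearMap.alternatization f v‖
          = ‖∑ σ : Equiv.Perm (Fin k), Equiv.Perm.sign σ • f (v ∘ σ)‖ := by
            rw [ContinuousMultilinearMap.alternatization_apply_apply]
        _ ≤ ∑ σ : Equiv.Perm (Fin k), ‖f‖ * ∏ i, ‖v i‖ :=
            norm_sum_le_of_le _ fun σ _ => this σ
        _ = (k.factorial : ℝ) * ‖f‖ * ∏ i, ‖v i‖ := by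
            simp [Fintype.card_perm, mul_assoc])

theorem alternatizationCLM_toContinuousMultilinearMap (A : E [⋀^Fin k]→L[ℝ] ℝ) :
    alternatizationCLM E k A.toContinuousMultilinearMap = (k.factorial : ℝ) • A := by
  ext v
  change ContinuousMultilinearMap.alternatization A.toContinuousMultilinearMap v = _
  rw [ContinuousMultilinearMap.alternatization_apply_apply]
  have : ∀ σ : Equiv.Perm (Fin k),
      Equiv.Perm.sign σ • A.toContinuousMultilinearMap (v ∘ σ) = A v := by
    intro σ
    have h : A.toContinuousMultilinearMap (v ∘ σ) = Equiv.Perm.sign σ • A v :=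
      A.toAlternatingMap.map_perm v σ
    rw [h, smul_smul, Int.units_mul_self, one_smul]
  rw [Finset.sum_congr rfl fun σ _ => this σ]
  simp [Fintype.card_perm]

/-- For multilinear forms the pullback is jointly analytic. An alternating form is recovered from
its underlying multilinear form by alternatization divided by k!, a continuous linear operation, so
smoothness transfers. -/
theorem contDiff_compContinuousLinearMap :
    ContDiff ℝ ∞ (fun p : (F [⋀^Fin k]→L[ℝ] ℝ) × (E →L[ℝ] F) =>
      p.1.compContinuousLinearMap p.2) := by
  have h : (fun p : (F [⋀^Fin k]→L[ℝ] ℝ) × (E →L[ℝ] F) => p.1.compContinuousLinearMap p.2) =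
      fun p => ((k.factorial : ℝ)⁻¹ • alternatizationCLM E k)
        ((ContinuousAlternatingMap.toContinuousMultilinearMapCLM ℝ p.1).compContinuousLinearMap
          (fun _ => p.2)) := by
    funext p
    have := alternatizationCLM_toContinuousMultilinearMap (p.1.compContinuousLinearMap p.2)
    change _ = (k.factorial : ℝ)⁻¹ •
      alternatizationCLM E k (p.1.compContinuousLinearMap p.2).toContinuousMultilinearMap
    rw [this, smul_smul, inv_mul_cancel₀ (by positivity), one_smul]
  rw [h]
  refine ContinuousLinearMap.contDiff _ |>.comp ?_
  have hq : ContDiff ℝ ∞ (fun q : (Fin k → (E →L[ℝ] F)) ×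
      (ContinuousMultilinearMap ℝ (fun _ : Fin k => F) ℝ) => q.2.compContinuousLinearMap q.1) :=
    contDiff_iff_contDiffAt.mpr fun q =>
      (ContinuousMultilinearMap.analyticAt_uncurry_compContinuousLinearMap).contDiffAt
  refine hq.comp (f := fun p : (F [⋀^Fin k]→L[ℝ] ℝ) × (E →L[ℝ] F) =>
    ((fun _ : Fin k => p.2), ContinuousAlternatingMap.toContinuousMultilinearMapCLM ℝ p.1)) ?_
  refine ContDiff.prodMk (contDiff_pi.mpr fun _ => contDiff_snd) ?_
  exact (ContinuousLinearMap.contDiff _).comp contDiff_fst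

end AlternatingSmooth

/-! ### Pullback of differential forms: functoriality, smoothness, compatibility with d. -/

section Pullback

variable {E : Type*} [NormedAddCommGroup E] [NormedSpace ℝ E]
  {M : Type*} [TopologicalSpace M] [ChartedSpace E M]
  {F : Type*} [NormedAddCommGroup F] [NormedSpace ℝ F]
  {N : Type*} [TopologicalSpace N] [ChartedSpace F N]
  {G : Type*} [NormedAddCommGroup G] [NormedSpace ℝ G]
  {P : Type*} [TopologicalSpace P] [ChartedSpace G P] {k : ℕ}

theorem DForm.pullback_apply (f : M → N) (η : DForm F N k) (x : M)
    (v : Fin k → TangentSpace 𝓘(ℝ, E) x) :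
    DForm.pullback f η x v = η (f x) (fun i => mfderiv 𝓘(ℝ, E) 𝓘(ℝ, F) f x (v i)) := rfl

theorem DForm.pullback_comp_apply {f : M → N} {g : N → P} {x : M}
    (hg : MDifferentiableAt 𝓘(ℝ, F) 𝓘(ℝ, G) g (f x)) (hf : MDifferentiableAt 𝓘(ℝ, E) 𝓘(ℝ, F) f x)
    (η : DForm G P k) :
    DForm.pullback (E := E) (M := M) (g ∘ f) η x = DForm.pullback f (DForm.pullback (E := F) (M := N) g η) x := by
  ext v
  rw [DForm.pullback_apply, DForm.pullback_apply, DForm.pullback_apply, mfderiv_comp x hg hf]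
  rfl

theorem DForm.pullback_congr {f g : M → N} {x : M} (h : f =ᶠ[𝓝 x] g) (η : DForm F N k) :
    DForm.pullback f η x = DForm.pullback (E := E) (M := M) g η x := by
  have h1 := h.self_of_nhds
  have h2 := h.mfderiv_eq (I := 𝓘(ℝ, E)) (I' := 𝓘(ℝ, F))
  ext v
  rw [DForm.pullback_apply, DForm.pullback_apply, h2, h1]

theorem DForm.pullback_id (η : DForm E M k) : DForm.pullback id η = η := by
  funext x
  ext v
  rw [DForm.pullback_apply, mfderiv_id]
  rfl

/-- The pullback of a differential form to a normed space, as a form on that space. -/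
noncomputable def DForm.pullbackModel (f : E → N) (η : DForm F N k) : E → E [⋀^Fin k]→L[ℝ] ℝ :=
  DForm.pullback (E := E) (M := E) f η

theorem DForm.inChart_apply (η : DForm E M k) (x₀ : M) (y : E) :
    η.inChart x₀ y =
      (DForm.pullback (E := E) (M := E) (extChartAt 𝓘(ℝ, E) x₀).symm η y :) := rfl

/-- Near x, f is its chart expression followed by the inverse chart. This reduces questions about
pullbacks to forms on the model space. -/
theorem DForm.pullback_eq_pullback_inChart [IsManifold 𝓘(ℝ, F) ∞ N] {f : M → N} {x : M} {y₀ : N}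
    (hf : MDifferentiableAt 𝓘(ℝ, E) 𝓘(ℝ, F) f x) (hx : f x ∈ (extChartAt 𝓘(ℝ, F) y₀).source)
    (η : DForm F N k) :
    DForm.pullback (E := E) (M := M) f η x =
      DForm.pullback (F := F) (N := F) (extChartAt 𝓘(ℝ, F) y₀ ∘ f) (η.inChart y₀) x := by
  have hs : MDifferentiableAt 𝓘(ℝ, F) 𝓘(ℝ, F) (extChartAt 𝓘(ℝ, F) y₀).symm
      ((extChartAt 𝓘(ℝ, F) y₀ ∘ f) x) :=
    mdifferentiableAt_extChartAt_symm ((extChartAt 𝓘(ℝ, F) y₀).map_source hx)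
  have hc : MDifferentiableAt 𝓘(ℝ, E) 𝓘(ℝ, F) (extChartAt 𝓘(ℝ, F) y₀ ∘ f) x :=
    (mdifferentiableAt_extChartAt_of_mem hx).comp x hf
  rw [DForm.inChart, ← DForm.pullback_comp_apply hs hc]
  apply DForm.pullback_congr
  filter_upwards [hf.continuousAt.preimage_mem_nhds
    ((isOpen_extChartAt_source y₀).mem_nhds hx)] with z hz
  exact ((extChartAt 𝓘(ℝ, F) y₀).left_inv hz).symm

theorem DForm.inChart_model (η : DForm E E k) (x₀ : E) : η.inChart x₀ = η := by
  funext y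
  rw [DForm.inChart_apply]
  have : ((extChartAt 𝓘(ℝ, E) x₀).symm : E → E) = id := rfl
  rw [this, DForm.pullback_id]

/-- On the model space, the exterior derivative of a form is `extDeriv`. -/
theorem DForm.d_model (η : DForm E E k) (x : E) :
    η.d x = extDeriv (fun y => (η y : E [⋀^Fin k]→L[ℝ] ℝ)) x := by
  ext v
  rw [DForm.d, DForm.inChart_model]
  have : (extChartAt 𝓘(ℝ, E) x : E → E) = id := rfl
  rw [this, mfderiv_id]
  rfl

theorem DForm.pullback_model_apply (f : E → F) (η : DForm F F k) (x : E) :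
    DForm.pullback (E := E) (M := E) f η x =
      (η (f x) : F [⋀^Fin k]→L[ℝ] ℝ).compContinuousLinearMap (fderiv ℝ f x) := by
  rw [DForm.pullback, mfderiv_eq_fderiv]
  rfl

theorem DForm.IsSmooth.contDiffAt_inChart {η : DForm F N k} (hη : η.IsSmooth) {y₀ : N} {y : F}
    (hy : y ∈ (extChartAt 𝓘(ℝ, F) y₀).target) : ContDiffAt ℝ ∞ (η.inChart y₀) y :=
  (hη y₀).contDiffAt ((isOpen_extChartAt_target y₀).mem_nhds hy)

variable [IsManifold 𝓘(ℝ, F) ∞ N]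

theorem DForm.pullback_eventuallyEq_inChart {f : E → N} {x : E} {y₀ : N}
    (hf : ContMDiffAt 𝓘(ℝ, E) 𝓘(ℝ, F) ∞ f x) (hx : f x ∈ (extChartAt 𝓘(ℝ, F) y₀).source)
    (η : DForm F N k) :
    (η.pullbackModel f) =ᶠ[𝓝 x]
      fun z => (η.inChart y₀ ((extChartAt 𝓘(ℝ, F) y₀ ∘ f) z)).compContinuousLinearMap
        (fderiv ℝ (extChartAt 𝓘(ℝ, F) y₀ ∘ f) z) := by
  have h1 : ∀ᶠ z in 𝓝 x, ContMDiffAt 𝓘(ℝ, E) 𝓘(ℝ, F) 1 f z :=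
    (contMDiffAt_iff_contMDiffAt_nhds (by simp)).mp
      (hf.of_le (by exact_mod_cast (le_top : (1 : ℕ∞) ≤ ⊤)))
  filter_upwards [h1, hf.continuousAt.preimage_mem_nhds
    ((isOpen_extChartAt_source y₀).mem_nhds hx)] with z hz hz'
  rw [DForm.pullbackModel, DForm.pullback_eq_pullback_inChart (hz.mdifferentiableAt (by simp)) hz' η]
  exact DForm.pullback_model_apply _ _ _

theorem contDiffAt_extChartAt_comp {f : E → N} {x : E} {y₀ : N}
    (hf : ContMDiffAt 𝓘(ℝ, E) 𝓘(ℝ, F) ∞ f x) (hx : f x ∈ (extChartAt 𝓘(ℝ, F) y₀).source) :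
    ContDiffAt ℝ ∞ (extChartAt 𝓘(ℝ, F) y₀ ∘ f) x :=
  ((contMDiffAt_extChartAt' (by simpa using hx)).comp x hf).contDiffAt

theorem DForm.IsSmooth.contDiffAt_pullback {η : DForm F N k} (hη : η.IsSmooth) {f : E → N} {x : E}
    (hf : ContMDiffAt 𝓘(ℝ, E) 𝓘(ℝ, F) ∞ f x) :
    ContDiffAt ℝ ∞
      (η.pullbackModel f) x := by
  have hx := mem_extChartAt_source (I := 𝓘(ℝ, F)) (f x)
  refine ContDiffAt.congr_of_eventuallyEq ?_ (DForm.pullback_eventuallyEq_inChart hf hx η)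
  have hc := contDiffAt_extChartAt_comp hf hx
  have h1 : ContDiffAt ℝ ∞ (fun z => η.inChart (f x) ((extChartAt 𝓘(ℝ, F) (f x) ∘ f) z)) x :=
    (hη.contDiffAt_inChart ((extChartAt 𝓘(ℝ, F) (f x)).map_source hx)).comp x hc
  have h2 : ContDiffAt ℝ ∞ (fderiv ℝ (extChartAt 𝓘(ℝ, F) (f x) ∘ f)) x :=
    hc.fderiv_right (by simp)
  exact contDiff_compContinuousLinearMap.contDiffAt.comp x (h1.prodMk h2)

/-- The exterior derivative commutes with pullback to a normed space. -/
theorem DForm.IsSmooth.extDeriv_pullback {η : DForm F N k} (hη : η.IsSmooth) {f : E → N} {x : E}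
    (hf : ContMDiffAt 𝓘(ℝ, E) 𝓘(ℝ, F) ∞ f x) :
    extDeriv (η.pullbackModel f) x =
      η.d.pullbackModel f x := by
  have hx := mem_extChartAt_source (I := 𝓘(ℝ, F)) (f x)
  rw [(DForm.pullback_eventuallyEq_inChart hf hx η).extDeriv_eq]
  have hc := contDiffAt_extChartAt_comp hf hx
  have h1 := hη.contDiffAt_inChart ((extChartAt 𝓘(ℝ, F) (f x)).map_source hx)
  rw [_root_.extDeriv_pullback (f := extChartAt 𝓘(ℝ, F) (f x) ∘ f) (r := ∞) (h1.differentiableAt (by simp)) hc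
    (by rw [minSmoothness_of_isRCLikeNormedField]; exact_mod_cast ENat.LEInfty.out)]
  have h3 : fderiv ℝ (extChartAt 𝓘(ℝ, F) (f x) ∘ f) x =
      (mfderiv 𝓘(ℝ, F) 𝓘(ℝ, F) (extChartAt 𝓘(ℝ, F) (f x)) (f x)).comp
        (mfderiv 𝓘(ℝ, E) 𝓘(ℝ, F) f x) := by
    rw [← mfderiv_eq_fderiv]
    exact mfderiv_comp x (mdifferentiableAt_extChartAt_of_mem hx)
      (hf.mdifferentiableAt (by simp))
  rw [h3]
  rfl

theorem DForm.inChart_pullback_eventuallyEq [IsManifold 𝓘(ℝ, E) ∞ M] {f : M → N} {x₀ : M} {y : E}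
    (hf : ContMDiff 𝓘(ℝ, E) 𝓘(ℝ, F) ∞ f) (hy : y ∈ (extChartAt 𝓘(ℝ, E) x₀).target)
    (η : DForm F N k) :
    DForm.inChart (E := E) (M := M) (DForm.pullback f η) x₀ =ᶠ[𝓝 y]
      η.pullbackModel (f ∘ (extChartAt 𝓘(ℝ, E) x₀).symm) := by
  filter_upwards [(isOpen_extChartAt_target x₀).mem_nhds hy] with z hz
  exact (DForm.pullback_comp_apply ((hf _).mdifferentiableAt (by simp))
    (mdifferentiableAt_extChartAt_symm hz) η).symm

theorem DForm.IsSmooth.pullback [IsManifold 𝓘(ℝ, E) ∞ M] {f : M → N} {η : DForm F N k}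
    (hη : η.IsSmooth) (hf : ContMDiff 𝓘(ℝ, E) 𝓘(ℝ, F) ∞ f) :
    DForm.IsSmooth (E := E) (M := M) (DForm.pullback f η) := by
  intro x₀ y hy
  refine ContDiffAt.contDiffWithinAt (ContDiffAt.congr_of_eventuallyEq ?_
    (DForm.inChart_pullback_eventuallyEq hf hy η))
  exact hη.contDiffAt_pullback ((hf _).comp y (contMDiffAt_extChartAt_symm hy))

/-- The exterior derivative commutes with pullback. -/
theorem DForm.IsSmooth.d_pullback [IsManifold 𝓘(ℝ, E) ∞ M] {f : M → N} {η : DForm F N k}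
    (hη : η.IsSmooth) (hf : ContMDiff 𝓘(ℝ, E) 𝓘(ℝ, F) ∞ f) :
    DForm.d (E := E) (M := M) (DForm.pullback f η) = DForm.pullback f η.d := by
  funext x
  have hx := mem_extChartAt_source (I := 𝓘(ℝ, E)) x
  have hy := (extChartAt 𝓘(ℝ, E) x).map_source hx
  have hs := contMDiffAt_extChartAt_symm hy
  rw [DForm.d, (DForm.inChart_pullback_eventuallyEq hf hy η).extDeriv_eq,
    hη.extDeriv_pullback ((hf _).comp _ hs)]
  have h1 := DForm.pullback_comp_apply (f := extChartAt 𝓘(ℝ, E) x)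
    (g := f ∘ (extChartAt 𝓘(ℝ, E) x).symm) (x := x)
    (((hf _).comp _ hs).mdifferentiableAt (by simp)) (mdifferentiableAt_extChartAt_of_mem hx) η.d
  -- Near x the chart followed by its inverse is the identity, so the chart drops out.
  refine h1.symm.trans (DForm.pullback_congr ?_ _)
  filter_upwards [(isOpen_extChartAt_source x).mem_nhds hx] with z hz
  simp only [Function.comp_apply, (extChartAt 𝓘(ℝ, E) x).left_inv hz]

end Pullback

/-! ### Linearity of smoothness and of d. -/

section Linear

variable {E : Type*} [NormedAddCommGroup E] [NormedSpace ℝ E]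
  {M : Type*} [TopologicalSpace M] [ChartedSpace E M] {k : ℕ} {η ζ : DForm E M k}

theorem DForm.inChart_add (η ζ : DForm E M k) (x₀ : M) :
    (η + ζ).inChart x₀ = η.inChart x₀ + ζ.inChart x₀ := rfl

theorem DForm.inChart_smul (c : ℝ) (η : DForm E M k) (x₀ : M) :
    (c • η).inChart x₀ = c • η.inChart x₀ := rfl

theorem DForm.IsSmooth.add (hη : η.IsSmooth) (hζ : ζ.IsSmooth) : (η + ζ).IsSmooth := fun x₀ => by
  rw [DForm.inChart_add]
  exact (hη x₀).add (hζ x₀)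

theorem DForm.IsSmooth.const_smul (c : ℝ) (hη : η.IsSmooth) :
    DForm.IsSmooth (E := E) (M := M) (c • η) := fun x₀ => by
  rw [DForm.inChart_smul]
  exact contDiffOn_const.smul (hη x₀)

theorem DForm.IsSmooth.sub (hη : η.IsSmooth) (hζ : ζ.IsSmooth) : (η - ζ).IsSmooth := by
  rw [sub_eq_add_neg, ← neg_one_smul ℝ ζ]
  exact hη.add (hζ.const_smul _)

theorem DForm.IsSmooth.d_add (hη : η.IsSmooth) (hζ : ζ.IsSmooth) :
    DForm.d (η + ζ) = η.d + ζ.d := by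
  funext x
  have hy := (extChartAt 𝓘(ℝ, E) x).map_source (mem_extChartAt_source x)
  rw [DForm.d, DForm.inChart_add, extDeriv_add
    ((hη.contDiffAt_inChart hy).differentiableAt (by simp))
    ((hζ.contDiffAt_inChart hy).differentiableAt (by simp))]
  rfl

theorem DForm.d_const_smul (c : ℝ) (η : DForm E M k) :
    DForm.d (E := E) (M := M) (c • η) = c • η.d := by
  funext x
  rw [DForm.d, DForm.inChart_smul, extDeriv_smul]
  rfl

theorem DForm.IsSmooth.d_sub (hη : η.IsSmooth) (hζ : ζ.IsSmooth) :
    DForm.d (η - ζ) = η.d - ζ.d := by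
  rw [sub_eq_add_neg, ← neg_one_smul ℝ ζ, hη.d_add (hζ.const_smul _), DForm.d_const_smul,
    sub_eq_add_neg]
  congr 1
  funext x
  ext v
  exact neg_one_mul _

end Linear

/-! ### One-forms and differentials of functions. -/

section OneForms

variable {E : Type*} [NormedAddCommGroup E] [NormedSpace ℝ E]
  {M : Type*} [TopologicalSpace M] [ChartedSpace E M] [IsManifold 𝓘(ℝ, E) ∞ M]

/-- The coordinate form `dt` on the real line. -/
noncomputable def lineForm : DForm ℝ ℝ 1 := fun _ =>
  (ContinuousAlternatingMap.ofSubsingleton ℝ ℝ ℝ (0 : Fin 1) (ContinuousLinearMap.id ℝ ℝ) :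
    ℝ [⋀^Fin 1]→L[ℝ] ℝ)

theorem lineForm_isSmooth : lineForm.IsSmooth := by
  intro x₀
  rw [DForm.inChart_model]
  exact contDiffOn_const

theorem d_lineForm : lineForm.d = 0 := by
  funext x
  rw [DForm.d_model]
  have : (fun y => (lineForm y : ℝ [⋀^Fin 1]→L[ℝ] ℝ)) = fun _ =>
      (ContinuousAlternatingMap.ofSubsingleton ℝ ℝ ℝ (0 : Fin 1) (ContinuousLinearMap.id ℝ ℝ)) := rfl
  rw [this, extDeriv, fderiv_fun_const]
  exact map_zero (ContinuousAlternatingMap.alternatizeUncurryFinCLM ℝ ℝ ℝ)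

/-- The derivative of a real function, as a linear form on the tangent space. -/
noncomputable def funDeriv (f : M → ℝ) (x : M) : TangentSpace 𝓘(ℝ, E) x →L[ℝ] ℝ :=
  mfderiv 𝓘(ℝ, E) 𝓘(ℝ, ℝ) f x

/-- The differential of a function, as a `1`-form. -/
noncomputable def DForm.ofFun (f : M → ℝ) : DForm E M 1 := DForm.pullback f lineForm

theorem DForm.ofFun_apply (f : M → ℝ) (x : M) (v : Fin 1 → TangentSpace 𝓘(ℝ, E) x) :
    DForm.ofFun (E := E) f x v = funDeriv f x (v 0) := rfl

theorem DForm.ofFun_isSmooth {f : M → ℝ} (hf : ContMDiff 𝓘(ℝ, E) 𝓘(ℝ, ℝ) ∞ f) :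
    (DForm.ofFun (E := E) f).IsSmooth := lineForm_isSmooth.pullback hf

theorem DForm.d_ofFun {f : M → ℝ} (hf : ContMDiff 𝓘(ℝ, E) 𝓘(ℝ, ℝ) ∞ f) :
    (DForm.ofFun (E := E) f).d = 0 := by
  rw [DForm.ofFun, lineForm_isSmooth.d_pullback hf, d_lineForm]
  rfl

theorem DForm.oneForm_ext {η ζ : DForm E M 1}
    (h : ∀ (x : M) (v : TangentSpace 𝓘(ℝ, E) x), η x ![v] = ζ x ![v]) : η = ζ := by
  funext x
  ext v
  have : v = ![v 0] := by
    funext i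
    fin_cases i
    rfl
  rw [this]
  exact h x (v 0)

theorem DForm.oneForm_sub (η : DForm E M 1) (x : M) (a b : TangentSpace 𝓘(ℝ, E) x) :
    η x ![a - b] = η x ![a] - η x ![b] := by
  have h (c : TangentSpace 𝓘(ℝ, E) x) : Function.update ![a] 0 c = ![c] := by
    funext i
    fin_cases i
    simp
  have := (η x).map_update_sub ![a] 0 a b
  rwa [h, h, h] at this

end OneForms

/-! ### Whitney approximation of continuous maps between manifolds. -/

section Smoothing

variable {EM : Type*} [NormedAddCommGroup EM] [NormedSpace ℝ EM] [FiniteDimensional ℝ EM]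
  {HM : Type*} [TopologicalSpace HM] (I : ModelWithCorners ℝ EM HM)
  {M : Type*} [TopologicalSpace M] [ChartedSpace HM M] [IsManifold I ∞ M] [T2Space M]
  [SigmaCompactSpace M]
  {E : Type*} [NormedAddCommGroup E] [NormedSpace ℝ E]
  {N : Type*} [TopologicalSpace N] [ChartedSpace E N] [IsManifold 𝓘(ℝ, E) ∞ N]

/-- A continuous function with values in a normed space can be approximated, uniformly on a
compact set near which it is continuous, by smooth functions. -/
theorem exists_contMDiff_dist_lt_on_compact {u : M → E} {K : Set M} (hK : IsClosed K)
    (hu : ∀ x ∈ K, ContinuousAt u x) {δ : ℝ} (hδ : 0 < δ) :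
    ∃ g : M → E, ContMDiff I 𝓘(ℝ, E) ∞ g ∧ ∀ x ∈ K, dist (g x) (u x) < δ := by
  -- Partition of unity: the condition at x is a ball when x lies in K and no condition otherwise,
  -- hence convex, and a local constant satisfies it.
  obtain ⟨g, hg⟩ := exists_contMDiffMap_forall_mem_convex_of_local_const I (n := ⊤)
    (t := fun x => {y | x ∈ K → dist y (u x) < δ})
    (fun x => by
      by_cases hx : x ∈ K
      · simp only [hx, true_imp_iff]
        exact convex_ball (u x) δ
      · simpa [hx] using convex_univ)
    (fun x => by
      by_cases hx : x ∈ K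
      · refine ⟨u x, ?_⟩
        filter_upwards [(hu x hx).eventually (Metric.ball_mem_nhds (u x) hδ)] with y hy _
        rw [dist_comm]
        exact hy
      · refine ⟨0, ?_⟩
        filter_upwards [hK.isOpen_compl.mem_nhds hx] with y hy hy'
        exact absurd hy' hy)
  exact ⟨g, g.contMDiff, hg⟩

/-- Smoothing a continuous map inside one chart of the target, while keeping prescribed sets in
prescribed chart domains. -/
theorem exists_local_smoothing {ι : Type*} {K : ι → Set M} (hKc : ∀ i, IsCompact (K i))
    (hKf : LocallyFinite K) (p : ι → N) (i : ι) {χ : M → ℝ} (hχ : ContMDiff I 𝓘(ℝ, ℝ) ∞ χ)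
    (hχ01 : ∀ x, χ x ∈ Icc (0 : ℝ) 1) (hχK : tsupport χ = K i) {f : M → N} (hf : Continuous f)
    (hfK : ∀ j, ∀ x ∈ K j, f x ∈ (extChartAt 𝓘(ℝ, E) (p j)).source) :
    ∃ g : M → N, (Continuous g ∧ ∀ j, ∀ x ∈ K j, g x ∈ (extChartAt 𝓘(ℝ, E) (p j)).source) ∧
      (∀ x ∉ K i, g x = f x) ∧
      (∀ x, ContMDiffAt I 𝓘(ℝ, E) ∞ f x → ContMDiffAt I 𝓘(ℝ, E) ∞ g x) ∧
      (∀ x, χ =ᶠ[𝓝 x] 1 → ContMDiffAt I 𝓘(ℝ, E) ∞ g x) := by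
  classical
  set e := extChartAt 𝓘(ℝ, E) (p i) with he
  have hef : ∀ x ∈ K i, ContinuousAt (fun x => e (f x)) x := fun x hx =>
    (continuousAt_extChartAt' (hfK i x hx)).comp hf.continuousAt
  have hefc : ∀ S ⊆ K i, ContinuousOn (fun x => e (f x)) S := fun S hS x hx =>
    (hef x (hS hx)).continuousWithinAt
  -- a uniform radius
  have hO : ∀ j, IsOpen (e.target ∩ e.symm ⁻¹' (extChartAt 𝓘(ℝ, E) (p j)).source) := fun j =>
    (continuousOn_extChartAt_symm (p i)).isOpen_inter_preimage (isOpen_extChartAt_target (p i))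
      (isOpen_extChartAt_source (p j))
  have hδj : ∀ j, ∃ δ : ℝ, 0 < δ ∧ ∀ x ∈ K i ∩ K j, ∀ y, dist y (e (f x)) < δ →
      y ∈ e.target ∩ e.symm ⁻¹' (extChartAt 𝓘(ℝ, E) (p j)).source := by
    intro j
    have hc : IsCompact ((fun x => e (f x)) '' (K i ∩ K j)) :=
      ((hKc i).inter (hKc j)).image_of_continuousOn (hefc _ inter_subset_left)
    have hsub : (fun x => e (f x)) '' (K i ∩ K j) ⊆
        e.target ∩ e.symm ⁻¹' (extChartAt 𝓘(ℝ, E) (p j)).source := by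
      rintro _ ⟨x, hx, rfl⟩
      refine ⟨e.map_source (hfK i x hx.1), ?_⟩
      rw [mem_preimage, e.left_inv (hfK i x hx.1)]
      exact hfK j x hx.2
    obtain ⟨δ, hδ, hδs⟩ := hc.exists_thickening_subset_open (hO j) hsub
    exact ⟨δ, hδ, fun x hx y hy => hδs (Metric.mem_thickening_iff.mpr ⟨_, ⟨x, hx, rfl⟩, hy⟩)⟩
  have hfin : {j | (K j ∩ K i).Nonempty}.Finite := hKf.finite_nonempty_inter_compact (hKc i)
  choose δj hδj0 hδjs using hδj
  -- By local finiteness only finitely many `K j` meet the compact `K i`, so one radius serves them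
  -- all.
  obtain ⟨δ, hδ0, hδs⟩ : ∃ δ : ℝ, 0 < δ ∧ ∀ j, (K j ∩ K i).Nonempty → δ ≤ δj j := by
    have : ∃ δ : ℝ, 0 < δ ∧ ∀ j ∈ hfin.toFinset, δ ≤ δj j := by
      refine hfin.toFinset.induction_on ⟨1, one_pos, by simp⟩ ?_
      rintro a S - ⟨δ, h0, h⟩
      refine ⟨min δ (δj a), lt_min h0 (hδj0 a), fun j hj => ?_⟩
      rcases Finset.mem_insert.mp hj with rfl | hj
      · exact min_le_right _ _
      · exact (min_le_left _ _).trans (h j hj)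
    obtain ⟨δ, h0, h⟩ := this
    exact ⟨δ, h0, fun j hj => h j (hfin.mem_toFinset.mpr hj)⟩
  obtain ⟨g, hg, hgd⟩ := exists_contMDiff_dist_lt_on_compact I (hKc i).isClosed hef hδ0
  -- In the chart, interpolate from f to the smooth approximation g: c is smooth wherever f is,
  -- equals g where χ = 1, equals f where χ = 0, and stays within δ of f.
  set c : M → E := fun x => e (f x) + χ x • (g x - e (f x)) with hc
  have hcd : ∀ x ∈ K i, dist (c x) (e (f x)) < δ := by
    intro x hx
    have h1 : dist (c x) (e (f x)) = χ x * dist (g x) (e (f x)) := by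
      rw [dist_eq_norm, dist_eq_norm, hc]
      simp [norm_smul, abs_of_nonneg (hχ01 x).1]
    rw [h1]
    exact (mul_le_of_le_one_left dist_nonneg (hχ01 x).2).trans_lt (hgd x hx)
  have hcmem : ∀ x ∈ K i, ∀ j, x ∈ K j →
      c x ∈ e.target ∩ e.symm ⁻¹' (extChartAt 𝓘(ℝ, E) (p j)).source := fun x hx j hj =>
    hδjs j x ⟨hx, hj⟩ _ ((hcd x hx).trans_le (hδs j ⟨x, hj, hx⟩))
  have hχ0 : ∀ x ∉ K i, χ x = 0 := fun x hx => by
    rw [← hχK] at hx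
    exact image_eq_zero_of_notMem_tsupport hx
  set φ : M → N := fun x => if x ∈ K i then e.symm (c x) else f x with hφ
  have hφ_in : ∀ x ∈ K i, φ =ᶠ[𝓝 x] fun z => e.symm (c z) := by
    intro x hx
    filter_upwards [hf.continuousAt.preimage_mem_nhds
      ((isOpen_extChartAt_source (p i)).mem_nhds (hfK i x hx))] with z hz
    by_cases hzK : z ∈ K i
    · simp [hφ, hzK]
    · have : c z = e (f z) := by simp [hc, hχ0 z hzK]
      simp only [hφ, hzK, if_false, this]
      exact (e.left_inv hz).symm
  have hφ_out : ∀ x ∉ K i, φ =ᶠ[𝓝 x] f := by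
    intro x hx
    filter_upwards [(hKc i).isClosed.isOpen_compl.mem_nhds hx] with z hz
    have hz' : z ∉ K i := hz
    simp [hφ, hz']
  refine ⟨φ, ⟨?_, ?_⟩, fun x hx => (hφ_out x hx).self_of_nhds, ?_, ?_⟩
  · rw [continuous_iff_continuousAt]
    intro x
    by_cases hx : x ∈ K i
    · refine ContinuousAt.congr ?_ (hφ_in x hx).symm
      have h1 : ContinuousAt c x := (hef x hx).add
        (hχ.continuous.continuousAt.smul (hg.continuous.continuousAt.sub (hef x hx)))
      exact (continuousAt_extChartAt_symm'' (hcmem x hx i hx).1).comp h1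
    · exact hf.continuousAt.congr (hφ_out x hx).symm
  · intro j x hj
    by_cases hx : x ∈ K i
    · simp only [hφ, hx, if_true]
      exact (hcmem x hx j hj).2
    · simp only [hφ, hx, if_false]
      exact hfK j x hj
  · intro x hfx
    by_cases hx : x ∈ K i
    · refine ContMDiffAt.congr_of_eventuallyEq ?_ (hφ_in x hx)
      have hs : ContMDiffAt 𝓘(ℝ, E) 𝓘(ℝ, E) ∞ e.symm (c x) :=
        contMDiffAt_extChartAt_symm (hcmem x hx i hx).1
      have h1 : ContMDiffAt I 𝓘(ℝ, E) ∞ (fun x => e (f x)) x :=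
        (contMDiffAt_extChartAt' (by simpa using hfK i x hx)).comp x hfx
      have h2 : ContMDiffAt I 𝓘(ℝ, E) ∞ c x := h1.add ((hχ x).smul ((hg x).sub h1))
      exact hs.comp x h2
    · exact hfx.congr_of_eventuallyEq (hφ_out x hx)
  · intro x hx1
    have hx : x ∈ K i := by
      by_contra h
      have := hx1.self_of_nhds
      rw [hχ0 x h] at this
      simp at this
    have hcg : (fun z => e.symm (c z)) =ᶠ[𝓝 x] fun z => e.symm (g z) := by
      filter_upwards [hx1] with z hz
      simp [hc, hz]
    refine ContMDiffAt.congr_of_eventuallyEq ?_ ((hφ_in x hx).trans hcg)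
    have hgx : c x = g x := by simp [hc, hx1.self_of_nhds]
    have hs : ContMDiffAt 𝓘(ℝ, E) 𝓘(ℝ, E) ∞ e.symm (g x) :=
      contMDiffAt_extChartAt_symm (hgx ▸ (hcmem x hx i hx).1)
    exact hs.comp x (hg x)

/-- **Whitney approximation**: a continuous map between manifolds which is smooth outside a closed
set `s` agrees with a smooth map on every closed set disjoint from `s`. -/
theorem exists_contMDiff_eqOn {f : M → N} (hf : Continuous f) {A s : Set M} (hA : IsClosed A)
    (hs : IsClosed s) (hAs : Disjoint A s) (hfs : ∀ x ∉ s, ContMDiffAt I 𝓘(ℝ, E) ∞ f x) :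
    ∃ g : M → N, ContMDiff I 𝓘(ℝ, E) ∞ g ∧ EqOn g f A := by
  -- The bump functions are supported in Aᶜ, so no correction below touches A, and each support is
  -- mapped by f into a single chart domain.
  obtain ⟨ι, fs, hfsub⟩ := SmoothBumpCovering.exists_isSubordinate I hs
    (U := fun x => Aᶜ ∩ f ⁻¹' (extChartAt 𝓘(ℝ, E) (f x)).source) (fun x hx =>
      inter_mem (hA.isOpen_compl.mem_nhds fun h => disjoint_left.mp hAs h hx)
        (hf.continuousAt.preimage_mem_nhds (extChartAt_source_mem_nhds (f x))))
  have hKf : LocallyFinite fun i => tsupport (fs i) := fs.locallyFinite.closure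
  have hKc : ∀ i, IsCompact (tsupport (fs i)) := fun i => (fs i).hasCompactSupport
  have hcount : Countable ι := by
    rw [← countable_univ_iff]
    exact fs.locallyFinite.countable_univ fun i => (fs i).nonempty_support
  have : Encodable ι := Encodable.ofCountable ι
  -- The invariant of the iteration: every support still lands in its chart domain, so the next
  -- local smoothing applies.
  set S := {h : M → N // Continuous h ∧
    ∀ j, ∀ x ∈ tsupport (fs j), h x ∈ (extChartAt 𝓘(ℝ, E) (f (fs.c j))).source}
  have hstep : ∀ (i : ι) (h : S), ∃ g : S, (∀ x ∉ tsupport (fs i), g.1 x = h.1 x) ∧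
      (∀ x, ContMDiffAt I 𝓘(ℝ, E) ∞ h.1 x → ContMDiffAt I 𝓘(ℝ, E) ∞ g.1 x) ∧
      (∀ x, fs i =ᶠ[𝓝 x] 1 → ContMDiffAt I 𝓘(ℝ, E) ∞ g.1 x) := by
    intro i h
    obtain ⟨g, h1, h2⟩ := exists_local_smoothing I hKc hKf (fun j => f (fs.c j)) i
      (fs i).contMDiff (fun x => (fs i).mem_Icc) rfl h.2.1 h.2.2
    exact ⟨⟨g, h1⟩, h2⟩
  choose step hstep1 hstep2 hstep3 using hstep
  -- The index i is treated at step `encode i`; later steps preserve the smoothness gained.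
  let seq : ℕ → S := fun n => Nat.rec ⟨f, hf, fun j x hx => (hfsub j hx).2⟩
    (fun n h => (Encodable.decode₂ ι n).elim h (fun i => step i h)) n
  have hsucc : ∀ n, seq (n + 1) =
      (Encodable.decode₂ ι n).elim (seq n) (fun i => step i (seq n)) := fun n => rfl
  have hmono : ∀ n x, ContMDiffAt I 𝓘(ℝ, E) ∞ (seq n).1 x →
      ContMDiffAt I 𝓘(ℝ, E) ∞ (seq (n + 1)).1 x := by
    intro n x h
    rw [hsucc]
    cases hd : Encodable.decode₂ ι n with
    | none => exact h
    | some i => exact hstep2 i _ x h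
  have hmono' : ∀ m n x, m ≤ n → ContMDiffAt I 𝓘(ℝ, E) ∞ (seq m).1 x →
      ContMDiffAt I 𝓘(ℝ, E) ∞ (seq n).1 x := by
    intro m n x hmn h
    induction n, hmn using Nat.le_induction with
    | base => exact h
    | succ n _ ih => exact hmono n x ih
  have hne : ∀ n x, (seq (n + 1)).1 x ≠ (seq n).1 x →
      ∃ i, Encodable.encode i = n ∧ x ∈ tsupport (fs i) := by
    intro n x h
    rw [hsucc] at h
    cases hd : Encodable.decode₂ ι n with
    | none => simp [hd] at h
    | some i =>
      refine ⟨i, Encodable.mem_decode₂.mp hd, ?_⟩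
      by_contra hx
      rw [hd] at h
      exact h (hstep1 i _ x hx)
  -- Near any point only finitely many steps change the map, so the sequence stabilises locally and
  -- its limit inherits smoothness.
  have hlf : LocallyFinite fun n => {x | (seq (n + 1)).1 x ≠ (seq n).1 x} := by
    intro x
    obtain ⟨U, hU, hfin⟩ := hKf x
    refine ⟨U, hU, (hfin.image Encodable.encode).subset ?_⟩
    rintro n ⟨z, hz, hzU⟩
    obtain ⟨i, rfl, hi⟩ := hne n z hz
    exact ⟨i, ⟨z, hi, hzU⟩, rfl⟩
  obtain ⟨F, hF⟩ := hlf.exists_forall_eventually_atTop_eventuallyEq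
    (f := fun n => (seq n).1)
  refine ⟨F, fun x => ?_, fun x hx => ?_⟩
  · obtain ⟨m, hm⟩ : ∃ m, ContMDiffAt I 𝓘(ℝ, E) ∞ (seq m).1 x := by
      by_cases hx : x ∈ s
      · refine ⟨Encodable.encode (fs.ind x hx) + 1, ?_⟩
        rw [hsucc, Encodable.encodek₂]
        exact hstep3 _ _ x (fs.eventuallyEq_one x hx)
      · exact ⟨0, hfs x hx⟩
    obtain ⟨n, hn, hmn⟩ := ((hF x).and (eventually_ge_atTop m)).exists
    exact (hmono' m n x hmn hm).congr_of_eventuallyEq hn.symm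
  · have hseq : ∀ n, (seq n).1 x = f x := by
      intro n
      induction n with
      | zero => rfl
      | succ n ih =>
        rw [← ih]
        by_contra h
        obtain ⟨i, -, hi⟩ := hne n x h
        exact (hfsub i hi).1 hx
    obtain ⟨n, hn⟩ := (hF x).exists
    rw [← hn.self_of_nhds, hseq]

end Smoothing

/-! ### Smooth contractions of contractible manifolds. -/

section Contraction

variable {E : Type*} [NormedAddCommGroup E] [NormedSpace ℝ E] [FiniteDimensional ℝ E]
  {M : Type*} [TopologicalSpace M] [T2Space M] [SecondCountableTopology M] [ChartedSpace E M]
  [IsManifold 𝓘(ℝ, E) ∞ M]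

/-- A contractible manifold is smoothly contractible. -/
theorem exists_smooth_contraction [ContractibleSpace M] :
    ∃ (G : ℝ × M → M) (p : M), ContMDiff (𝓘(ℝ, ℝ).prod 𝓘(ℝ, E)) 𝓘(ℝ, E) ∞ G ∧
      (∀ x, G (0, x) = p) ∧ ∀ x, G (1, x) = x := by
  have : LocallyCompactSpace M := ChartedSpace.locallyCompactSpace E M
  obtain ⟨p, ⟨H⟩⟩ := id_nullhomotopic M
  -- The reparametrisation reverses the homotopy H from the identity to p and freezes it outside
  -- [1/3, 2/3]. There f is locally the constant p or the projection, hence smooth, and Whitney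
  -- approximation leaves t ≤ 0 and t ≥ 1 alone.
  set r : ℝ → unitInterval := fun t => projIcc 0 1 zero_le_one (2 - 3 * t) with hr
  have hrc : Continuous r := continuous_projIcc.comp (by fun_prop)
  set f : ℝ × M → M := fun q => H (r q.1, q.2) with hf
  have hfc : Continuous f := by fun_prop
  have hA : IsClosed {q : ℝ × M | q.1 ≤ 0 ∨ 1 ≤ q.1} :=
    (isClosed_le continuous_fst continuous_const).union (isClosed_le continuous_const continuous_fst)
  have hs : IsClosed {q : ℝ × M | 1 / 3 ≤ q.1 ∧ q.1 ≤ 2 / 3} :=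
    (isClosed_le continuous_const continuous_fst).inter (isClosed_le continuous_fst continuous_const)
  have hf0 : ∀ q : ℝ × M, q.1 < 1 / 3 → f q = p := by
    intro q hq
    have : r q.1 = 1 := projIcc_of_right_le zero_le_one (by linarith)
    simp [hf, this]
  have hf1 : ∀ q : ℝ × M, 2 / 3 < q.1 → f q = q.2 := by
    intro q hq
    have : r q.1 = 0 := projIcc_of_le_left zero_le_one (by linarith)
    simp [hf, this]
  obtain ⟨G, hG, hGA⟩ := exists_contMDiff_eqOn (𝓘(ℝ, ℝ).prod 𝓘(ℝ, E)) (E := E) hfc hA hs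
    (by
      rw [disjoint_left]
      rintro q (h | h) ⟨h1, h2⟩ <;> linarith)
    (by
      intro q hq
      rcases lt_or_ge q.1 (1 / 3) with h | h
      · refine (contMDiffAt_const (c := p)).congr_of_eventuallyEq ?_
        filter_upwards [(isOpen_lt continuous_fst continuous_const).mem_nhds h] with z hz
        exact hf0 z hz
      · have h' : 2 / 3 < q.1 := by
          by_contra hc
          exact hq ⟨h, not_lt.mp hc⟩
        refine contMDiffAt_snd.congr_of_eventuallyEq ?_
        filter_upwards [(isOpen_lt continuous_const continuous_fst).mem_nhds h'] with z hz
        exact hf1 z hz)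
  refine ⟨G, p, hG, fun x => ?_, fun x => ?_⟩
  · rw [hGA (Or.inl le_rfl), hf0 _ (by norm_num)]
  · rw [hGA (Or.inr le_rfl), hf1 _ (by norm_num)]

end Contraction

/-! ### Smoothness of integrals depending on a parameter. -/

section ParametricIntegral

variable {E : Type u} [NormedAddCommGroup E] [NormedSpace ℝ E] [FiniteDimensional ℝ E]
  {V : Type u} [NormedAddCommGroup V] [NormedSpace ℝ V] [CompleteSpace V]

theorem continuous_slice_of_contDiffOn {V : Type*} [NormedAddCommGroup V] [NormedSpace ℝ V]
    {f : ℝ × E → V} {U : Set E} (hf : ContinuousOn f (univ ×ˢ U)) {y : E} (hy : y ∈ U) :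
    Continuous fun t : ℝ => f (t, y) := by
  rw [← continuousOn_univ]
  exact hf.comp (by fun_prop) fun t _ => ⟨mem_univ _, hy⟩

/-- The partial derivative is continuous on the compact product of [0, 1] with a small closed ball,
so a constant dominates it. -/
theorem hasFDerivAt_intervalIntegral_param {f : ℝ × E → V} {U : Set E} (hU : IsOpen U)
    (hf : ContDiffOn ℝ 1 f (univ ×ˢ U)) {y : E} (hy : y ∈ U) :
    HasFDerivAt (fun z => ∫ t in (0 : ℝ)..1, f (t, z))
      (∫ t in (0 : ℝ)..1, (fderiv ℝ f (t, y)).comp (ContinuousLinearMap.inr ℝ ℝ E)) y := by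
  have hO : IsOpen (univ ×ˢ U : Set (ℝ × E)) := isOpen_univ.prod hU
  have hdf : ContinuousOn (fun q => (fderiv ℝ f q).comp (ContinuousLinearMap.inr ℝ ℝ E))
      (univ ×ˢ U) :=
    (hf.continuousOn_fderiv_of_isOpen hO le_rfl).clm_comp continuousOn_const
  obtain ⟨ε, hε, hεU⟩ := Metric.nhds_basis_closedBall.mem_iff.mp (hU.mem_nhds hy)
  have hK : IsCompact (Icc (0 : ℝ) 1 ×ˢ Metric.closedBall y ε) :=
    isCompact_Icc.prod (isCompact_closedBall y ε)
  obtain ⟨C, hC⟩ := hK.exists_bound_of_continuousOn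
    (hdf.mono fun q hq => ⟨mem_univ _, hεU hq.2⟩)
  refine (intervalIntegral.hasFDerivAt_integral_of_dominated_of_fderiv_le
    (F := fun z t => f (t, z))
    (F' := fun z t => (fderiv ℝ f (t, z)).comp (ContinuousLinearMap.inr ℝ ℝ E))
    (bound := fun _ => C) (Metric.ball_mem_nhds y hε) ?_ ?_ ?_ ?_ ?_ ?_)
  · filter_upwards [hU.mem_nhds hy] with z hz
    exact (continuous_slice_of_contDiffOn hf.continuousOn hz).aestronglyMeasurable
  · exact (continuous_slice_of_contDiffOn hf.continuousOn hy).intervalIntegrable _ _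
  · exact (continuous_slice_of_contDiffOn hdf hy).aestronglyMeasurable
  · refine Eventually.of_forall fun t ht z hz => ?_
    rw [uIoc_of_le zero_le_one] at ht
    exact hC (t, z) ⟨⟨ht.1.le, ht.2⟩, Metric.ball_subset_closedBall hz⟩
  · exact intervalIntegrable_const
  · refine Eventually.of_forall fun t _ z hz => ?_
    have h1 : HasFDerivAt f (fderiv ℝ f (t, z)) (t, z) :=
      ((hf.differentiableOn one_ne_zero).differentiableAt
        (hO.mem_nhds ⟨mem_univ _, hεU (Metric.ball_subset_closedBall hz)⟩)).hasFDerivAt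
    exact h1.comp z (hasFDerivAt_prodMk_right t z)

theorem clm_fderiv_intervalIntegral_param {f : ℝ × E → V} {U : Set E} (hU : IsOpen U)
    (hf : ContDiffOn ℝ 1 f (univ ×ˢ U)) {y : E} (hy : y ∈ U) (Λ : (E →L[ℝ] V) →L[ℝ] ℝ) :
    Λ (fderiv ℝ (fun z => ∫ t in (0 : ℝ)..1, f (t, z)) y) =
      ∫ t in (0 : ℝ)..1, Λ ((fderiv ℝ f (t, y)).comp (ContinuousLinearMap.inr ℝ ℝ E)) := by
  have hdf : ContinuousOn (fun q => (fderiv ℝ f q).comp (ContinuousLinearMap.inr ℝ ℝ E))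
      (univ ×ˢ U) :=
    (hf.continuousOn_fderiv_of_isOpen (isOpen_univ.prod hU) le_rfl).clm_comp continuousOn_const
  rw [(hasFDerivAt_intervalIntegral_param hU hf hy).fderiv]
  exact (Λ.intervalIntegral_comp_comm
    ((continuous_slice_of_contDiffOn hdf hy).intervalIntegrable 0 1)).symm

/-- Induction on the order: the derivative is again such an integral, now with values in `E →L[ℝ]
V`. Generalising over `V` is what makes `E` and `V` share a universe. -/
theorem contDiffOn_intervalIntegral_param {f : ℝ × E → V} {U : Set E} (hU : IsOpen U)
    (hf : ContDiffOn ℝ ∞ f (univ ×ˢ U)) :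
    ContDiffOn ℝ ∞ (fun z => ∫ t in (0 : ℝ)..1, f (t, z)) U := by
  rw [contDiffOn_infty]
  intro n
  induction n generalizing V with
  | zero =>
    rw [Nat.cast_zero, contDiffOn_zero]
    exact fun y hy => (hasFDerivAt_intervalIntegral_param hU
      (hf.of_le (by exact_mod_cast le_top)) hy).continuousAt.continuousWithinAt
  | succ n ih =>
    rw [Nat.cast_succ, contDiffOn_succ_iff_fderiv_of_isOpen hU]
    have hd := fun y hy => hasFDerivAt_intervalIntegral_param hU
      (hf.of_le (m := 1) (by exact_mod_cast le_top)) (y := y) hy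
    refine ⟨fun y hy => (hd y hy).differentiableAt.differentiableWithinAt, by simp, ?_⟩
    have hO : IsOpen (univ ×ˢ U : Set (ℝ × E)) := isOpen_univ.prod hU
    refine (ih (V := E →L[ℝ] V)
      (f := fun q => (fderiv ℝ f q).comp (ContinuousLinearMap.inr ℝ ℝ E)) ?_).congr
      fun y hy => (hd y hy).fderiv
    exact (hf.fderiv_of_isOpen hO (by simp)).clm_comp contDiffOn_const

end ParametricIntegral

/-! ### The homotopy formula on ℝ × U. -/

section HomotopyOperator

variable {E : Type u} [NormedAddCommGroup E] [NormedSpace ℝ E] {k : ℕ}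

/-- Contraction of a form on `ℝ × E` with `∂/∂t`, followed by restriction to `E`. -/
noncomputable def contractTime (E : Type u) [NormedAddCommGroup E] [NormedSpace ℝ E] (k : ℕ) :
    (ℝ × E) [⋀^Fin (k + 1)]→L[ℝ] ℝ →L[ℝ] E [⋀^Fin k]→L[ℝ] ℝ :=
  (ContinuousAlternatingMap.compContinuousLinearMapCLM (ContinuousLinearMap.inr ℝ ℝ E)).comp
    ((ContinuousLinearMap.apply ℝ ((ℝ × E) [⋀^Fin k]→L[ℝ] ℝ) ((1, 0) : ℝ × E)).comp
      (ContinuousAlternatingMap.curryLeftLI (𝕜 := ℝ) (E := ℝ × E) (F := ℝ)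
        (n := k)).toContinuousLinearMap)

theorem contractTime_apply (A : (ℝ × E) [⋀^Fin (k + 1)]→L[ℝ] ℝ) (v : Fin k → E) :
    contractTime E k A v = A (Fin.cons ((1, 0) : ℝ × E) fun i => ((0, v i) : ℝ × E)) := rfl

variable [FiniteDimensional ℝ E]

/-- The homotopy formula for a closed form on `ℝ × U`. -/
theorem extDeriv_integral_contractTime {α : ℝ × E → (ℝ × E) [⋀^Fin (k + 1)]→L[ℝ] ℝ} {U : Set E}
    (hU : IsOpen U) (hα : ContDiffOn ℝ ∞ α (univ ×ˢ U)) {y : E} (hy : y ∈ U)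
    (hd : ∀ t : ℝ, extDeriv α (t, y) = 0) (v : Fin (k + 1) → E) :
    extDeriv (fun z => ∫ t in (0 : ℝ)..1, contractTime E k (α (t, z))) y v =
      α (1, y) (fun i => ((0, v i) : ℝ × E)) - α (0, y) (fun i => ((0, v i) : ℝ × E)) := by
  have hO : IsOpen (univ ×ˢ U : Set (ℝ × E)) := isOpen_univ.prod hU
  have hα1 : ContDiffOn ℝ 1 α (univ ×ˢ U) := hα.of_le (by exact_mod_cast le_top)
  have hdα : ∀ t : ℝ, DifferentiableAt ℝ α (t, y) := fun t =>
    (hα1.differentiableOn one_ne_zero).differentiableAt (hO.mem_nhds ⟨mem_univ _, hy⟩)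
  have hdc : Continuous fun t : ℝ => fderiv ℝ α (t, y) :=
    continuous_slice_of_contDiffOn (hα1.continuousOn_fderiv_of_isOpen hO le_rfl) hy
  set f : ℝ × E → E [⋀^Fin k]→L[ℝ] ℝ := fun q => contractTime E k (α q) with hf
  have hfs : ContDiffOn ℝ 1 f (univ ×ˢ U) := (contractTime E k).contDiff.comp_contDiffOn hα1
  have hfd : ∀ t : ℝ, fderiv ℝ f (t, y) = (contractTime E k).comp (fderiv ℝ α (t, y)) := fun t =>
    ((contractTime E k).hasFDerivAt.comp (t, y) (hdα t).hasFDerivAt).fderiv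
  have h1 := clm_fderiv_intervalIntegral_param hU hfs hy
    ((ContinuousAlternatingMap.apply ℝ E ℝ v).comp
      (ContinuousAlternatingMap.alternatizeUncurryFinCLM ℝ E ℝ))
  refine h1.trans ?_
  set w : Fin (k + 1) → ℝ × E := fun i => (0, v i) with hw
  have h2 : ∀ t : ℝ, ContinuousAlternatingMap.alternatizeUncurryFin
        ((fderiv ℝ f (t, y)).comp (ContinuousLinearMap.inr ℝ ℝ E)) v =
      fderiv ℝ α (t, y) (1, 0) w := by
    intro t
    -- Cartan's formula: in the expansion of dα(∂t, w) = 0 the head term is ∂_t α(w), and the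
    -- remaining terms are minus the spatial exterior derivative of ι_∂t α.
    have h3 : extDeriv α (t, y) (Fin.cons ((1, 0) : ℝ × E) w) = 0 := by
      rw [hd t]
      rfl
    rw [extDeriv, ContinuousAlternatingMap.alternatizeUncurryFin_apply, Fin.sum_univ_succ] at h3
    rw [ContinuousAlternatingMap.alternatizeUncurryFin_apply]
    simp only [Fin.val_zero, pow_zero, Fin.cons_zero, one_smul, Fin.val_succ, Fin.cons_succ,
      Fin.removeNth_zero, Fin.tail_cons, pow_succ, mul_neg, mul_one, neg_smul,
      Finset.sum_neg_distrib] at h3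
    rw [← sub_eq_add_neg, sub_eq_zero] at h3
    rw [h3]
    refine Finset.sum_congr rfl fun i _ => ?_
    congr 1
    rw [hfd]
    change contractTime E k (fderiv ℝ α (t, y) (0, v i)) (i.removeNth v) = _
    rw [contractTime_apply]
    congr 1
    funext j
    refine Fin.cases ?_ (fun j => ?_) j
    · simp [Fin.removeNth]
    · simp [Fin.removeNth, hw]
  refine (intervalIntegral.integral_congr fun t _ => h2 t).trans ?_
  -- The integrand is now a t-derivative, so the fundamental theorem of calculus leaves the two
  -- endpoint values.
  have h4 : ∀ t : ℝ, HasDerivAt (fun s : ℝ => α (s, y) w) (fderiv ℝ α (t, y) (1, 0) w) t := by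
    intro t
    have h5 : HasDerivAt (fun s : ℝ => α (s, y)) (fderiv ℝ α (t, y) (1, 0)) t := by
      have h6 : HasFDerivAt (fun s : ℝ => (s, y)) (ContinuousLinearMap.inl ℝ ℝ E) t :=
        hasFDerivAt_prodMk_left t y
      exact ((hdα t).hasFDerivAt.comp t h6).hasDerivAt
    exact ((ContinuousAlternatingMap.apply ℝ (ℝ × E) ℝ w).hasFDerivAt.comp_hasDerivAt t h5)
  rw [intervalIntegral.integral_eq_sub_of_hasDerivAt (fun t _ => h4 t)]
  refine Continuous.intervalIntegrable ?_ _ _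
  exact (ContinuousAlternatingMap.apply ℝ (ℝ × E) ℝ w).continuous.comp
    (hdc.clm_apply continuous_const)

end HomotopyOperator

/-! ### The homotopy operator on a manifold. -/

section Poincare

variable {E : Type u} [NormedAddCommGroup E] [NormedSpace ℝ E]
  {M : Type v} [TopologicalSpace M] [ChartedSpace E M] [IsManifold 𝓘(ℝ, E) ∞ M] {k : ℕ}

/-- The contraction of `G^* η` with `∂/∂t` at `(t, x)`, restricted to `T_x M`. -/
noncomputable def homotopyIntegrand (G : ℝ × M → M) (η : DForm E M (k + 1)) (x : M) (t : ℝ) :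
    E [⋀^Fin k]→L[ℝ] ℝ :=
  contractTime E k ((η (G (t, x)) : E [⋀^Fin (k + 1)]→L[ℝ] ℝ).compContinuousLinearMap
    (mfderiv (𝓘(ℝ, ℝ).prod 𝓘(ℝ, E)) 𝓘(ℝ, E) G (t, x) : ℝ × E →L[ℝ] E))

/-- The homotopy operator on forms defined by `G`. -/
noncomputable def homotopyForm (G : ℝ × M → M) (η : DForm E M (k + 1)) : DForm E M k :=
  fun x => (∫ t in (0 : ℝ)..1, homotopyIntegrand G η x t : E [⋀^Fin k]→L[ℝ] ℝ)

/-- A homotopy read in a chart of the source. -/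
noncomputable def homotopyInChart (G : ℝ × M → M) (x₀ : M) : ℝ × E → M :=
  fun q => G (q.1, (extChartAt 𝓘(ℝ, E) x₀).symm q.2)

variable {G : ℝ × M → M} (hG : ContMDiff (𝓘(ℝ, ℝ).prod 𝓘(ℝ, E)) 𝓘(ℝ, E) ∞ G)
  {η : DForm E M (k + 1)}

include hG

theorem contMDiffAt_homotopyInChart (x₀ : M) (t : ℝ) {y : E}
    (hy : y ∈ (extChartAt 𝓘(ℝ, E) x₀).target) :
    ContMDiffAt 𝓘(ℝ, ℝ × E) 𝓘(ℝ, E) ∞ (homotopyInChart (E := E) G x₀) (t, y) := by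
  have h1 : ContMDiffAt 𝓘(ℝ, ℝ × E) 𝓘(ℝ, ℝ) ∞ (Prod.fst : ℝ × E → ℝ) (t, y) :=
    contDiffAt_fst.contMDiffAt
  have h2 : ContMDiffAt 𝓘(ℝ, ℝ × E) 𝓘(ℝ, E) ∞ (Prod.snd : ℝ × E → E) (t, y) :=
    contDiffAt_snd.contMDiffAt
  have h3 : ContMDiffAt 𝓘(ℝ, ℝ × E) 𝓘(ℝ, E) ∞
      (fun q : ℝ × E => (extChartAt 𝓘(ℝ, E) x₀).symm q.2) (t, y) :=
    ContMDiffAt.comp (t, y) (contMDiffAt_extChartAt_symm (by exact hy)) h2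
  exact (hG _).comp (t, y) (h1.prodMk h3)

theorem mfderiv_homotopyInChart (x₀ : M) (t : ℝ) {y : E}
    (hy : y ∈ (extChartAt 𝓘(ℝ, E) x₀).target) (w : ℝ × E) :
    (mfderiv 𝓘(ℝ, ℝ × E) 𝓘(ℝ, E) (homotopyInChart (E := E) G x₀) (t, y) : ℝ × E →L[ℝ] E) w =
      (mfderiv (𝓘(ℝ, ℝ).prod 𝓘(ℝ, E)) 𝓘(ℝ, E) G (t, (extChartAt 𝓘(ℝ, E) x₀).symm y) :
        ℝ × E →L[ℝ] E)
        (w.1, (chartSymmDeriv x₀ y) w.2) := by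
  have h1 : HasMFDerivAt 𝓘(ℝ, ℝ × E) 𝓘(ℝ, ℝ) (Prod.fst : ℝ × E → ℝ) (t, y)
      (ContinuousLinearMap.fst ℝ ℝ E) := hasFDerivAt_fst.hasMFDerivAt
  have h2 : HasMFDerivAt 𝓘(ℝ, ℝ × E) 𝓘(ℝ, E) (Prod.snd : ℝ × E → E) (t, y)
      (ContinuousLinearMap.snd ℝ ℝ E) := hasFDerivAt_snd.hasMFDerivAt
  have h3 := HasMFDerivAt.comp (t, y)
    (mdifferentiableAt_extChartAt_symm (x₀ := x₀) (y := ((t, y) : ℝ × E).2) hy).hasMFDerivAt h2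
  have h4 := ((hG (t, (extChartAt 𝓘(ℝ, E) x₀).symm y)).mdifferentiableAt (by simp)).hasMFDerivAt
  have h5 := HasMFDerivAt.comp (t, y) (g := G) h4 (h1.prodMk h3)
  have h6 : mfderiv 𝓘(ℝ, ℝ × E) 𝓘(ℝ, E) (homotopyInChart (E := E) G x₀) (t, y) = _ := h5.mfderiv
  rw [h6]
  rfl

/-- A chart of M does not involve t, so contraction with ∂/∂t commutes with passing to the chart. -/
theorem contractTime_pullback_homotopyInChart (x₀ : M) (t : ℝ) {y : E}
    (hy : y ∈ (extChartAt 𝓘(ℝ, E) x₀).target) :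
    contractTime E k (η.pullbackModel (homotopyInChart G x₀) (t, y)) =
      (homotopyIntegrand G η ((extChartAt 𝓘(ℝ, E) x₀).symm y) t).compContinuousLinearMap
        (chartSymmDeriv x₀ y) := by
  ext v
  rw [contractTime_apply]
  change η (G (t, (extChartAt 𝓘(ℝ, E) x₀).symm y)) (fun i =>
    (mfderiv 𝓘(ℝ, ℝ × E) 𝓘(ℝ, E) (homotopyInChart (E := E) G x₀) (t, y) : ℝ × E →L[ℝ] E) _) =
    η (G (t, (extChartAt 𝓘(ℝ, E) x₀).symm y)) (fun i =>
    (mfderiv (𝓘(ℝ, ℝ).prod 𝓘(ℝ, E)) 𝓘(ℝ, E) G (t, (extChartAt 𝓘(ℝ, E) x₀).symm y) :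
        ℝ × E →L[ℝ] E) ((Fin.cons ((1, 0) : ℝ × E) fun i => ((0,
        (chartSymmDeriv x₀ y) (v i)) : ℝ × E)
          : Fin (k + 1) → ℝ × E) i))
  congr 1
  funext i
  rw [mfderiv_homotopyInChart hG x₀ t hy]
  congr 1
  refine Fin.cases ?_ (fun j => ?_) i
  · simp
    rfl
  · simp
    rfl

theorem contDiffOn_pullback_homotopyInChart (hη : η.IsSmooth) (x₀ : M) :
    ContDiffOn ℝ ∞ (η.pullbackModel (homotopyInChart (E := E) G x₀))
      (univ ×ˢ (extChartAt 𝓘(ℝ, E) x₀).target) := fun q hq =>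
  (hη.contDiffAt_pullback (contMDiffAt_homotopyInChart hG x₀ q.1 hq.2)).contDiffWithinAt

theorem continuous_homotopyIntegrand (hη : η.IsSmooth) (x : M) :
    Continuous (homotopyIntegrand G η x) := by
  have hx := mem_extChartAt_source (I := 𝓘(ℝ, E)) x
  have hy := (extChartAt 𝓘(ℝ, E) x).map_source hx
  have h1 : Continuous fun t : ℝ => contractTime E k
      (η.pullbackModel (homotopyInChart (E := E) G x) (t, extChartAt 𝓘(ℝ, E) x x)) := by
    refine (contractTime E k).continuous.comp ?_
    rw [← continuousOn_univ]
    exact (contDiffOn_pullback_homotopyInChart hG hη x).continuousOn.comp (by fun_prop)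
      fun t _ => ⟨mem_univ _, hy⟩
  have h2 : homotopyIntegrand G η x = fun t => ContinuousAlternatingMap.compContinuousLinearMapCLM
      (chartDeriv x x) (contractTime E k
        (η.pullbackModel (homotopyInChart (E := E) G x) (t, extChartAt 𝓘(ℝ, E) x x))) := by
    funext t
    rw [contractTime_pullback_homotopyInChart hG x t hy, (extChartAt 𝓘(ℝ, E) x).left_inv hx]
    ext v
    change homotopyIntegrand G η x t v = homotopyIntegrand G η x t (fun i =>
      chartSymmDeriv x (extChartAt 𝓘(ℝ, E) x x) (chartDeriv x x (v i)))
    simp only [chartSymmDeriv_chartDeriv hx]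
  rw [h2]
  exact ContinuousLinearMap.continuous _ |>.comp h1

/-- Pullback by the inverse chart is a fixed continuous linear map at y, so it passes under the
integral. The operator thereby becomes the one on ℝ × U. -/
theorem inChart_homotopyForm (hη : η.IsSmooth) (x₀ : M) {y : E}
    (hy : y ∈ (extChartAt 𝓘(ℝ, E) x₀).target) :
    (homotopyForm G η).inChart x₀ y = ∫ t in (0 : ℝ)..1, contractTime E k
      (η.pullbackModel (homotopyInChart (E := E) G x₀) (t, y)) := by
  simp only [contractTime_pullback_homotopyInChart hG x₀ _ hy]
  exact (ContinuousLinearMap.intervalIntegral_comp_comm (μ := MeasureTheory.volume)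
    (ContinuousAlternatingMap.compContinuousLinearMapCLM
      (chartSymmDeriv x₀ y))
    ((continuous_homotopyIntegrand hG hη _).intervalIntegrable 0 1)).symm

variable [FiniteDimensional ℝ E]

theorem homotopyForm_isSmooth (hη : η.IsSmooth) : (homotopyForm G η).IsSmooth := by
  intro x₀
  refine (contDiffOn_intervalIntegral_param (isOpen_extChartAt_target x₀)
    (f := fun q => contractTime E k (η.pullbackModel (homotopyInChart (E := E) G x₀) q)) ?_).congr
    fun y hy => inChart_homotopyForm hG hη x₀ hy
  exact (contractTime E k).contDiff.comp_contDiffOn (contDiffOn_pullback_homotopyInChart hG hη x₀)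

/-- The homotopy formula gives G₁^*η − G₀^*η. Here G₁ is the identity, and G₀ is constant, so it
kills forms of positive degree. -/
theorem d_homotopyForm (hη : η.IsSmooth) (hd : η.d = 0) {p : M} (h0 : ∀ x, G (0, x) = p)
    (h1 : ∀ x, G (1, x) = x) : (homotopyForm G η).d = η := by
  funext x
  have hx := mem_extChartAt_source (I := 𝓘(ℝ, E)) x
  have hy := (extChartAt 𝓘(ℝ, E) x).map_source hx
  set y := extChartAt 𝓘(ℝ, E) x x with hydef
  have hev : (homotopyForm G η).inChart x =ᶠ[𝓝 y] fun z => ∫ t in (0 : ℝ)..1, contractTime E k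
      (η.pullbackModel (homotopyInChart (E := E) G x) (t, z)) := by
    filter_upwards [(isOpen_extChartAt_target x).mem_nhds hy] with z hz
    exact inChart_homotopyForm hG hη x hz
  have hslice : ∀ (s : ℝ) (v : Fin (k + 1) → E),
      η.pullbackModel (homotopyInChart (E := E) G x) (s, y) (fun i => ((0, v i) : ℝ × E)) =
      η.pullbackModel (fun z => homotopyInChart (E := E) G x (s, z)) y v := by
    intro s v
    have hc := DForm.pullback_comp_apply (E := E) (M := E) (F := ℝ × E) (N := ℝ × E)
      (f := fun z : E => (s, z)) (g := homotopyInChart (E := E) G x) (x := y)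
      ((contMDiffAt_homotopyInChart hG x s hy).mdifferentiableAt (by simp))
      ((hasFDerivAt_prodMk_right s y).hasMFDerivAt.mdifferentiableAt) η
    have hc' : η.pullbackModel (fun z => homotopyInChart (E := E) G x (s, z)) y v =
      _ := congrArg (fun A : E [⋀^Fin (k + 1)]→L[ℝ] ℝ => A v) hc
    rw [hc']
    have hm : mfderiv 𝓘(ℝ, E) 𝓘(ℝ, ℝ × E) (fun z : E => (s, z)) y =
      ContinuousLinearMap.inr ℝ ℝ E := (hasFDerivAt_prodMk_right s y).hasMFDerivAt.mfderiv
    have := DForm.pullback_apply (E := E) (M := E) (F := ℝ × E) (N := ℝ × E)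
      (fun z : E => (s, z)) (DForm.pullback (homotopyInChart (E := E) G x) η) y v
    refine Eq.trans ?_ this.symm
    rw [hm]
    rfl
  have hext : ∀ v : Fin (k + 1) → E,
      extDeriv ((homotopyForm G η).inChart x) y v = η.inChart x y v := by
    intro v
    rw [hev.extDeriv_eq, extDeriv_integral_contractTime (isOpen_extChartAt_target x)
      (contDiffOn_pullback_homotopyInChart hG hη x) hy, hslice, hslice]
    · have e1 : (fun z => homotopyInChart (E := E) G x (1, z)) = (extChartAt 𝓘(ℝ, E) x).symm :=
        funext fun z => h1 _
      have e0 : (fun z => homotopyInChart (E := E) G x (0, z)) = fun _ => p :=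
        funext fun z => h0 _
      rw [e1, e0]
      have : η.pullbackModel (fun _ : E => p) y v = 0 := by
        change η p (fun i => mfderiv 𝓘(ℝ, E) 𝓘(ℝ, E) (fun _ : E => p) y (v i)) = 0
        rw [mfderiv_const]
        exact (η p).map_zero
      rw [this, sub_zero]
      rfl
    · intro t
      rw [hη.extDeriv_pullback (contMDiffAt_homotopyInChart hG x t hy), hd]
      rfl
  ext v
  have h2 : (homotopyForm G η).d x v = η.inChart x y
      (fun i => mfderiv 𝓘(ℝ, E) 𝓘(ℝ, E) (extChartAt 𝓘(ℝ, E) x) x (v i)) := hext _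
  rw [h2]
  have h3 := mfderiv_extChartAt_symm_comp hx
  change η ((extChartAt 𝓘(ℝ, E) x).symm y) (fun i =>
      ((mfderiv 𝓘(ℝ, E) 𝓘(ℝ, E) (extChartAt 𝓘(ℝ, E) x).symm (extChartAt 𝓘(ℝ, E) x x)).comp
      (mfderiv 𝓘(ℝ, E) 𝓘(ℝ, E) (extChartAt 𝓘(ℝ, E) x) x)) (v i)) = _
  rw [h3, hydef, (extChartAt 𝓘(ℝ, E) x).left_inv hx]
  rfl

end Poincare

/-! ### Exactness of closed forms on contractible manifolds. -/

section Exactness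

variable {E : Type u} [NormedAddCommGroup E] [NormedSpace ℝ E] [FiniteDimensional ℝ E]
  {M : Type v} [TopologicalSpace M] [T2Space M] [SecondCountableTopology M] [ChartedSpace E M]
  [IsManifold 𝓘(ℝ, E) ∞ M] [ContractibleSpace M] {k : ℕ}

/-- **Poincaré lemma**: closed forms of positive degree on a contractible manifold are exact. -/
theorem DForm.IsSmooth.exists_primitive {η : DForm E M (k + 1)} (hη : η.IsSmooth) (hd : η.d = 0) :
    ∃ θ : DForm E M k, θ.IsSmooth ∧ θ.d = η := by
  obtain ⟨G, p, hG, h0, h1⟩ := exists_smooth_contraction (E := E) (M := M)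
  exact ⟨homotopyForm G η, homotopyForm_isSmooth hG hη, d_homotopyForm hG hη hd h0 h1⟩

/-- Closed `1`-forms on a contractible manifold are differentials of functions. -/
theorem DForm.IsSmooth.exists_potential {η : DForm E M 1} (hη : η.IsSmooth) (hd : η.d = 0) :
    ∃ f : M → ℝ, ContMDiff 𝓘(ℝ, E) 𝓘(ℝ, ℝ) ∞ f ∧ DForm.ofFun f = η := by
  obtain ⟨ζ, hζ, hζd⟩ := hη.exists_primitive hd
  -- A 0-form takes the empty tuple, of which `0` is the only one, so evaluation there makes it a
  -- function.
  let f : M → ℝ := fun x => ζ x 0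
  have hchart : ∀ x₀ : M, ζ.inChart x₀ = fun y => ContinuousAlternatingMap.constOfIsEmpty ℝ E (Fin 0)
      ((f ∘ (extChartAt 𝓘(ℝ, E) x₀).symm) y) := by
    intro x₀
    funext y
    ext v
    change ζ ((extChartAt 𝓘(ℝ, E) x₀).symm y) _ = ζ ((extChartAt 𝓘(ℝ, E) x₀).symm y) 0
    congr 1
    exact Subsingleton.elim _ _
  have hfc : ∀ x₀ : M, ContDiffOn ℝ ∞ (f ∘ (extChartAt 𝓘(ℝ, E) x₀).symm)
      (extChartAt 𝓘(ℝ, E) x₀).target := by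
    intro x₀
    have h1 := hζ x₀
    rw [hchart] at h1
    have h2 := (ContinuousAlternatingMap.apply ℝ E ℝ (0 : Fin 0 → E)).contDiff.comp_contDiffOn h1
    exact h2
  have hf : ContMDiff 𝓘(ℝ, E) 𝓘(ℝ, ℝ) ∞ f := by
    intro x
    have hx := mem_extChartAt_source (I := 𝓘(ℝ, E)) x
    have hy := (extChartAt 𝓘(ℝ, E) x).map_source hx
    have h1 : ContMDiffAt 𝓘(ℝ, E) 𝓘(ℝ, ℝ) ∞ (f ∘ (extChartAt 𝓘(ℝ, E) x).symm)
        (extChartAt 𝓘(ℝ, E) x x) :=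
      ((hfc x).contDiffAt ((isOpen_extChartAt_target x).mem_nhds hy)).contMDiffAt
    refine (h1.comp x contMDiffAt_extChartAt).congr_of_eventuallyEq ?_
    filter_upwards [(isOpen_extChartAt_source x).mem_nhds hx] with z hz
    simp only [Function.comp_apply, (extChartAt 𝓘(ℝ, E) x).left_inv hz]
  refine ⟨f, hf, ?_⟩
  rw [← hζd]
  refine DForm.oneForm_ext fun x v => ?_
  have hx := mem_extChartAt_source (I := 𝓘(ℝ, E)) x
  have hy := (extChartAt 𝓘(ℝ, E) x).map_source hx
  rw [DForm.ofFun_apply, DForm.d, hchart, extDeriv_constOfIsEmpty, ← mfderiv_eq_fderiv]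
  have hc := mfderiv_comp (I := 𝓘(ℝ, E)) (I' := 𝓘(ℝ, E)) (I'' := 𝓘(ℝ, ℝ)) (extChartAt 𝓘(ℝ, E) x x)
    ((hf _).mdifferentiableAt (by simp)) (mdifferentiableAt_extChartAt_symm hy)
  rw [hc]
  have h3 := mfderiv_extChartAt_symm_comp hx
  change mfderiv 𝓘(ℝ, E) 𝓘(ℝ, ℝ) f x v = mfderiv 𝓘(ℝ, E) 𝓘(ℝ, ℝ) f
    ((extChartAt 𝓘(ℝ, E) x).symm (extChartAt 𝓘(ℝ, E) x x))
    (((mfderiv 𝓘(ℝ, E) 𝓘(ℝ, E) (extChartAt 𝓘(ℝ, E) x).symm (extChartAt 𝓘(ℝ, E) x x)).comp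
      (mfderiv 𝓘(ℝ, E) 𝓘(ℝ, E) (extChartAt 𝓘(ℝ, E) x) x)) v)
  rw [h3, (extChartAt 𝓘(ℝ, E) x).left_inv hx]
  rfl

end Exactness

/-! ### Smoothness of maps into a manifold with global coordinates (f, q). -/

section InverseFunction

variable {F : Type*} [NormedAddCommGroup F] [NormedSpace ℝ F] [FiniteDimensional ℝ F]
  {X : Type*} [TopologicalSpace X] [ChartedSpace F X] [IsManifold 𝓘(ℝ, F) ∞ X]
  {E : Type*} [NormedAddCommGroup E] [NormedSpace ℝ E] [FiniteDimensional ℝ E]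
  {W : Type*} [TopologicalSpace W] [ChartedSpace E W] [IsManifold 𝓘(ℝ, E) ∞ W]
  {EZ : Type*} [NormedAddCommGroup EZ] [NormedSpace ℝ EZ]
  {Z : Type*} [TopologicalSpace Z] [ChartedSpace EZ Z]

/-- Inverse function theorem: a map into `X` is smooth if its composition with an injective map
`(f, q) : X → ℝ × W` with invertible derivative is smooth. -/
theorem contMDiffAt_of_comp_injective {f : X → ℝ} {q : X → W}
    (hf : ContMDiff 𝓘(ℝ, F) 𝓘(ℝ, ℝ) ∞ f) (hq : ContMDiff 𝓘(ℝ, F) 𝓘(ℝ, E) ∞ q)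
    (hinj : ∀ x y, f x = f y → q x = q y → x = y) {u : Z → X} {z : Z}
    (hker : ∀ v : TangentSpace 𝓘(ℝ, F) (u z), mfderiv 𝓘(ℝ, F) 𝓘(ℝ, ℝ) f (u z) v = 0 →
      mfderiv 𝓘(ℝ, F) 𝓘(ℝ, E) q (u z) v = 0 → v = 0)
    (hsurj : ∀ (s : ℝ) (w : TangentSpace 𝓘(ℝ, E) (q (u z))), ∃ v : TangentSpace 𝓘(ℝ, F) (u z),
      mfderiv 𝓘(ℝ, F) 𝓘(ℝ, ℝ) f (u z) v = s ∧ mfderiv 𝓘(ℝ, F) 𝓘(ℝ, E) q (u z) v = w)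
    (hfu : ContMDiffAt 𝓘(ℝ, EZ) 𝓘(ℝ, ℝ) ∞ (f ∘ u) z)
    (hqu : ContMDiffAt 𝓘(ℝ, EZ) 𝓘(ℝ, E) ∞ (q ∘ u) z) :
    ContMDiffAt 𝓘(ℝ, EZ) 𝓘(ℝ, F) ∞ u z := by
  have : CompleteSpace F := FiniteDimensional.complete ℝ F
  have : CompleteSpace E := FiniteDimensional.complete ℝ E
  set x := u z with hx
  set e := extChartAt 𝓘(ℝ, F) x with he
  set c := extChartAt 𝓘(ℝ, E) (q x) with hc
  have hxs : x ∈ e.source := mem_extChartAt_source x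
  have hqs : q x ∈ c.source := mem_extChartAt_source (q x)
  have hex : e.symm (e x) = x := e.left_inv hxs
  have hy : e x ∈ e.target := e.map_source hxs
  have hsm : ContMDiffAt 𝓘(ℝ, F) 𝓘(ℝ, F) ∞ e.symm (e x) := contMDiffAt_extChartAt_symm hy
  -- the map `(f, q)` in charts
  set g : F → ℝ × E := fun y => (f (e.symm y), c (q (e.symm y))) with hg
  have hg1 : ContDiffAt ℝ ∞ (fun y => f (e.symm y)) (e x) :=
    ((hf _).comp (e x) hsm).contDiffAt
  have hqe : ContMDiffAt 𝓘(ℝ, F) 𝓘(ℝ, E) ∞ (fun y => q (e.symm y)) (e x) :=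
    (hq _).comp (e x) hsm
  have hg2 : ContDiffAt ℝ ∞ (fun y => c (q (e.symm y))) (e x) :=
    contDiffAt_extChartAt_comp hqe (by rw [hex]; exact hqs)
  have hgs : ContDiffAt ℝ ∞ g (e x) := hg1.prodMk hg2
  have hd1 : ∀ v, fderiv ℝ (fun y => f (e.symm y)) (e x) v =
      mfderiv 𝓘(ℝ, F) 𝓘(ℝ, ℝ) f x (chartSymmDeriv x (e x) v) := by
    intro v
    rw [← mfderiv_eq_fderiv]
    have := mfderiv_comp (I := 𝓘(ℝ, F)) (I' := 𝓘(ℝ, F)) (I'' := 𝓘(ℝ, ℝ)) (e x)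
      ((hf (e.symm (e x))).mdifferentiableAt (by simp)) (hsm.mdifferentiableAt (by simp))
    rw [hex] at this
    exact congrArg (fun A : F →L[ℝ] ℝ => A v) this
  have hd2 : ∀ v, fderiv ℝ (fun y => c (q (e.symm y))) (e x) v =
      chartDeriv (E := E) (q x) (q x) (mfderiv 𝓘(ℝ, F) 𝓘(ℝ, E) q x (chartSymmDeriv x (e x) v)) := by
    intro v
    rw [← mfderiv_eq_fderiv]
    have h1 := mfderiv_comp (I := 𝓘(ℝ, F)) (I' := 𝓘(ℝ, F)) (I'' := 𝓘(ℝ, E)) (e x)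
      ((hq (e.symm (e x))).mdifferentiableAt (by simp)) (hsm.mdifferentiableAt (by simp))
    have h2 := mfderiv_comp (I := 𝓘(ℝ, F)) (I' := 𝓘(ℝ, E)) (I'' := 𝓘(ℝ, E)) (g := c)
      (f := q ∘ e.symm) (e x)
      (mdifferentiableAt_extChartAt_of_mem (by simpa only [Function.comp_apply, hex] using hqs))
      (hqe.mdifferentiableAt (by simp))
    rw [h1] at h2
    simp only [Function.comp_apply] at h2
    rw [hex] at h2
    exact congrArg (fun A : F →L[ℝ] E => A v) h2
  set A : F →L[ℝ] ℝ × E := (fderiv ℝ (fun y => f (e.symm y)) (e x)).prod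
    (fderiv ℝ (fun y => c (q (e.symm y))) (e x)) with hA
  have hgA : HasFDerivAt g A (e x) :=
    (hg1.differentiableAt (by simp)).hasFDerivAt.prodMk (hg2.differentiableAt (by simp)).hasFDerivAt
  have hAker : LinearMap.ker A.toLinearMap = ⊥ := by
    rw [LinearMap.ker_eq_bot']
    intro v hv
    have h1 : fderiv ℝ (fun y => f (e.symm y)) (e x) v = 0 := congrArg Prod.fst hv
    have h2 : fderiv ℝ (fun y => c (q (e.symm y))) (e x) v = 0 := congrArg Prod.snd hv
    rw [hd1] at h1
    rw [hd2] at h2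
    have h3 := chartSymmDeriv_chartDeriv hqs
      (mfderiv 𝓘(ℝ, F) 𝓘(ℝ, E) q x (chartSymmDeriv x (e x) v))
    rw [h2, map_zero] at h3
    have h4 := chartDeriv_chartSymmDeriv hy v
    rw [hex, hker _ h1 h3.symm] at h4
    exact h4.symm.trans (map_zero _)
  have hArange : LinearMap.range A.toLinearMap = ⊤ := by
    rw [LinearMap.range_eq_top]
    rintro ⟨s, w⟩
    obtain ⟨v, hv1, hv2⟩ := hsurj s (chartSymmDeriv (q x) (c (q x)) w)
    refine ⟨chartDeriv x x v, ?_⟩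
    have h1 : chartSymmDeriv x (e x) (chartDeriv x x v) = v := chartSymmDeriv_chartDeriv hxs v
    refine Prod.ext ?_ ?_
    · refine (hd1 (chartDeriv x x v)).trans ?_
      rw [h1]
      exact hv1
    · refine (hd2 (chartDeriv x x v)).trans ?_
      rw [h1]
      refine (congrArg (chartDeriv (E := E) (q x) (q x)) hv2).trans ?_
      have := chartDeriv_chartSymmDeriv (c.map_source hqs) w
      rwa [c.left_inv hqs] at this
  set B := ContinuousLinearEquiv.ofBijective A hAker hArange with hB
  have hgB : HasFDerivAt g (B : F →L[ℝ] ℝ × E) (e x) := hgA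
  have hstrict := hgs.hasStrictFDerivAt' hgB (by simp)
  set h := hgs.localInverse hgB (by simp) with hh
  have hhs : ContDiffAt ℝ ∞ h (g (e x)) := hgs.to_localInverse hgB (by simp)
  have hhx : h (g (e x)) = e x := hgs.localInverse_apply_image hgB (by simp)
  have hright : ∀ᶠ p in 𝓝 (g (e x)), g (h p) = p := hstrict.eventually_right_inverse
  set r : Z → ℝ × E := fun z' => (f (u z'), c (q (u z'))) with hr
  have hrz : r z = g (e x) := by
    simp only [hr, hg, hex, ← hx]
  have hrs : ContMDiffAt 𝓘(ℝ, EZ) 𝓘(ℝ, ℝ × E) ∞ r z := by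
    refine ContMDiffAt.prodMk_space hfu ?_
    have hqs' : (q ∘ u) z ∈ (chartAt E (q x)).source := mem_chart_source E (q x)
    exact (contMDiffAt_extChartAt' hqs').comp z hqu
  have hrc : Tendsto r (𝓝 z) (𝓝 (g (e x))) := by
    rw [← hrz]
    exact hrs.continuousAt
  have hhr : Tendsto (fun z' => h (r z')) (𝓝 z) (𝓝 (e x)) := by
    rw [← hhx]
    exact hhs.continuousAt.tendsto.comp hrc
  -- Continuity of u is not presupposed: the local inverse produces a point with the same f and q as
  -- `u z'`, and global injectivity of (f, q) identifies the two.
  have hus : (fun z' => e.symm (h (r z'))) =ᶠ[𝓝 z] u := by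
    have hO : ∀ᶠ y in 𝓝 (e x), q (e.symm y) ∈ c.source := by
      refine hqe.continuousAt.eventually_mem ((isOpen_extChartAt_source (q x)).mem_nhds ?_)
      rw [hex]
      exact hqs
    have hO' : ∀ᶠ z' in 𝓝 z, q (u z') ∈ c.source :=
      hqu.continuousAt.eventually_mem ((isOpen_extChartAt_source (q x)).mem_nhds hqs)
    filter_upwards [hrc.eventually hright, hhr.eventually hO, hO'] with z' h1 h2 h3
    have h4 : f (e.symm (h (r z'))) = f (u z') := congrArg Prod.fst h1
    have h5 : c (q (e.symm (h (r z')))) = c (q (u z')) := congrArg Prod.snd h1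
    exact hinj _ _ h4 (c.injOn h2 h3 h5)
  refine ContMDiffAt.congr_of_eventuallyEq ?_ hus.symm
  have hh' : ContMDiffAt 𝓘(ℝ, EZ) 𝓘(ℝ, F) ∞ (fun z' => h (r z')) z :=
    ContMDiffAt.comp z (by rw [hrz]; exact hhs.contMDiffAt) hrs
  exact ContMDiffAt.comp z (by
    have : h (r z) = e x := by rw [hrz, hhx]
    rw [this]
    exact hsm) hh'

end InverseFunction

/-! ### Potentials on a Boothby–Wang fibration. -/

section BoothbyWangPotential

variable {F : Type*} [NormedAddCommGroup F] [NormedSpace ℝ F]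
  {X : Type*} [TopologicalSpace X] [ChartedSpace F X] [IsManifold 𝓘(ℝ, F) ∞ X]
  {E : Type*} [NormedAddCommGroup E] [NormedSpace ℝ E]
  {W : Type*} [TopologicalSpace W] [ChartedSpace E W] [IsManifold 𝓘(ℝ, E) ∞ W]
  {S : SasakiStructure F X} {φ : Flow ℝ X} {K : KaehlerStructure E W} {q : X → W}

/-- A horizontal vector which is annihilated by the projection vanishes. -/
theorem IsBoothbyWang.eq_zero (h : IsBoothbyWang S φ K q) {x : X} {v : TangentSpace 𝓘(ℝ, F) x}
    (hv : S.form x ![v] = 0) (hqv : mfderiv 𝓘(ℝ, F) 𝓘(ℝ, E) q x v = 0) : v = 0 := by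
  by_contra hne
  have hpos := S.pos x v hv hne
  rw [← h.curvature, DForm.pullback_apply] at hpos
  rw [ContinuousAlternatingMap.map_coord_zero _ 1 hqv] at hpos
  exact lt_irrefl _ hpos

theorem IsBoothbyWang.map_flow (h : IsBoothbyWang S φ K q) (t : ℝ) (x : X) : q (φ t x) = q x :=
  ((h.fibres x (φ t x)).mpr ⟨(t : FlowGroup φ), rfl⟩).symm

/-- q is constant along Reeb orbits; differentiate at t = 0. -/
theorem IsBoothbyWang.mfderiv_reeb (h : IsBoothbyWang S φ K q) (x : X) :
    mfderiv 𝓘(ℝ, F) 𝓘(ℝ, E) q x (S.reeb x) = 0 := by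
  have h1 := h.regular.flow.integral x 0
  have h2 := HasMFDerivAt.comp 0 ((h.smooth (φ 0 x)).mdifferentiableAt (by simp)).hasMFDerivAt h1
  have h3 : (q ∘ fun t => φ t x) = fun _ => q x := funext fun t => h.map_flow t x
  have h4 := h2.mfderiv
  rw [h3, mfderiv_const] at h4
  have h5 := congrArg (fun A : ℝ →L[ℝ] E => A 1) h4
  have h6 : (0 : E) = mfderiv 𝓘(ℝ, F) 𝓘(ℝ, E) q (φ 0 x) ((1 : ℝ) • S.reeb (φ 0 x)) := h5
  rw [one_smul, φ.map_zero_apply] at h6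
  exact h6.symm

/-- A potential of the contact form relative to a connection form `θ` on the base. -/
structure IsPotential (S : SasakiStructure F X) (q : X → W) (θ : DForm E W 1) (f : X → ℝ) :
    Prop where
  smooth : ContMDiff 𝓘(ℝ, F) 𝓘(ℝ, ℝ) ∞ f
  eq : DForm.ofFun f + DForm.pullback q θ = S.form

theorem IsPotential.form_apply {θ : DForm E W 1} {f : X → ℝ} (hf : IsPotential S q θ f) (x : X)
    (v : TangentSpace 𝓘(ℝ, F) x) : S.form x ![v] = funDeriv f x v +
      θ (q x) ![mfderiv 𝓘(ℝ, F) 𝓘(ℝ, E) q x v] := by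
  rw [← hf.eq]
  change funDeriv f x v + θ (q x) _ = _
  congr 2
  funext i
  fin_cases i
  rfl

theorem IsPotential.form_eq_of_mfderiv_eq_zero {θ : DForm E W 1} {f : X → ℝ}
    (hf : IsPotential S q θ f) {x : X} {v : TangentSpace 𝓘(ℝ, F) x}
    (hv : mfderiv 𝓘(ℝ, F) 𝓘(ℝ, E) q x v = 0) :
    S.form x ![v] = funDeriv f x v := by
  rw [hf.form_apply, hv, ContinuousAlternatingMap.map_coord_zero (θ (q x)) 0 rfl, add_zero]

/-- The form ω − q^*θ is closed because dω = q^*Ω = q^*dθ, and X is contractible. -/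
theorem IsBoothbyWang.exists_potential [FiniteDimensional ℝ F] [T2Space X]
    [SecondCountableTopology X] [ContractibleSpace X] (h : IsBoothbyWang S φ K q)
    {θ : DForm E W 1} (hθ : θ.IsSmooth) (hd : θ.d = K.Ω) :
    ∃ f : X → ℝ, IsPotential S q θ f := by
  have hp := hθ.pullback h.smooth
  obtain ⟨f, hf, hfe⟩ := (S.smooth_form.sub hp).exists_potential (by
    rw [S.smooth_form.d_sub hp, hθ.d_pullback h.smooth, hd, h.curvature, sub_self])
  exact ⟨f, hf, by rw [hfe, sub_add_cancel]⟩

variable {θ : DForm E W 1} {f : X → ℝ}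

theorem IsBoothbyWang.mfderiv_potential_reeb (h : IsBoothbyWang S φ K q)
    (hf : IsPotential S q θ f) (x : X) : funDeriv f x (S.reeb x) = 1 := by
  rw [← hf.form_eq_of_mfderiv_eq_zero (h.mfderiv_reeb x)]
  exact S.form_reeb x

/-- Along a Reeb orbit df(𝒜) = ω(𝒜) = 1, since q^*θ vanishes on vertical vectors. This makes f a
global fibre coordinate: periods are excluded, and (f, q) is a bijection onto ℝ × W. -/
theorem IsBoothbyWang.potential_flow (h : IsBoothbyWang S φ K q) (hf : IsPotential S q θ f)
    (t : ℝ) (x : X) : f (φ t x) = f x + t := by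
  have hder : ∀ s : ℝ, HasDerivAt (fun s => f (φ s x) - s) 0 s := by
    intro s
    have h1 := h.regular.flow.integral x s
    have h2 := HasMFDerivAt.comp s
      ((hf.smooth (φ s x)).mdifferentiableAt (by simp)).hasMFDerivAt h1
    have h3 : HasFDerivAt (fun s => f (φ s x))
        ((1 : ℝ →L[ℝ] ℝ).smulRight (funDeriv f (φ s x) (S.reeb (φ s x)))) s := by
      refine h2.hasFDerivAt.congr_fderiv ?_
      ext
      exact map_smul (funDeriv f (φ s x)) (1 : ℝ) (S.reeb (φ s x))
    have h5 := h3.hasDerivAt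
    rw [h.mfderiv_potential_reeb hf] at h5
    have h6 := h5.sub (hasDerivAt_id s)
    simp only [ContinuousLinearMap.smulRight_apply, one_apply_eq_self, smul_eq_mul,
      mul_one, sub_self] at h6
    exact h6
  have hconst := is_const_of_deriv_eq_zero (fun s => (hder s).differentiableAt)
    (fun s => (hder s).deriv) t 0
  rw [φ.map_zero_apply] at hconst
  linarith

theorem IsBoothbyWang.periods_eq_bot (h : IsBoothbyWang S φ K q) (hf : IsPotential S q θ f)
    [Nonempty X] : periods φ = ⊥ := by
  rw [eq_bot_iff]
  intro t ht
  obtain ⟨x⟩ := ‹Nonempty X›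
  have h1 := h.potential_flow hf t x
  rw [ht x] at h1
  rw [AddSubgroup.mem_bot]
  linarith

theorem IsBoothbyWang.potential_injective (h : IsBoothbyWang S φ K q) (hf : IsPotential S q θ f)
    (x y : X) (h1 : f x = f y) (h2 : q x = q y) : x = y := by
  obtain ⟨g, rfl⟩ := (h.fibres x y).mp h2
  induction g using QuotientAddGroup.induction_on with
  | H t =>
    rw [FlowGroup.mk_vadd] at h1 ⊢
    rw [h.potential_flow hf] at h1
    have : t = 0 := by linarith
    rw [this, φ.map_zero_apply]

theorem IsBoothbyWang.potential_bijective (h : IsBoothbyWang S φ K q) (hf : IsPotential S q θ f) :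
    Function.Bijective fun x => (f x, q x) := by
  refine ⟨fun x y hxy => h.potential_injective hf x y (congrArg Prod.fst hxy)
    (congrArg Prod.snd hxy), ?_⟩
  rintro ⟨s, w⟩
  obtain ⟨x, rfl⟩ := h.surjective w
  exact ⟨φ (s - f x) x, Prod.ext (by simp [h.potential_flow hf]) (h.map_flow _ x)⟩

variable [FiniteDimensional ℝ F] [FiniteDimensional ℝ E]

/-- The differential of (f, q) is bijective: on ker q_* the form df equals ω, and a vector with ω =
0 and q_* = 0 vanishes. -/
theorem IsBoothbyWang.contMDiff_of_comp (h : IsBoothbyWang S φ K q) (hf : IsPotential S q θ f)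
    {EZ : Type*} [NormedAddCommGroup EZ] [NormedSpace ℝ EZ]
    {Z : Type*} [TopologicalSpace Z] [ChartedSpace EZ Z] {u : Z → X}
    (hfu : ContMDiff 𝓘(ℝ, EZ) 𝓘(ℝ, ℝ) ∞ (f ∘ u)) (hqu : ContMDiff 𝓘(ℝ, EZ) 𝓘(ℝ, E) ∞ (q ∘ u)) :
    ContMDiff 𝓘(ℝ, EZ) 𝓘(ℝ, F) ∞ u := by
  intro z
  refine contMDiffAt_of_comp_injective hf.smooth h.smooth (h.potential_injective hf) ?_ ?_
    (hfu z) (hqu z)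
  · intro v h1 h2
    exact h.eq_zero ((hf.form_eq_of_mfderiv_eq_zero h2).trans h1) h2
  · intro s w
    obtain ⟨v, rfl⟩ := h.submersion (u z) w
    -- A multiple of the Reeb field adjusts df without changing q_*.
    refine ⟨v + (s - funDeriv f (u z) v) • S.reeb (u z), ?_, ?_⟩
    · change funDeriv f (u z) (v + (s - funDeriv f (u z) v) • S.reeb (u z)) = s
      rw [map_add, map_smul, h.mfderiv_potential_reeb hf, smul_eq_mul]
      ring
    · rw [map_add, map_smul, h.mfderiv_reeb, smul_zero, add_zero]

end BoothbyWangPotential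

/-! ### Uniqueness of the Sasaki manifold over W. -/

section Uniqueness

variable {F₁ : Type*} [NormedAddCommGroup F₁] [NormedSpace ℝ F₁]
  {X₁ : Type*} [TopologicalSpace X₁] [ChartedSpace F₁ X₁] [IsManifold 𝓘(ℝ, F₁) ∞ X₁]
  {F₂ : Type*} [NormedAddCommGroup F₂] [NormedSpace ℝ F₂]
  {X₂ : Type*} [TopologicalSpace X₂] [ChartedSpace F₂ X₂] [IsManifold 𝓘(ℝ, F₂) ∞ X₂]
  {E : Type*} [NormedAddCommGroup E] [NormedSpace ℝ E]
  {W : Type*} [TopologicalSpace W] [ChartedSpace E W] [IsManifold 𝓘(ℝ, E) ∞ W]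
  {S₁ : SasakiStructure F₁ X₁} {φ₁ : Flow ℝ X₁} {S₂ : SasakiStructure F₂ X₂} {φ₂ : Flow ℝ X₂}
  {K : KaehlerStructure E W} {q₁ : X₁ → W} {q₂ : X₂ → W}

/-- A diffeomorphism which preserves contact forms and covers the identity of the Kähler quotient
is a pseudo-Hermitian isometry. -/
theorem IsBoothbyWang.isPshIsometry (h₁ : IsBoothbyWang S₁ φ₁ K q₁) (h₂ : IsBoothbyWang S₂ φ₂ K q₂)
    (f : X₁ ≃ₘ^∞⟮𝓘(ℝ, F₁), 𝓘(ℝ, F₂)⟯ X₂) (hform : DForm.pullback f S₂.form = S₁.form)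
    (hq : q₂ ∘ f = q₁) : S₁.IsPshIsometry S₂ f := by
  refine ⟨hform, fun x v hv => ?_⟩
  subst hq
  have hform' : ∀ w : TangentSpace 𝓘(ℝ, F₁) x,
      S₂.form (f x) ![mfderiv 𝓘(ℝ, F₁) 𝓘(ℝ, F₂) f x w] = S₁.form x ![w] := by
    intro w
    rw [← hform, DForm.pullback_apply]
    congr 1
    funext i
    fin_cases i
    rfl
  have hcomp : ∀ w : TangentSpace 𝓘(ℝ, F₁) x, mfderiv 𝓘(ℝ, F₁) 𝓘(ℝ, E) (q₂ ∘ f) x w =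
      mfderiv 𝓘(ℝ, F₂) 𝓘(ℝ, E) q₂ (f x) (mfderiv 𝓘(ℝ, F₁) 𝓘(ℝ, F₂) f x w) := by
    intro w
    rw [mfderiv_comp x ((h₂.smooth _).mdifferentiableAt (by simp))
      ((f.contMDiff x).mdifferentiableAt (by simp))]
    rfl
  -- The difference of the two sides is horizontal and is annihilated by q₂, hence zero.
  rw [← sub_eq_zero]
  refine h₂.eq_zero ?_ ?_
  · rw [DForm.oneForm_sub, hform', S₁.J_mem, S₂.J_mem, sub_zero]
  · rw [map_sub, ← hcomp, h₁.holomorphic x v hv, h₂.holomorphic (f x) _ ((hform' v).trans hv), hcomp]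
    exact sub_self _

/-- Both potentials refer to the same θ, so the bijection matching (f₁, q₁) with (f₂, q₂) carries
df₂ + q₂^*θ to df₁ + q₁^*θ. -/
theorem IsBoothbyWang.exists_isPshIsometry [FiniteDimensional ℝ F₁] [FiniteDimensional ℝ F₂]
    [FiniteDimensional ℝ E] (h₁ : IsBoothbyWang S₁ φ₁ K q₁) (h₂ : IsBoothbyWang S₂ φ₂ K q₂)
    {θ : DForm E W 1} {f₁ : X₁ → ℝ} {f₂ : X₂ → ℝ} (hf₁ : IsPotential S₁ q₁ θ f₁)
    (hf₂ : IsPotential S₂ q₂ θ f₂) :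
    ∃ f : X₁ ≃ₘ^∞⟮𝓘(ℝ, F₁), 𝓘(ℝ, F₂)⟯ X₂, S₁.IsPshIsometry S₂ f := by
  let Φ₁ := Equiv.ofBijective _ (h₁.potential_bijective hf₁)
  let Φ₂ := Equiv.ofBijective _ (h₂.potential_bijective hf₂)
  let u : X₁ ≃ X₂ := Φ₁.trans Φ₂.symm
  have hu : ∀ x, (f₂ (u x), q₂ (u x)) = (f₁ x, q₁ x) := fun x => Φ₂.apply_symm_apply (Φ₁ x)
  have hfu : f₂ ∘ u = f₁ := funext fun x => congrArg Prod.fst (hu x)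
  have hqu : q₂ ∘ u = q₁ := funext fun x => congrArg Prod.snd (hu x)
  have hfu' : f₁ ∘ u.symm = f₂ := by
    rw [← hfu]
    funext x
    simp
  have hqu' : q₁ ∘ u.symm = q₂ := by
    rw [← hqu]
    funext x
    simp
  have hus : ContMDiff 𝓘(ℝ, F₁) 𝓘(ℝ, F₂) ∞ u := h₂.contMDiff_of_comp hf₂
    (by rw [hfu]; exact hf₁.smooth) (by rw [hqu]; exact h₁.smooth)
  have hus' : ContMDiff 𝓘(ℝ, F₂) 𝓘(ℝ, F₁) ∞ u.symm := h₁.contMDiff_of_comp hf₁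
    (by rw [hfu']; exact hf₂.smooth) (by rw [hqu']; exact h₂.smooth)
  let f : X₁ ≃ₘ^∞⟮𝓘(ℝ, F₁), 𝓘(ℝ, F₂)⟯ X₂ :=
    { toEquiv := u, contMDiff_toFun := hus, contMDiff_invFun := hus' }
  refine ⟨f, h₁.isPshIsometry h₂ f ?_ hqu⟩
  rw [← hf₁.eq, ← hf₂.eq]
  funext x
  have hux := (hus x).mdifferentiableAt (by simp : (∞ : WithTop ℕ∞) ≠ 0)
  have e1 := DForm.pullback_comp_apply (E := F₁) (M := X₁) (f := u) (g := f₂) (x := x)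
    ((hf₂.smooth _).mdifferentiableAt (by simp)) hux lineForm
  have e2 := DForm.pullback_comp_apply (E := F₁) (M := X₁) (f := u) (g := q₂) (x := x)
    ((h₂.smooth _).mdifferentiableAt (by simp)) hux θ
  rw [hfu] at e1
  rw [hqu] at e2
  change DForm.pullback u (DForm.pullback f₂ lineForm) x + DForm.pullback u (DForm.pullback q₂ θ) x
    = DForm.pullback f₁ lineForm x + DForm.pullback q₁ θ x
  rw [e1, e2]

end Uniqueness

/-! ### The structure group as a topological group. -/

section Fibre

theorem flowGroup_equiv_real {X : Type*} [TopologicalSpace X] {φ : Flow ℝ X}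
    (h : periods φ = ⊥) : Nonempty (FlowGroup φ ≃ₜ+ ℝ) := by
  have hinj : Function.Injective (QuotientAddGroup.mk : ℝ → FlowGroup φ) := by
    intro s t hst
    have h1 : -s + t ∈ periods φ := QuotientAddGroup.eq.mp hst
    rw [h, AddSubgroup.mem_bot] at h1
    linarith
  let e : ℝ ≃+ FlowGroup φ :=
    AddEquiv.ofBijective (QuotientAddGroup.mk' (periods φ)) ⟨hinj, QuotientAddGroup.mk_surjective⟩
  have hcont : Continuous e := QuotientAddGroup.continuous_mk
  have hopen : IsOpenMap e := QuotientAddGroup.isOpenMap_coe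
  exact ⟨ContinuousAddEquiv.symm
    { e with
      continuous_toFun := hcont
      continuous_invFun := (Equiv.toHomeomorphOfContinuousOpen e.toEquiv hcont hopen).symm.continuous }⟩

end Fibre

/-! ### Vector fields, endomorphism fields and Lie brackets in charts. -/

section FieldsInCharts

variable {E : Type*} [NormedAddCommGroup E] [NormedSpace ℝ E]
  {M : Type*} [TopologicalSpace M] [ChartedSpace E M]

/-- The expression of a vector field in the preferred chart around `x₀`. -/
noncomputable def VField.inChart (U : VField E M) (x₀ : M) (y : E) : E :=
  chartDeriv (E := E) x₀ ((extChartAt 𝓘(ℝ, E) x₀).symm y) (U ((extChartAt 𝓘(ℝ, E) x₀).symm y))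

/-- The expression of a field of endomorphisms in the preferred chart around `x₀`. -/
noncomputable def EndField.inChart (J : EndField E M) (x₀ : M) (y : E) : E →L[ℝ] E :=
  (chartDeriv (E := E) x₀ ((extChartAt 𝓘(ℝ, E) x₀).symm y)).comp
    (ContinuousLinearMap.comp (J ((extChartAt 𝓘(ℝ, E) x₀).symm y) : E →L[ℝ] E)
      (chartSymmDeriv (E := E) x₀ y))

variable [IsManifold 𝓘(ℝ, E) ∞ M]

/-- Smoothness at the centre of a chart can be read off in the chart. -/
theorem contMDiffAt_iff_contDiffAt_extChartAt_symm {F : Type*} [NormedAddCommGroup F]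
    [NormedSpace ℝ F] {f : M → F} {x₀ : M} :
    ContMDiffAt 𝓘(ℝ, E) 𝓘(ℝ, F) ∞ f x₀ ↔
      ContDiffAt ℝ ∞ (fun y => f ((extChartAt 𝓘(ℝ, E) x₀).symm y)) (extChartAt 𝓘(ℝ, E) x₀ x₀) := by
  constructor
  · intro h
    refine ContMDiffAt.contDiffAt ?_
    refine ContMDiffAt.comp _ ?_ (contMDiffAt_extChartAt_symm (mem_extChartAt_target x₀))
    rwa [extChartAt_to_inv]
  · intro h
    have h1 : ContMDiffAt 𝓘(ℝ, E) 𝓘(ℝ, F) ∞ ((fun y => f ((extChartAt 𝓘(ℝ, E) x₀).symm y)) ∘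
        extChartAt 𝓘(ℝ, E) x₀) x₀ :=
      ContMDiffAt.comp x₀ h.contMDiffAt contMDiffAt_extChartAt
    refine h1.congr_of_eventuallyEq ?_
    filter_upwards [extChartAt_source_mem_nhds (I := 𝓘(ℝ, E)) x₀] with z hz
    exact congrArg f ((extChartAt 𝓘(ℝ, E) x₀).left_inv hz).symm

theorem trivializationAt_tangent_snd {x₀ x : M} (hx : x ∈ (extChartAt 𝓘(ℝ, E) x₀).source)
    (v : TangentSpace 𝓘(ℝ, E) x) :
    (trivializationAt E (TangentSpace 𝓘(ℝ, E)) x₀ (⟨x, v⟩ : TangentBundle 𝓘(ℝ, E) M)).2 =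
      chartDeriv (E := E) x₀ x v := by
  have hx' : x ∈ (chartAt E x₀).source := by simpa using hx
  have : IsManifold 𝓘(ℝ, E) 1 M := IsManifold.of_le (n := ∞) (by exact_mod_cast le_top)
  have h1 := TangentBundle.continuousLinearMapAt_trivializationAt (I := 𝓘(ℝ, E)) hx'
  have h2 := (trivializationAt E (TangentSpace 𝓘(ℝ, E)) x₀).continuousLinearMapAt_apply_of_mem
    (R := ℝ) (b := x) hx' v
  rw [← h2]
  exact congrArg (fun A : E →L[ℝ] E => A v) h1

theorem VField.contMDiffAt_iff (U : VField E M) {x₀ x : M}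
    (hx : x ∈ (extChartAt 𝓘(ℝ, E) x₀).source) :
    ContMDiffAt 𝓘(ℝ, E) 𝓘(ℝ, E).tangent ∞ (fun x => (⟨x, U x⟩ : TangentBundle 𝓘(ℝ, E) M)) x ↔
      ContMDiffAt 𝓘(ℝ, E) 𝓘(ℝ, E) ∞ (fun z => chartDeriv (E := E) x₀ z (U z)) x := by
  have hx' : x ∈ (trivializationAt E (TangentSpace 𝓘(ℝ, E)) x₀).baseSet := by simpa using hx
  refine ((trivializationAt E (TangentSpace 𝓘(ℝ, E)) x₀).contMDiffAt_section_iff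
    (n := ∞) (IB := 𝓘(ℝ, E)) (s := U) hx').trans ?_
  refine Filter.EventuallyEq.contMDiffAt_iff ?_
  filter_upwards [(isOpen_extChartAt_source x₀).mem_nhds hx] with z hz
  exact trivializationAt_tangent_snd hz _

/-- Testing at chart centres suffices, as every point is the centre of its own preferred chart. -/
theorem VField.isSmooth_iff (U : VField E M) : U.IsSmooth ↔
    ∀ x₀ : M, ContDiffAt ℝ ∞ (U.inChart x₀) (extChartAt 𝓘(ℝ, E) x₀ x₀) := by
  refine forall_congr' fun x₀ => ?_
  rw [U.contMDiffAt_iff (mem_extChartAt_source x₀)]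
  exact contMDiffAt_iff_contDiffAt_extChartAt_symm

theorem EndField.isSmooth_iff (J : EndField E M) : J.IsSmooth ↔
    ∀ x₀ : M, ContDiffAt ℝ ∞ (J.inChart x₀) (extChartAt 𝓘(ℝ, E) x₀ x₀) := by
  refine forall_congr' fun x₀ => ?_
  have : IsManifold 𝓘(ℝ, E) 1 M := IsManifold.of_le (n := ∞) (by exact_mod_cast le_top)
  rw [contMDiffAt_hom_bundle]
  refine (and_iff_right contMDiffAt_id).trans ?_
  refine contMDiffAt_iff_contDiffAt_extChartAt_symm.trans ?_
  suffices h : (fun y => ContinuousLinearMap.inCoordinates E (TangentSpace 𝓘(ℝ, E)) E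
      (TangentSpace 𝓘(ℝ, E)) x₀ ((extChartAt 𝓘(ℝ, E) x₀).symm y) x₀
        ((extChartAt 𝓘(ℝ, E) x₀).symm y) (J ((extChartAt 𝓘(ℝ, E) x₀).symm y)))
      =ᶠ[𝓝 (extChartAt 𝓘(ℝ, E) x₀ x₀)] J.inChart x₀ from
    ⟨fun h' => h'.congr_of_eventuallyEq h.symm, fun h' => h'.congr_of_eventuallyEq h⟩
  filter_upwards [extChartAt_target_mem_nhds (I := 𝓘(ℝ, E)) x₀] with y hy
  have hx := (extChartAt 𝓘(ℝ, E) x₀).map_target hy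
  have hx' : (extChartAt 𝓘(ℝ, E) x₀).symm y ∈ (chartAt E x₀).source := by simpa using hx
  have h1 := TangentBundle.continuousLinearMapAt_trivializationAt (I := 𝓘(ℝ, E)) hx'
  have h2 := TangentBundle.symmL_trivializationAt (I := 𝓘(ℝ, E)) hx'
  rw [modelWithCornersSelf_coe, range_id, mfderivWithin_univ,
    (extChartAt 𝓘(ℝ, E) x₀).right_inv hy] at h2
  simp only [ContinuousLinearMap.inCoordinates]
  ext v
  have h2' := congrArg (fun A : E →L[ℝ] E => A v) h2
  have h1' (w : E) := congrArg (fun A : E →L[ℝ] E => A w) h1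
  refine (h1' _).trans ?_
  exact congrArg (fun w : E => chartDeriv (E := E) x₀ ((extChartAt 𝓘(ℝ, E) x₀).symm y)
    ((J ((extChartAt 𝓘(ℝ, E) x₀).symm y) : E →L[ℝ] E) w)) h2'

theorem chartDeriv_injective {x₀ x : M} (hx : x ∈ (extChartAt 𝓘(ℝ, E) x₀).source) :
    Function.Injective (chartDeriv (E := E) x₀ x) :=
  Function.LeftInverse.injective (chartSymmDeriv_chartDeriv hx)

theorem mfderiv_extChartAt_inverse {x₀ x : M} (hx : x ∈ (extChartAt 𝓘(ℝ, E) x₀).source) :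
    (mfderiv 𝓘(ℝ, E) 𝓘(ℝ, E) (extChartAt 𝓘(ℝ, E) x₀) x).inverse =
      chartSymmDeriv (E := E) x₀ (extChartAt 𝓘(ℝ, E) x₀ x) := by
  refine ContinuousLinearMap.inverse_eq ?_ (mfderiv_extChartAt_symm_comp hx)
  have := mfderiv_extChartAt_comp_symm ((extChartAt 𝓘(ℝ, E) x₀).map_source hx)
  rwa [(extChartAt 𝓘(ℝ, E) x₀).left_inv hx] at this

theorem mfderiv_extChartAt_symm_inverse {x₀ : M} {y : E}
    (hy : y ∈ (extChartAt 𝓘(ℝ, E) x₀).target) :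
    (mfderiv 𝓘(ℝ, E) 𝓘(ℝ, E) (extChartAt 𝓘(ℝ, E) x₀).symm y).inverse =
      chartDeriv (E := E) x₀ ((extChartAt 𝓘(ℝ, E) x₀).symm y) := by
  refine ContinuousLinearMap.inverse_eq ?_ (mfderiv_extChartAt_comp_symm hy)
  have := mfderiv_extChartAt_symm_comp ((extChartAt 𝓘(ℝ, E) x₀).map_target hy)
  rwa [(extChartAt 𝓘(ℝ, E) x₀).right_inv hy] at this

/-- The Lie bracket of vector fields, computed in a chart. -/
theorem chartDeriv_bracket (U V : VField E M) (x : M) :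
    chartDeriv (E := E) x x (bracket U V x) =
      VectorField.lieBracket ℝ (U.inChart x) (V.inChart x) (extChartAt 𝓘(ℝ, E) x x) := by
  have hpull (Z : VField E M) : VectorField.mpullbackWithin 𝓘(ℝ, E) 𝓘(ℝ, E)
      (extChartAt 𝓘(ℝ, E) x).symm Z (range 𝓘(ℝ, E)) =ᶠ[𝓝 (extChartAt 𝓘(ℝ, E) x x)]
        Z.inChart x := by
    filter_upwards [extChartAt_target_mem_nhds (I := 𝓘(ℝ, E)) x] with y hy
    rw [VectorField.mpullbackWithin_apply, modelWithCornersSelf_coe, range_id, mfderivWithin_univ,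
      mfderiv_extChartAt_symm_inverse hy]
    rfl
  have h1 : bracket U V x = chartSymmDeriv (E := E) x (extChartAt 𝓘(ℝ, E) x x)
      (VectorField.lieBracket ℝ (U.inChart x) (V.inChart x) (extChartAt 𝓘(ℝ, E) x x)) := by
    rw [bracket, ← VectorField.mlieBracketWithin_univ, VectorField.mlieBracketWithin_apply,
      mfderiv_extChartAt_inverse (mem_extChartAt_source x)]
    congr 1
    have key (A B : E → E) (hA : A =ᶠ[𝓝 (extChartAt 𝓘(ℝ, E) x x)] U.inChart x)
        (hB : B =ᶠ[𝓝 (extChartAt 𝓘(ℝ, E) x x)] V.inChart x) :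
        VectorField.lieBracketWithin ℝ A B univ (extChartAt 𝓘(ℝ, E) x x) =
          VectorField.lieBracket ℝ (U.inChart x) (V.inChart x) (extChartAt 𝓘(ℝ, E) x x) := by
      rw [VectorField.lieBracketWithin_univ]
      exact hA.lieBracket_vectorField_eq hB
    rw [preimage_univ, univ_inter]
    have hr : range 𝓘(ℝ, E) = univ := by rw [modelWithCornersSelf_coe, range_id]
    have := key _ _ (hpull U) (hpull V)
    rw [← hr] at this
    exact this
  rw [h1]
  have h2 := chartDeriv_chartSymmDeriv (mem_extChartAt_target (I := 𝓘(ℝ, E)) x)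
    (VectorField.lieBracket ℝ (U.inChart x) (V.inChart x) (extChartAt 𝓘(ℝ, E) x x))
  rwa [extChartAt_to_inv] at h2

theorem EndField.inChart_chartDeriv (J : EndField E M) {x₀ x : M}
    (hx : x ∈ (extChartAt 𝓘(ℝ, E) x₀).source) (v : TangentSpace 𝓘(ℝ, E) x) :
    J.inChart x₀ (extChartAt 𝓘(ℝ, E) x₀ x) (chartDeriv (E := E) x₀ x v) = chartDeriv (E := E) x₀ x (J x v) := by
  -- `A` hides the dependence of the tangent space on its base point, so that `left_inv` can be
  -- rewritten.
  let A (z : M) (w : E) : E := chartDeriv (E := E) x₀ z ((J z : E →L[ℝ] E) w)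
  change A ((extChartAt 𝓘(ℝ, E) x₀).symm (extChartAt 𝓘(ℝ, E) x₀ x))
    (chartSymmDeriv (E := E) x₀ (extChartAt 𝓘(ℝ, E) x₀ x) (chartDeriv (E := E) x₀ x v)) = A x v
  rw [(extChartAt 𝓘(ℝ, E) x₀).left_inv hx]
  exact congrArg (A x) (chartSymmDeriv_chartDeriv hx v)

theorem EndField.inChart_app (J : EndField E M) (U : VField E M) (x₀ : M) {y : E}
    (hy : y ∈ (extChartAt 𝓘(ℝ, E) x₀).target) :
    (J.app U).inChart x₀ y = J.inChart x₀ y (U.inChart x₀ y) := by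
  have h := J.inChart_chartDeriv ((extChartAt 𝓘(ℝ, E) x₀).map_target hy)
    (U ((extChartAt 𝓘(ℝ, E) x₀).symm y))
  rw [(extChartAt 𝓘(ℝ, E) x₀).right_inv hy] at h
  exact h.symm

theorem EndField.IsSmooth.app {J : EndField E M} (hJ : J.IsSmooth) {U : VField E M}
    (hU : U.IsSmooth) : (J.app U).IsSmooth := by
  rw [VField.isSmooth_iff] at hU ⊢
  rw [EndField.isSmooth_iff] at hJ
  intro x₀
  refine ((hJ x₀).clm_apply (hU x₀)).congr_of_eventuallyEq ?_
  filter_upwards [extChartAt_target_mem_nhds (I := 𝓘(ℝ, E)) x₀] with y hy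
  exact J.inChart_app U x₀ hy

/-- Every tangent vector extends to a smooth vector field which is constant in the chart. -/
theorem exists_isSmooth_inChart_eventuallyEq [FiniteDimensional ℝ E] [T2Space M] (x₀ : M) (u : E) :
    ∃ U : VField E M, U.IsSmooth ∧ U.inChart x₀ =ᶠ[𝓝 (extChartAt 𝓘(ℝ, E) x₀ x₀)] fun _ => u := by
  obtain ⟨ρ⟩ : Nonempty (SmoothBumpFunction 𝓘(ℝ, E) x₀) := inferInstance
  let U : VField E M := fun z => ρ z • (chartSymmDeriv (E := E) x₀ (extChartAt 𝓘(ℝ, E) x₀ z) u : E)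
  have hU (z : M) (hz : z ∈ (extChartAt 𝓘(ℝ, E) x₀).source) :
      chartDeriv (E := E) x₀ z (U z) = ρ z • u := by
    have h := chartDeriv_chartSymmDeriv ((extChartAt 𝓘(ℝ, E) x₀).map_source hz) u
    rw [(extChartAt 𝓘(ℝ, E) x₀).left_inv hz] at h
    refine (map_smul (chartDeriv (E := E) x₀ z) (ρ z) _).trans ?_
    rw [h]
  refine ⟨U, fun z => ?_, ?_⟩
  · by_cases hz : z ∈ tsupport ρ
    · have hz' : z ∈ (extChartAt 𝓘(ℝ, E) x₀).source := ρ.tsupport_subset_extChartAt_source hz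
      rw [U.contMDiffAt_iff hz']
      have h1 : ContMDiffAt 𝓘(ℝ, E) 𝓘(ℝ, E) ∞ (fun z => ρ z • u) z :=
        ρ.contMDiffAt.smul contMDiffAt_const
      refine h1.congr_of_eventuallyEq ?_
      filter_upwards [(isOpen_extChartAt_source x₀).mem_nhds hz'] with w hw
      exact hU w hw
    · have h0 := (Bundle.contMDiff_zeroSection ℝ (F := E) (IB := 𝓘(ℝ, E)) (n := ∞)
        (TangentSpace 𝓘(ℝ, E) : M → Type _)) z
      refine h0.congr_of_eventuallyEq ?_
      filter_upwards [(isClosed_tsupport ρ).isOpen_compl.mem_nhds hz] with w hw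
      have : ρ w = 0 := image_eq_zero_of_notMem_tsupport hw
      have hw0 : U w = 0 := by
        change ρ w • (_ : E) = 0
        rw [this, zero_smul]
      rw [hw0]
      rfl
  · have h1 : Tendsto (extChartAt 𝓘(ℝ, E) x₀).symm (𝓝 (extChartAt 𝓘(ℝ, E) x₀ x₀)) (𝓝 x₀) := by
      have := (continuousAt_extChartAt_symm (I := 𝓘(ℝ, E)) x₀).tendsto
      rwa [extChartAt_to_inv] at this
    filter_upwards [extChartAt_target_mem_nhds (I := 𝓘(ℝ, E)) x₀,
      h1.eventually ρ.eventuallyEq_one] with y hy hρ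
    refine (hU _ ((extChartAt 𝓘(ℝ, E) x₀).map_target hy)).trans ?_
    rw [hρ]
    exact one_smul ℝ u

end FieldsInCharts

/-! ### The Nijenhuis tensor and its pointwise form. -/

section Nijenhuis

variable {E : Type*} [NormedAddCommGroup E] [NormedSpace ℝ E]

/-- The tensorial part of the Nijenhuis tensor of a field of endomorphisms of a vector space. -/
noncomputable def nijenhuis (J : E → E →L[ℝ] E) (y u v : E) : E :=
  fderiv ℝ J y (J y u) v - fderiv ℝ J y (J y v) u + J y (fderiv ℝ J y v u) - J y (fderiv ℝ J y u v)

/-- Derivatives of U and V survive only through [U, V]. The term [U, V] + J²[U, V] is kept because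
J² = −1 fails for the lift to ℝ × W, which kills the Reeb direction. -/
theorem lieBracket_nijenhuis {J : E → E →L[ℝ] E} {U V : E → E} {y : E}
    (hJ : DifferentiableAt ℝ J y) (hU : DifferentiableAt ℝ U y) (hV : DifferentiableAt ℝ V y) :
    VectorField.lieBracket ℝ (fun z => J z (U z)) (fun z => J z (V z)) y -
        VectorField.lieBracket ℝ U V y -
      J y (VectorField.lieBracket ℝ (fun z => J z (U z)) V y +
        VectorField.lieBracket ℝ U (fun z => J z (V z)) y) =
      nijenhuis J y (U y) (V y) - (VectorField.lieBracket ℝ U V y +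
        J y (J y (VectorField.lieBracket ℝ U V y))) := by
  have h (Z : E → E) (hZ : DifferentiableAt ℝ Z y) (w : E) :
      fderiv ℝ (fun z => J z (Z z)) y w = J y (fderiv ℝ Z y w) + fderiv ℝ J y w (Z y) := by
    rw [(hJ.hasFDerivAt.clm_apply hZ.hasFDerivAt).fderiv]
    simp
  simp only [VectorField.lieBracket, h U hU, h V hV, map_add, map_sub, nijenhuis]
  abel

end Nijenhuis

section NijenhuisInChart

variable {E : Type*} [NormedAddCommGroup E] [NormedSpace ℝ E]
  {M : Type*} [TopologicalSpace M] [ChartedSpace E M] [IsManifold 𝓘(ℝ, E) ∞ M]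

/-- The vector field expression whose vanishing expresses the integrability of `J`. -/
noncomputable def EndField.torsion (J : EndField E M) (U V : VField E M) (x : M) :
    TangentSpace 𝓘(ℝ, E) x :=
  bracket (J.app U) (J.app V) x - bracket U V x -
    J x (bracket (J.app U) V x + bracket U (J.app V) x)

theorem EndField.IsSmooth.chartDeriv_torsion {J : EndField E M} (hJ : J.IsSmooth) {U V : VField E M}
    (hU : U.IsSmooth) (hV : V.IsSmooth) (x : M) :
    chartDeriv (E := E) x x (J.torsion U V x) =
      nijenhuis (J.inChart x) (extChartAt 𝓘(ℝ, E) x x) (chartDeriv (E := E) x x (U x))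
        (chartDeriv (E := E) x x (V x)) -
      (chartDeriv (E := E) x x (bracket U V x) +
        chartDeriv (E := E) x x (J x (J x (bracket U V x)))) := by
  rw [EndField.isSmooth_iff] at hJ
  rw [VField.isSmooth_iff] at hU hV
  have hx := mem_extChartAt_source (I := 𝓘(ℝ, E)) x
  have happ (Z : VField E M) : (J.app Z).inChart x =ᶠ[𝓝 (extChartAt 𝓘(ℝ, E) x x)]
      fun y => J.inChart x y (Z.inChart x y) := by
    filter_upwards [extChartAt_target_mem_nhds (I := 𝓘(ℝ, E)) x] with y hy
    exact J.inChart_app Z x hy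
  have hval (Z : VField E M) : Z.inChart x (extChartAt 𝓘(ℝ, E) x x) =
      chartDeriv (E := E) x x (Z x) := by
    rw [VField.inChart, extChartAt_to_inv]
  have key := lieBracket_nijenhuis ((hJ x).differentiableAt (by simp))
    ((hU x).differentiableAt (by simp)) ((hV x).differentiableAt (by simp))
  rw [← (happ U).lieBracket_vectorField_eq (happ V),
    ← (happ U).lieBracket_vectorField_eq (EventuallyEq.refl _ (V.inChart x)),
    ← (EventuallyEq.refl _ (U.inChart x)).lieBracket_vectorField_eq (happ V),
    ← chartDeriv_bracket, ← chartDeriv_bracket, ← chartDeriv_bracket, ← chartDeriv_bracket,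
    hval, hval] at key
  rw [J.inChart_chartDeriv hx, J.inChart_chartDeriv hx] at key
  rw [← key]
  have h2 := J.inChart_chartDeriv hx (bracket (J.app U) V x + bracket U (J.app V) x)
  have h1 (a b : E) := map_sub (chartDeriv (E := E) x x) a b
  have h3 (a b : E) := map_add (chartDeriv (E := E) x x) a b
  refine (h1 _ _).trans ?_
  refine congrArg₂ _ (h1 _ _) (h2.symm.trans ?_)
  exact congrArg _ (h3 _ _)

/-- Integrability is stated for global fields. Extending two vectors to smooth fields constant in
the chart turns it into a pointwise identity. -/
theorem KaehlerStructure.nijenhuis_eq_zero [FiniteDimensional ℝ E] [T2Space M]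
    (K : KaehlerStructure E M) (x : M) (u v : E) :
    nijenhuis (K.J.inChart x) (extChartAt 𝓘(ℝ, E) x x) u v = 0 := by
  obtain ⟨U, hU, hUx⟩ := exists_isSmooth_inChart_eventuallyEq x u
  obtain ⟨V, hV, hVx⟩ := exists_isSmooth_inChart_eventuallyEq x v
  have h := K.smooth_J.chartDeriv_torsion hU hV x
  have h0 : K.J.torsion U V x = 0 := by
    rw [EndField.torsion, K.integrable U V hU hV, sub_self]
  have hval (Z : VField E M) : Z.inChart x (extChartAt 𝓘(ℝ, E) x x) =
      chartDeriv (E := E) x x (Z x) := by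
    rw [VField.inChart, extChartAt_to_inv]
  rw [h0, K.J_sq, ← hval, ← hval, hUx.self_of_nhds, hVx.self_of_nhds] at h
  have h3 (a : E) := map_neg (chartDeriv (E := E) x x) a
  have h4 : chartDeriv (E := E) x x (-bracket U V x) =
    -chartDeriv (E := E) x x (bracket U V x) := h3 _
  rw [h4, add_neg_cancel, sub_zero] at h
  exact h.symm.trans (map_zero (chartDeriv (E := E) x x))

end NijenhuisInChart

/-! ### The exterior derivative of a 1-form on its kernel. -/

section ExteriorDerivativeOfKernelFields

variable {E : Type*} [NormedAddCommGroup E] [NormedSpace ℝ E]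
  {M : Type*} [TopologicalSpace M] [ChartedSpace E M] [IsManifold 𝓘(ℝ, E) ∞ M]

theorem DForm.inChart_chartDeriv {k : ℕ} (η : DForm E M k) {x₀ x : M}
    (hx : x ∈ (extChartAt 𝓘(ℝ, E) x₀).source) (v : Fin k → TangentSpace 𝓘(ℝ, E) x) :
    η.inChart x₀ (extChartAt 𝓘(ℝ, E) x₀ x) (fun i => chartDeriv (E := E) x₀ x (v i)) = η x v := by
  let A (z : M) (w : Fin k → E) : ℝ := (η z : E [⋀^Fin k]→L[ℝ] ℝ) w
  change A ((extChartAt 𝓘(ℝ, E) x₀).symm (extChartAt 𝓘(ℝ, E) x₀ x)) (fun i =>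
    chartSymmDeriv (E := E) x₀ (extChartAt 𝓘(ℝ, E) x₀ x) (chartDeriv (E := E) x₀ x (v i))) = A x v
  rw [(extChartAt 𝓘(ℝ, E) x₀).left_inv hx]
  exact congrArg (A x) (funext fun i => chartSymmDeriv_chartDeriv hx (v i))

theorem DForm.inChart_inChart (η : DForm E M 1) (U : VField E M) {x₀ : M} {y : E}
    (hy : y ∈ (extChartAt 𝓘(ℝ, E) x₀).target) :
    η.inChart x₀ y ![U.inChart x₀ y] =
      η ((extChartAt 𝓘(ℝ, E) x₀).symm y) ![U ((extChartAt 𝓘(ℝ, E) x₀).symm y)] := by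
  have h := η.inChart_chartDeriv ((extChartAt 𝓘(ℝ, E) x₀).map_target hy)
    ![U ((extChartAt 𝓘(ℝ, E) x₀).symm y)]
  rw [(extChartAt 𝓘(ℝ, E) x₀).right_inv hy] at h
  rw [← h]
  congr 1
  funext i
  fin_cases i
  rfl

/-- The exterior derivative of a `1`-form on sections of its kernel. -/
theorem DForm.IsSmooth.d_apply_of_ker {η : DForm E M 1} (hη : η.IsSmooth) {U V : VField E M}
    (hU : U.IsSmooth) (hV : V.IsSmooth) (hηU : ∀ x, η x ![U x] = 0) (hηV : ∀ x, η x ![V x] = 0)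
    (x : M) : η.d x ![U x, V x] = -η x ![bracket U V x] := by
  rw [VField.isSmooth_iff] at hU hV
  have hx := mem_extChartAt_source (I := 𝓘(ℝ, E)) x
  have hval (Z : VField E M) : Z.inChart x (extChartAt 𝓘(ℝ, E) x x) =
      chartDeriv (E := E) x x (Z x) := by
    rw [VField.inChart, extChartAt_to_inv]
  -- η(U) and η(V) vanish identically, so in the formula for dη(U, V) only the bracket term remains.
  have hvan (Z : VField E M) (hZ : ∀ x, η x ![Z x] = 0) :
      (fun y => η.inChart x y ![Z.inChart x y]) =ᶠ[𝓝 (extChartAt 𝓘(ℝ, E) x x)] fun _ => 0 := by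
    filter_upwards [extChartAt_target_mem_nhds (I := 𝓘(ℝ, E)) x] with y hy
    rw [η.inChart_inChart Z hy, hZ]
  have key := extDeriv_apply_vectorField (V := ![U.inChart x, V.inChart x])
    (x := extChartAt 𝓘(ℝ, E) x x)
    ((hη.contDiffAt_inChart ((extChartAt 𝓘(ℝ, E) x).map_source hx)).differentiableAt (by simp))
    (by
      intro i
      fin_cases i
      · exact (hU x).differentiableAt (by simp)
      · exact (hV x).differentiableAt (by simp))
  have e0 : (fun y => η.inChart x y ((0 : Fin 2).removeNth fun i => ![U.inChart x, V.inChart x] i y))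
      = fun y => η.inChart x y ![V.inChart x y] := by
    funext y
    congr 1
    funext i
    fin_cases i
    rfl
  have e1 : (fun y => η.inChart x y ((1 : Fin 2).removeNth fun i => ![U.inChart x, V.inChart x] i y))
      = fun y => η.inChart x y ![U.inChart x y] := by
    funext y
    congr 1
    funext i
    fin_cases i
    rfl
  rw [Fin.sum_univ_two, e0, e1, (hvan V hηV).fderiv_eq, (hvan U hηU).fderiv_eq] at key
  have e2 : η.d x ![U x, V x] = extDeriv (η.inChart x) (extChartAt 𝓘(ℝ, E) x x)
      (fun i => ![U.inChart x, V.inChart x] i (extChartAt 𝓘(ℝ, E) x x)) := by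
    change extDeriv (η.inChart x) (extChartAt 𝓘(ℝ, E) x x) _ = _
    congr 1
    funext i
    fin_cases i
    · exact (hval U).symm
    · exact (hval V).symm
  rw [e2, key]
  have e3 := η.inChart_chartDeriv hx ![bracket U V x]
  have e4 : (fun i => chartDeriv (E := E) x x (![bracket U V x] i)) =
      ![VectorField.lieBracket ℝ (U.inChart x) (V.inChart x) (extChartAt 𝓘(ℝ, E) x x)] := by
    funext i
    fin_cases i
    exact chartDeriv_bracket U V x
  rw [← e3, e4]
  simp
  congr 1
  funext i
  fin_cases i
  rfl

end ExteriorDerivativeOfKernelFields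

/-! ### The product of a manifold with the real line -/

/-- The product of `W` with the real line. -/
def LineProd (W : Type*) : Type _ := ℝ × W

namespace LineProd

instance {W : Type*} [TopologicalSpace W] : TopologicalSpace (LineProd W) :=
  inferInstanceAs (TopologicalSpace (ℝ × W))

instance {W : Type*} [TopologicalSpace W] [T2Space W] : T2Space (LineProd W) :=
  inferInstanceAs (T2Space (ℝ × W))

instance {W : Type*} [TopologicalSpace W] [SecondCountableTopology W] :
    SecondCountableTopology (LineProd W) :=
  inferInstanceAs (SecondCountableTopology (ℝ × W))

instance {W : Type*} [TopologicalSpace W] [ContractibleSpace W] :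
    ContractibleSpace (LineProd W) :=
  inferInstanceAs (ContractibleSpace (ℝ × W))

/-- The projection to the real line. -/
def height {W : Type*} (p : LineProd W) : ℝ := Prod.fst p

/-- The projection to the base. -/
def base {W : Type*} (p : LineProd W) : W := Prod.snd p

/-- The point with given height and base point. -/
def mk {W : Type*} (t : ℝ) (x : W) : LineProd W := (t, x)

@[simp] theorem height_mk {W : Type*} (t : ℝ) (x : W) : (mk t x).height = t := rfl

@[simp] theorem base_mk {W : Type*} (t : ℝ) (x : W) : (mk t x).base = x := rfl

variable {E : Type*} [NormedAddCommGroup E] [NormedSpace ℝ E]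
  {W : Type*} [TopologicalSpace W] [ChartedSpace E W]

theorem continuous_height : Continuous (height : LineProd W → ℝ) := continuous_fst

theorem continuous_base : Continuous (base : LineProd W → W) := continuous_snd

theorem continuous_mk {Z : Type*} [TopologicalSpace Z] {a : Z → ℝ} {b : Z → W}
    (ha : Continuous a) (hb : Continuous b) : Continuous fun z => mk (a z) (b z) := ha.prodMk hb

instance : ChartedSpace (ℝ × E) (LineProd W) :=
  inferInstanceAs (ChartedSpace (ModelProd ℝ E) (ℝ × W))

/-- The definitions of forms and Sasaki structures use `𝓘(ℝ, ℝ × E)`, whereas products carry `𝓘(ℝ,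
ℝ).prod 𝓘(ℝ, E)`; `modelWithCornersSelf_prod` transfers facts between them. -/
instance [IsManifold 𝓘(ℝ, E) ∞ W] : IsManifold 𝓘(ℝ, ℝ × E) ∞ (LineProd W) := by
  have h : IsManifold (𝓘(ℝ, ℝ).prod 𝓘(ℝ, E)) ∞ (ℝ × W) := inferInstance
  rw [← modelWithCornersSelf_prod] at h
  exact h

theorem mem_extChartAt_source_iff {p z : LineProd W} :
    z ∈ (extChartAt 𝓘(ℝ, ℝ × E) p).source ↔ z.base ∈ (extChartAt 𝓘(ℝ, E) p.base).source := by
  rw [extChartAt_source, extChartAt_source]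
  exact ⟨fun h => h.2, fun h => ⟨mem_univ _, h⟩⟩

theorem mem_extChartAt_target_iff {p : LineProd W} {y : ℝ × E} :
    y ∈ (extChartAt 𝓘(ℝ, ℝ × E) p).target ↔ y.2 ∈ (extChartAt 𝓘(ℝ, E) p.base).target := by
  simp only [extChartAt_target, modelWithCornersSelf_coe_symm, preimage_id, range_id,
    modelWithCornersSelf_coe, inter_univ]
  exact ⟨fun h => h.2, fun h => ⟨mem_univ _, h⟩⟩

variable [IsManifold 𝓘(ℝ, E) ∞ W]

theorem contMDiff_height : ContMDiff 𝓘(ℝ, ℝ × E) 𝓘(ℝ, ℝ) ∞ (height : LineProd W → ℝ) := by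
  have h : ContMDiff (𝓘(ℝ, ℝ).prod 𝓘(ℝ, E)) 𝓘(ℝ, ℝ) ∞ (Prod.fst : ℝ × W → ℝ) := contMDiff_fst
  rw [← modelWithCornersSelf_prod] at h
  exact h

theorem contMDiff_base : ContMDiff 𝓘(ℝ, ℝ × E) 𝓘(ℝ, E) ∞ (base : LineProd W → W) := by
  have h : ContMDiff (𝓘(ℝ, ℝ).prod 𝓘(ℝ, E)) 𝓘(ℝ, E) ∞ (Prod.snd : ℝ × W → W) := contMDiff_snd
  rw [← modelWithCornersSelf_prod] at h
  exact h

theorem contMDiff_mk {EZ : Type*} [NormedAddCommGroup EZ] [NormedSpace ℝ EZ] {HZ : Type*}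
    [TopologicalSpace HZ] {I : ModelWithCorners ℝ EZ HZ}
    {Z : Type*} [TopologicalSpace Z] [ChartedSpace HZ Z] {a : Z → ℝ} {b : Z → W}
    (ha : ContMDiff I 𝓘(ℝ, ℝ) ∞ a) (hb : ContMDiff I 𝓘(ℝ, E) ∞ b) :
    ContMDiff I 𝓘(ℝ, ℝ × E) ∞ fun z => mk (a z) (b z) := by
  have h : ContMDiff I (𝓘(ℝ, ℝ).prod 𝓘(ℝ, E)) ∞ fun z => (a z, b z) := ha.prodMk hb
  rw [← modelWithCornersSelf_prod] at h
  exact h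

theorem mfderiv_height (p : LineProd W) (v : TangentSpace 𝓘(ℝ, ℝ × E) p) :
    mfderiv 𝓘(ℝ, ℝ × E) 𝓘(ℝ, ℝ) (height : LineProd W → ℝ) p v = (v : ℝ × E).1 := by
  have h : mfderiv (𝓘(ℝ, ℝ).prod 𝓘(ℝ, E)) 𝓘(ℝ, ℝ) (Prod.fst : ℝ × W → ℝ) p =
    ContinuousLinearMap.fst ℝ ℝ E := mfderiv_fst
  rw [← modelWithCornersSelf_prod] at h
  exact congrArg (fun A : ℝ × E →L[ℝ] ℝ => A v) h

theorem mfderiv_base (p : LineProd W) (v : TangentSpace 𝓘(ℝ, ℝ × E) p) :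
    mfderiv 𝓘(ℝ, ℝ × E) 𝓘(ℝ, E) (base : LineProd W → W) p v = (v : ℝ × E).2 := by
  have h : mfderiv (𝓘(ℝ, ℝ).prod 𝓘(ℝ, E)) 𝓘(ℝ, E) (Prod.snd : ℝ × W → W) p =
    ContinuousLinearMap.snd ℝ ℝ E := mfderiv_snd
  rw [← modelWithCornersSelf_prod] at h
  exact congrArg (fun A : ℝ × E →L[ℝ] E => A v) h

end LineProd

namespace LineProd

variable {E : Type*} [NormedAddCommGroup E] [NormedSpace ℝ E]
  {W : Type*} [TopologicalSpace W] [ChartedSpace E W] [IsManifold 𝓘(ℝ, E) ∞ W]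

section MapsInto

variable {EZ : Type*} [NormedAddCommGroup EZ] [NormedSpace ℝ EZ]
  {Z : Type*} [TopologicalSpace Z] [ChartedSpace EZ Z]

theorem mfderiv_fst {f : Z → LineProd W} {z : Z}
    (hf : MDifferentiableAt 𝓘(ℝ, EZ) 𝓘(ℝ, ℝ × E) f z) (v : TangentSpace 𝓘(ℝ, EZ) z) :
    (mfderiv 𝓘(ℝ, EZ) 𝓘(ℝ, ℝ × E) f z v : ℝ × E).1 =
      mfderiv 𝓘(ℝ, EZ) 𝓘(ℝ, ℝ) (fun z => (f z).height) z v := by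
  have h := mfderiv_comp z ((contMDiff_height (f z)).mdifferentiableAt (by simp)) hf
  refine Eq.trans ?_ (congrArg (fun A : EZ →L[ℝ] ℝ => A v) h).symm
  exact (mfderiv_height (f z) _).symm

theorem mfderiv_snd {f : Z → LineProd W} {z : Z}
    (hf : MDifferentiableAt 𝓘(ℝ, EZ) 𝓘(ℝ, ℝ × E) f z) (v : TangentSpace 𝓘(ℝ, EZ) z) :
    (mfderiv 𝓘(ℝ, EZ) 𝓘(ℝ, ℝ × E) f z v : ℝ × E).2 =
      mfderiv 𝓘(ℝ, EZ) 𝓘(ℝ, E) (fun z => (f z).base) z v := by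
  have h := mfderiv_comp z ((contMDiff_base (f z)).mdifferentiableAt (by simp)) hf
  refine Eq.trans ?_ (congrArg (fun A : EZ →L[ℝ] E => A v) h).symm
  exact (mfderiv_base (f z) _).symm

end MapsInto

theorem chartSymmDeriv_apply {p : LineProd W} {y : ℝ × E}
    (hy : y ∈ (extChartAt 𝓘(ℝ, ℝ × E) p).target) (v : ℝ × E) :
    chartSymmDeriv p y v = (v.1, chartSymmDeriv p.base y.2 v.2) := by
  have hd := mdifferentiableAt_extChartAt_symm hy
  have hy2 := mem_extChartAt_target_iff.mp hy
  refine Prod.ext ?_ ?_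
  · refine (mfderiv_fst hd v).trans ?_
    have : (fun z => ((extChartAt 𝓘(ℝ, ℝ × E) p).symm z).height) = (Prod.fst : ℝ × E → ℝ) := rfl
    rw [this, mfderiv_eq_fderiv, fderiv_fst]
    rfl
  · refine (mfderiv_snd hd v).trans ?_
    have : (fun z => ((extChartAt 𝓘(ℝ, ℝ × E) p).symm z).base) =
      (extChartAt 𝓘(ℝ, E) p.base).symm ∘ (Prod.snd : ℝ × E → E) := rfl
    rw [this, mfderiv_comp y (mdifferentiableAt_extChartAt_symm hy2)
      differentiableAt_snd.mdifferentiableAt, mfderiv_eq_fderiv, fderiv_snd]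
    rfl

theorem chartDeriv_apply {p z : LineProd W} (hz : z ∈ (extChartAt 𝓘(ℝ, ℝ × E) p).source)
    (v : ℝ × E) : chartDeriv p z v = (v.1, chartDeriv p.base z.base v.2) := by
  have hz2 := mem_extChartAt_source_iff.mp hz
  refine (Function.LeftInverse.injective (g := chartDeriv (E := ℝ × E) p z)
    (f := chartSymmDeriv (E := ℝ × E) p (extChartAt 𝓘(ℝ, ℝ × E) p z)) (fun w => ?_)) ?_
  · have := chartDeriv_chartSymmDeriv ((extChartAt 𝓘(ℝ, ℝ × E) p).map_source hz) w
    rwa [(extChartAt 𝓘(ℝ, ℝ × E) p).left_inv hz] at this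
  · rw [chartSymmDeriv_chartDeriv hz,
      chartSymmDeriv_apply ((extChartAt 𝓘(ℝ, ℝ × E) p).map_source hz)]
    exact Prod.ext rfl (chartSymmDeriv_chartDeriv hz2 v.2).symm

end LineProd

/-! ### One-forms as linear forms, and lifts of tensors to ℝ × W. -/

section OneFormCLM

variable {E : Type*} [NormedAddCommGroup E] [NormedSpace ℝ E]

/-- An alternating form in one variable, as a linear form. -/
noncomputable def oneFormCLM : (E [⋀^Fin 1]→L[ℝ] ℝ) →L[ℝ] (E →L[ℝ] ℝ) :=
  ((ContinuousMultilinearMap.ofSubsingletonₗᵢ (G := E) (G' := ℝ) ℝ (0 : Fin 1)).symm.toContinuousLinearEquiv :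
    ContinuousMultilinearMap ℝ (fun _ : Fin 1 => E) ℝ →L[ℝ] (E →L[ℝ] ℝ)).comp
    (ContinuousAlternatingMap.toContinuousMultilinearMapCLM ℝ)

theorem oneFormCLM_apply (η : E [⋀^Fin 1]→L[ℝ] ℝ) (v : E) : oneFormCLM η v = η ![v] := by
  have : (fun _ : Fin 1 => v) = ![v] := by
    funext i
    fin_cases i
    rfl
  rw [← this]
  rfl

end OneFormCLM

namespace LineProd

variable {E : Type*} [NormedAddCommGroup E] [NormedSpace ℝ E]
  {W : Type*} [TopologicalSpace W] [ChartedSpace E W]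

/-- The contact form `dt + θ` on the product of `W` with the real line. -/
noncomputable def form (θ : DForm E W 1) : DForm (ℝ × E) (LineProd W) 1 :=
  DForm.ofFun height + DForm.pullback base θ

/-- The horizontal lift `(s, w) ↦ (-t (A w), A w)` of an endomorphism `A`. -/
noncomputable def liftModel (A : E →L[ℝ] E) (t : E →L[ℝ] ℝ) : ℝ × E →L[ℝ] ℝ × E :=
  ((-(t.comp A)).prod A).comp (ContinuousLinearMap.snd ℝ ℝ E)

theorem liftModel_apply (A : E →L[ℝ] E) (t : E →L[ℝ] ℝ) (v : ℝ × E) :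
    liftModel A t v = (-t (A v.2), A v.2) := rfl

/-- The horizontal lift of a field of endomorphisms. -/
noncomputable def liftEnd (θ : DForm E W 1) (J : EndField E W) : EndField (ℝ × E) (LineProd W) :=
  fun p => liftModel (J p.base : E →L[ℝ] E) (oneFormCLM (θ p.base : E [⋀^Fin 1]→L[ℝ] ℝ))

/-- The vertical unit vector field. -/
def vertical : VField (ℝ × E) (LineProd W) := fun _ => ((1, 0) : ℝ × E)

/-- The vertical component of a tangent vector. -/
def vert {p : LineProd W} (v : TangentSpace 𝓘(ℝ, ℝ × E) p) : ℝ := Prod.fst (v : ℝ × E)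

/-- The component of a tangent vector along the base. -/
def hor {p : LineProd W} (v : TangentSpace 𝓘(ℝ, ℝ × E) p) : TangentSpace 𝓘(ℝ, E) p.base :=
  Prod.snd (v : ℝ × E)

theorem tangent_ext {p : LineProd W} {v w : TangentSpace 𝓘(ℝ, ℝ × E) p} (h1 : vert v = vert w)
    (h2 : hor v = hor w) : v = w := Prod.ext h1 h2

theorem hor_sub {p : LineProd W} (v w : TangentSpace 𝓘(ℝ, ℝ × E) p) :
    hor (v - w) = hor v - hor w := rfl

theorem hor_vertical (p : LineProd W) : hor (vertical p : TangentSpace 𝓘(ℝ, ℝ × E) p) = 0 := rfl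

theorem hor_liftEnd (θ : DForm E W 1) (J : EndField E W) (p : LineProd W)
    (v : TangentSpace 𝓘(ℝ, ℝ × E) p) : hor (liftEnd θ J p v) = J p.base (hor v) := rfl

theorem vert_liftEnd (θ : DForm E W 1) (J : EndField E W) (p : LineProd W)
    (v : TangentSpace 𝓘(ℝ, ℝ × E) p) :
    vert (liftEnd θ J p v) = -θ p.base ![J p.base (hor v)] :=
  congrArg Neg.neg (oneFormCLM_apply (E := E) (θ p.base : E [⋀^Fin 1]→L[ℝ] ℝ) _)

theorem chartDeriv_snd [IsManifold 𝓘(ℝ, E) ∞ W] (p : LineProd W)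
    (v : TangentSpace 𝓘(ℝ, ℝ × E) p) :
    (chartDeriv (E := ℝ × E) p p v).2 = chartDeriv (E := E) p.base p.base (hor v) :=
  congrArg Prod.snd (chartDeriv_apply (mem_extChartAt_source p) v)

variable [IsManifold 𝓘(ℝ, E) ∞ W]

theorem mfderiv_base_eq_hor (p : LineProd W) (v : TangentSpace 𝓘(ℝ, ℝ × E) p) :
    mfderiv 𝓘(ℝ, ℝ × E) 𝓘(ℝ, E) (base : LineProd W → W) p v = hor v := mfderiv_base p v

theorem form_apply (θ : DForm E W 1) (p : LineProd W) (v : TangentSpace 𝓘(ℝ, ℝ × E) p) :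
    form θ p ![v] = vert v + θ p.base ![hor v] := by
  have h1 : form θ p ![v] = funDeriv height p v +
      θ p.base (fun i => mfderiv 𝓘(ℝ, ℝ × E) 𝓘(ℝ, E) (base : LineProd W → W) p (![v] i)) := rfl
  have h2 : funDeriv height p v = vert v := mfderiv_height p v
  rw [h1, h2]
  congr 2
  funext i
  fin_cases i
  exact mfderiv_base_eq_hor p v

/-- Used throughout to prove vector identities on ℝ × W: compare contact forms and base components
separately. -/
theorem eq_zero_of_form {θ : DForm E W 1} {p : LineProd W} {v : TangentSpace 𝓘(ℝ, ℝ × E) p}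
    (h1 : form θ p ![v] = 0) (h2 : hor v = 0) : v = 0 := by
  rw [form_apply, h2, ContinuousAlternatingMap.map_coord_zero (θ p.base) 0 rfl, add_zero] at h1
  exact tangent_ext h1 h2

theorem form_isSmooth {θ : DForm E W 1} (hθ : θ.IsSmooth) : (form θ).IsSmooth :=
  (DForm.ofFun_isSmooth contMDiff_height).add (hθ.pullback contMDiff_base)

theorem d_form {θ : DForm E W 1} (hθ : θ.IsSmooth) :
    (form θ).d = DForm.pullback base θ.d := by
  rw [form, (DForm.ofFun_isSmooth contMDiff_height).d_add (hθ.pullback contMDiff_base),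
    DForm.d_ofFun contMDiff_height, hθ.d_pullback contMDiff_base, zero_add]

theorem pullback_base_apply (η : DForm E W 2) (p : LineProd W)
    (u v : TangentSpace 𝓘(ℝ, ℝ × E) p) :
    DForm.pullback base η p ![u, v] = η p.base ![hor u, hor v] := by
  rw [DForm.pullback_apply]
  congr 1
  funext i
  fin_cases i
  · exact mfderiv_base_eq_hor p u
  · exact mfderiv_base_eq_hor p v

/-- Lifting commutes with charts. The right side involves only `y.2`, which gives smoothness and
invariance under vertical translation. -/
theorem liftEnd_inChart (θ : DForm E W 1) (J : EndField E W) {p : LineProd W} {y : ℝ × E}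
    (hy : y ∈ (extChartAt 𝓘(ℝ, ℝ × E) p).target) :
    (liftEnd θ J).inChart p y =
      liftModel (J.inChart p.base y.2) (oneFormCLM (θ.inChart p.base y.2)) := by
  have hy2 := mem_extChartAt_target_iff.mp hy
  have hz2 := (extChartAt 𝓘(ℝ, E) p.base).map_target hy2
  refine ContinuousLinearMap.ext fun v => ?_
  set z := (extChartAt 𝓘(ℝ, E) p.base).symm y.2 with hz
  have h1 : (liftEnd θ J).inChart p y v =
      chartDeriv (E := ℝ × E) p ((extChartAt 𝓘(ℝ, ℝ × E) p).symm y)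
        (liftModel (E := E) (J z : E →L[ℝ] E) (oneFormCLM (E := E) (θ z : E [⋀^Fin 1]→L[ℝ] ℝ))
          (chartSymmDeriv p y v)) := rfl
  rw [h1, chartDeriv_apply ((extChartAt 𝓘(ℝ, ℝ × E) p).map_target hy), chartSymmDeriv_apply hy,
    liftModel_apply]
  refine Prod.ext (congrArg Neg.neg ?_) rfl
  have h2 := θ.inChart_chartDeriv hz2 ![(J z : E →L[ℝ] E) (chartSymmDeriv p.base y.2 v.2)]
  rw [(extChartAt 𝓘(ℝ, E) p.base).right_inv hy2] at h2
  refine (oneFormCLM_apply (E := E) (θ z : E [⋀^Fin 1]→L[ℝ] ℝ) _).trans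
    (h2.symm.trans (Eq.trans (congrArg _ ?_) (oneFormCLM_apply _ _).symm))
  funext i
  fin_cases i
  rfl

theorem liftEnd_inChart_eventuallyEq (θ : DForm E W 1) (J : EndField E W) (p : LineProd W) :
    (liftEnd θ J).inChart p =ᶠ[𝓝 (extChartAt 𝓘(ℝ, ℝ × E) p p)] fun y =>
      liftModel (J.inChart p.base y.2) (oneFormCLM (θ.inChart p.base y.2)) := by
  filter_upwards [extChartAt_target_mem_nhds (I := 𝓘(ℝ, ℝ × E)) p] with y hy
  exact liftEnd_inChart θ J hy

theorem contDiff_liftModel :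
    ContDiff ℝ ∞ fun q : (E →L[ℝ] E) × (E →L[ℝ] ℝ) => liftModel q.1 q.2 := by
  have h : (fun q : (E →L[ℝ] E) × (E →L[ℝ] ℝ) => liftModel q.1 q.2) = fun q =>
      ((ContinuousLinearMap.inr ℝ ℝ E).comp q.1 -
        (ContinuousLinearMap.inl ℝ ℝ E).comp (q.2.comp q.1)).comp
          (ContinuousLinearMap.snd ℝ ℝ E) := by
    funext q
    refine ContinuousLinearMap.ext fun v => ?_
    refine Prod.ext ?_ ?_ <;> simp [liftModel]
  rw [h]
  fun_prop

theorem contDiffAt_liftModel {θ : DForm E W 1} (hθ : θ.IsSmooth) {J : EndField E W}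
    (hJ : J.IsSmooth) (x : W) :
    ContDiffAt ℝ ∞ (fun y => liftModel (J.inChart x y) (oneFormCLM (θ.inChart x y)))
      (extChartAt 𝓘(ℝ, E) x x) := by
  rw [EndField.isSmooth_iff] at hJ
  refine ContDiffAt.comp (g := fun q : (E →L[ℝ] E) × (E →L[ℝ] ℝ) => liftModel q.1 q.2)
    (f := fun y => (J.inChart x y, oneFormCLM (θ.inChart x y))) (extChartAt 𝓘(ℝ, E) x x)
    contDiff_liftModel.contDiffAt ((hJ x).prodMk ?_)
  exact oneFormCLM.contDiff.contDiffAt.comp _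
    (hθ.contDiffAt_inChart (mem_extChartAt_target x))

theorem liftEnd_isSmooth {θ : DForm E W 1} (hθ : θ.IsSmooth) {J : EndField E W}
    (hJ : J.IsSmooth) : (liftEnd θ J).IsSmooth := by
  rw [EndField.isSmooth_iff]
  intro p
  refine ContDiffAt.congr_of_eventuallyEq ?_ (liftEnd_inChart_eventuallyEq θ J p)
  exact (contDiffAt_liftModel hθ hJ p.base).comp (extChartAt 𝓘(ℝ, ℝ × E) p p) contDiffAt_snd

theorem vertical_inChart_eventuallyEq (p : LineProd W) :
    (vertical : VField (ℝ × E) (LineProd W)).inChart p =ᶠ[𝓝 (extChartAt 𝓘(ℝ, ℝ × E) p p)]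
      fun _ => ((1, 0) : ℝ × E) := by
  filter_upwards [extChartAt_target_mem_nhds (I := 𝓘(ℝ, ℝ × E)) p] with y hy
  refine (chartDeriv_apply ((extChartAt 𝓘(ℝ, ℝ × E) p).map_target hy) ((1, 0) : ℝ × E)).trans ?_
  exact Prod.ext rfl (map_zero _)

theorem vertical_isSmooth : (vertical : VField (ℝ × E) (LineProd W)).IsSmooth := by
  rw [VField.isSmooth_iff]
  intro p
  exact contDiffAt_const.congr_of_eventuallyEq (vertical_inChart_eventuallyEq p)

/-- The horizontal lift is invariant under vertical translations. -/
theorem bracket_vertical_liftEnd {θ : DForm E W 1} (hθ : θ.IsSmooth) {J : EndField E W}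
    (hJ : J.IsSmooth) {U : VField (ℝ × E) (LineProd W)} (hU : U.IsSmooth) (p : LineProd W) :
    bracket vertical ((liftEnd θ J).app U) p = liftEnd θ J p (bracket vertical U p) := by
  have hx := mem_extChartAt_source (I := 𝓘(ℝ, ℝ × E)) p
  rw [VField.isSmooth_iff] at hU
  set y := extChartAt 𝓘(ℝ, ℝ × E) p p with hy
  set G : E → ℝ × E →L[ℝ] ℝ × E :=
    fun y => liftModel (J.inChart p.base y) (oneFormCLM (θ.inChart p.base y)) with hG
  have hGd : DifferentiableAt ℝ G y.2 := (contDiffAt_liftModel hθ hJ p.base).differentiableAt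
    (by simp)
  have happ : ((liftEnd θ J).app U).inChart p =ᶠ[𝓝 y] fun z => G z.2 (U.inChart p z) := by
    filter_upwards [extChartAt_target_mem_nhds (I := 𝓘(ℝ, ℝ × E)) p] with z hz
    rw [(liftEnd θ J).inChart_app U p hz, liftEnd_inChart θ J hz]
  -- Bracketing with the constant field (1, 0) is differentiation in t, and the lifted endomorphism
  -- is independent of t.
  have hlb (Z : ℝ × E → ℝ × E) :
      VectorField.lieBracket ℝ (fun _ => ((1, 0) : ℝ × E)) Z y = fderiv ℝ Z y (1, 0) := by
    simp [VectorField.lieBracket]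
  refine chartDeriv_injective hx ?_
  rw [chartDeriv_bracket, ← (liftEnd θ J).inChart_chartDeriv hx, chartDeriv_bracket,
    (vertical_inChart_eventuallyEq p).lieBracket_vectorField_eq happ,
    (vertical_inChart_eventuallyEq p).lieBracket_vectorField_eq
      (EventuallyEq.refl _ (U.inChart p)), hlb, hlb,
    (liftEnd_inChart_eventuallyEq θ J p).self_of_nhds]
  have hG2 : HasFDerivAt (fun z : ℝ × E => G z.2)
      ((fderiv ℝ G y.2).comp (ContinuousLinearMap.snd ℝ ℝ E)) y :=
    hGd.hasFDerivAt.comp y hasFDerivAt_snd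
  have hUd : HasFDerivAt (U.inChart p) (fderiv ℝ (U.inChart p) y) y :=
    ((hU p).differentiableAt (by simp)).hasFDerivAt
  rw [(hG2.clm_apply hUd).fderiv]
  change _ = G y.2 (fderiv ℝ (U.inChart p) y (1, 0))
  simp

/-- The projection to the base intertwines the lift with J, hence also their derivatives and
Nijenhuis tensors. -/
theorem nijenhuis_liftEnd_snd {θ : DForm E W 1} (hθ : θ.IsSmooth) {J : EndField E W}
    (hJ : J.IsSmooth) (p : LineProd W) (u v : ℝ × E) :
    (nijenhuis ((liftEnd θ J).inChart p) (extChartAt 𝓘(ℝ, ℝ × E) p p) u v).2 =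
      nijenhuis (J.inChart p.base) (extChartAt 𝓘(ℝ, E) p.base p.base) u.2 v.2 := by
  set y := extChartAt 𝓘(ℝ, ℝ × E) p p with hy
  have hA : DifferentiableAt ℝ ((liftEnd θ J).inChart p) y :=
    (((EndField.isSmooth_iff _).mp (liftEnd_isSmooth hθ hJ)) p).differentiableAt (by simp)
  have hB : DifferentiableAt ℝ (J.inChart p.base) y.2 :=
    (((EndField.isSmooth_iff _).mp hJ) p.base).differentiableAt (by simp)
  have h0 (w : ℝ × E) : ((liftEnd θ J).inChart p y w).2 = J.inChart p.base y.2 w.2 := by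
    rw [(liftEnd_inChart_eventuallyEq θ J p).self_of_nhds]
    rfl
  have h1 (h w : ℝ × E) : (fderiv ℝ ((liftEnd θ J).inChart p) y h w).2 =
      fderiv ℝ (J.inChart p.base) y.2 h.2 w.2 := by
    have e1 : HasFDerivAt (fun z => ((liftEnd θ J).inChart p z w).2)
        ((ContinuousLinearMap.snd ℝ ℝ E).comp
          ((fderiv ℝ ((liftEnd θ J).inChart p) y).flip w)) y :=
      (ContinuousLinearMap.snd ℝ ℝ E).hasFDerivAt.comp y
        (by simpa using hA.hasFDerivAt.clm_apply (hasFDerivAt_const w y))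
    have e2 : HasFDerivAt (fun z : ℝ × E => J.inChart p.base z.2 w.2)
        (((fderiv ℝ (J.inChart p.base) y.2).flip w.2).comp (ContinuousLinearMap.snd ℝ ℝ E)) y :=
      HasFDerivAt.comp (g := fun z => J.inChart p.base z w.2) y
        (by simpa using hB.hasFDerivAt.clm_apply (hasFDerivAt_const w.2 y.2)) hasFDerivAt_snd
    have e3 : (fun z => ((liftEnd θ J).inChart p z w).2) =ᶠ[𝓝 y]
        fun z : ℝ × E => J.inChart p.base z.2 w.2 := by
      filter_upwards [liftEnd_inChart_eventuallyEq θ J p] with z hz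
      rw [hz]
      rfl
    have e4 := e1.unique (e2.congr_of_eventuallyEq e3)
    exact congrArg (fun A : ℝ × E →L[ℝ] E => A h) e4
  have hy2 : extChartAt 𝓘(ℝ, E) p.base p.base = y.2 := rfl
  simp only [nijenhuis, Prod.snd_add, Prod.snd_sub, h0, h1, hy2]

end LineProd

/-! ### The Sasaki structure on ℝ × W, its Reeb flow and its homogeneity. -/

namespace LineProd

variable {E : Type*} [NormedAddCommGroup E] [NormedSpace ℝ E]
  {W : Type*} [TopologicalSpace W] [ChartedSpace E W] [IsManifold 𝓘(ℝ, E) ∞ W]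

/-- The vertical component −θ(J w) of the lift is chosen to cancel θ(J w), whether or not v is
horizontal. -/
theorem form_liftEnd (θ : DForm E W 1) (J : EndField E W) (p : LineProd W)
    (v : TangentSpace 𝓘(ℝ, ℝ × E) p) : form θ p ![liftEnd θ J p v] = 0 := by
  rw [form_apply, vert_liftEnd, hor_liftEnd, neg_add_cancel]

section Structure

variable (K : KaehlerStructure E W) {θ : DForm E W 1}

theorem d_form_apply (hθ : θ.IsSmooth) (hd : θ.d = K.Ω) (p : LineProd W)
    (u v : TangentSpace 𝓘(ℝ, ℝ × E) p) : (form θ).d p ![u, v] = K.Ω p.base ![hor u, hor v] := by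
  rw [d_form hθ, hd, pullback_base_apply]

/-- The base component is the Nijenhuis tensor of W, which vanishes; the defect [U, V] + J²[U, V]
has no base component because J² = −1 on W. -/
theorem hor_torsion [FiniteDimensional ℝ E] [T2Space W] (hθ : θ.IsSmooth)
    {U V : VField (ℝ × E) (LineProd W)} (hU : U.IsSmooth) (hV : V.IsSmooth) (p : LineProd W) :
    hor ((liftEnd θ K.J).torsion U V p) = 0 := by
  have h := congrArg Prod.snd ((liftEnd_isSmooth hθ K.smooth_J).chartDeriv_torsion hU hV p)
  rw [chartDeriv_snd] at h
  simp only [Prod.snd_sub, Prod.snd_add] at h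
  rw [nijenhuis_liftEnd_snd hθ K.smooth_J, K.nijenhuis_eq_zero, chartDeriv_snd, chartDeriv_snd,
    hor_liftEnd, hor_liftEnd, K.J_sq] at h
  have h3 (a : E) := map_neg (chartDeriv (E := E) p.base p.base) a
  have h4 : chartDeriv (E := E) p.base p.base (-hor (bracket U V p)) =
    -chartDeriv (E := E) p.base p.base (hor (bracket U V p)) := h3 _
  rw [h4, add_neg_cancel, sub_zero] at h
  exact chartDeriv_injective (mem_extChartAt_source (I := 𝓘(ℝ, E)) p.base)
    (h.trans (map_zero (chartDeriv (E := E) p.base p.base)).symm)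

/-- On horizontal fields dω(U, V) = −ω([U, V]). So ω of the torsion is dω(U, V) − dω(JU, JV), which
vanishes because Ω is J-invariant; the last torsion term lies in the image of the lift, hence in ker
ω. -/
theorem form_torsion (hθ : θ.IsSmooth) (hd : θ.d = K.Ω)
    {U V : VField (ℝ × E) (LineProd W)} (hU : U.IsSmooth) (hV : V.IsSmooth)
    (hUk : ∀ p, form θ p ![U p] = 0) (hVk : ∀ p, form θ p ![V p] = 0) (p : LineProd W) :
    form θ p ![(liftEnd θ K.J).torsion U V p] = 0 := by
  have hJ := liftEnd_isSmooth hθ K.smooth_J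
  have h1 := (form_isSmooth hθ).d_apply_of_ker hU hV hUk hVk p
  have h2 := (form_isSmooth hθ).d_apply_of_ker (hJ.app hU) (hJ.app hV)
    (fun p => form_liftEnd θ K.J p (U p)) (fun p => form_liftEnd θ K.J p (V p)) p
  rw [d_form_apply K hθ hd] at h1 h2
  have h3 := K.hermitian p.base (hor (U p)) (hor (V p))
  have h4 : K.Ω p.base ![hor ((liftEnd θ K.J).app U p), hor ((liftEnd θ K.J).app V p)] =
    K.Ω p.base ![K.J p.base (hor (U p)), K.J p.base (hor (V p))] := rfl
  rw [EndField.torsion, DForm.oneForm_sub, DForm.oneForm_sub, form_liftEnd]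
  rw [h4] at h2
  linarith

/-- The Sasaki structure with contact form `dt + θ` on the product of a Kähler manifold with the
real line, where `θ` is a primitive of the Kähler form. -/
noncomputable def sasaki [FiniteDimensional ℝ E] [T2Space W] (hθ : θ.IsSmooth)
    (hd : θ.d = K.Ω) : SasakiStructure (ℝ × E) (LineProd W) where
  form := form θ
  J := liftEnd θ K.J
  reeb := vertical
  smooth_form := form_isSmooth hθ
  smooth_J := liftEnd_isSmooth hθ K.smooth_J
  smooth_reeb := vertical_isSmooth
  form_reeb p := by
    rw [form_apply, hor_vertical, ContinuousAlternatingMap.map_coord_zero (θ p.base) 0 rfl,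
      add_zero]
    rfl
  d_form_reeb p v := by
    rw [d_form_apply K hθ hd]
    exact ContinuousAlternatingMap.map_coord_zero _ 0 rfl
  J_reeb p := by
    refine eq_zero_of_form (form_liftEnd θ K.J p _) ?_
    rw [hor_liftEnd, hor_vertical, map_zero]
  J_mem p v := form_liftEnd θ K.J p v
  J_sq p v hv := by
    have hneg : form θ p ![liftEnd θ K.J p (liftEnd θ K.J p v) - (-v)] = 0 := by
      have h0 : form θ p ![(0 : TangentSpace 𝓘(ℝ, ℝ × E) p)] = 0 :=
        ContinuousAlternatingMap.map_coord_zero _ 0 rfl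
      have h1 := DForm.oneForm_sub (form θ) p 0 v
      rw [zero_sub] at h1
      rw [DForm.oneForm_sub, form_liftEnd, h1, h0, hv]
      simp
    refine sub_eq_zero.mp (eq_zero_of_form hneg ?_)
    rw [hor_sub, hor_liftEnd, hor_liftEnd, K.J_sq]
    exact sub_self (-hor v)
  hermitian p u v _ _ := by
    rw [d_form_apply K hθ hd, d_form_apply K hθ hd, hor_liftEnd, hor_liftEnd, K.hermitian]
  pos p u hu hne := by
    rw [d_form_apply K hθ hd, hor_liftEnd]
    exact K.pos p.base (hor u) fun h => hne (eq_zero_of_form hu h)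
  integrable U V hU hV hUk hVk p := by
    refine sub_eq_zero.mp ?_
    exact eq_zero_of_form (form_torsion K hθ hd hU hV hUk hVk p) (hor_torsion K hθ hU hV p)
  standard U hU p := bracket_vertical_liftEnd hθ K.smooth_J hU p

end Structure

section Translations

/-- The flow of vertical translations. -/
def translation (W : Type*) [TopologicalSpace W] : Flow ℝ (LineProd W) where
  toFun t p := mk (p.height + t) p.base
  cont' := continuous_mk ((continuous_height.comp continuous_snd).add continuous_fst)
    (continuous_base.comp continuous_snd)
  map_add' s t p := by
    change mk (p.height + (s + t)) p.base = mk (p.height + t + s) p.base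
    rw [add_comm s t, add_assoc]
  map_zero' p := by
    change mk (p.height + 0) p.base = p
    rw [add_zero]
    rfl

theorem translation_apply (t : ℝ) (p : LineProd W) :
    translation W t p = mk (p.height + t) p.base := rfl

theorem translation_free (g : FlowGroup (translation W)) (p : LineProd W) (h : g +ᵥ p = p) :
    g = 0 := by
  induction g using QuotientAddGroup.induction_on with
  | H t =>
    rw [FlowGroup.mk_vadd, translation_apply] at h
    have h1 : p.height + t = p.height := congrArg height h
    have h2 : t = 0 := by linarith
    rw [h2]
    rfl

/-- The group element is recovered continuously from a pair (g + p, p) as the height difference, so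
the action map is a closed embedding and therefore proper. -/
theorem translation_proper [T2Space W] : ProperVAdd (FlowGroup (translation W)) (LineProd W) := by
  refine ⟨Topology.IsClosedEmbedding.isProperMap ?_⟩
  refine Function.LeftInverse.isClosedEmbedding
    (f := fun ab : LineProd W × LineProd W =>
      ((QuotientAddGroup.mk (ab.1.height - ab.2.height) : FlowGroup (translation W)), ab.2))
    ?_ ?_ ?_
  · rintro ⟨g, p⟩
    induction g using QuotientAddGroup.induction_on with
    | H t =>
      refine Prod.ext ?_ rfl
      change QuotientAddGroup.mk (((t : FlowGroup (translation W)) +ᵥ p).height - p.height) = _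
      rw [FlowGroup.mk_vadd, translation_apply, height_mk, add_sub_cancel_left]
  · exact (QuotientAddGroup.continuous_mk.comp ((continuous_height.comp continuous_fst).sub
      (continuous_height.comp continuous_snd))).prodMk continuous_snd
  -- Continuity of the action of T is checked after pulling back along the open quotient map from ℝ.
  · rw [← (QuotientAddGroup.isOpenQuotientMap_mk.prodMap
      IsOpenQuotientMap.id).continuous_comp_iff]
    exact ((translation W).cont'.comp continuous_id).prodMk continuous_snd

theorem isMIntegralCurve_translation (p : LineProd W) :
    IsMIntegralCurve (I := 𝓘(ℝ, ℝ × E)) (fun t => translation W t p) vertical := by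
  intro t
  have hs : ContMDiff 𝓘(ℝ, ℝ) 𝓘(ℝ, ℝ × E) ∞ (fun t => mk (p.height + t) p.base) :=
    contMDiff_mk (contDiff_const.add contDiff_id).contMDiff contMDiff_const
  have hd := (hs t).mdifferentiableAt (by simp : (∞ : WithTop ℕ∞) ≠ 0)
  have h := hd.hasMFDerivAt
  have e : mfderiv 𝓘(ℝ, ℝ) 𝓘(ℝ, ℝ × E) (fun t => mk (p.height + t) p.base) t =
      ((1 : ℝ →L[ℝ] ℝ).smulRight ((1, 0) : ℝ × E)) := by
    refine ContinuousLinearMap.ext fun c => ?_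
    refine Prod.ext ?_ ?_
    · refine (mfderiv_fst hd c).trans ?_
      have : (fun t => (mk (p.height + t) p.base).height) = fun t => p.height + t := rfl
      rw [this, mfderiv_eq_fderiv, fderiv_const_add, fderiv_fun_id]
      exact (mul_one (M := ℝ) c).symm
    · refine (mfderiv_snd hd c).trans ?_
      have : (fun t : ℝ => (mk (p.height + t) p.base).base) = fun _ => p.base := rfl
      rw [this, mfderiv_const]
      exact (smul_zero (M := ℝ) (A := E) c).symm
  rw [e] at h
  exact h

variable [FiniteDimensional ℝ E] [T2Space W] (K : KaehlerStructure E W) {θ : DForm E W 1}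
  (hθ : θ.IsSmooth) (hd : θ.d = K.Ω)

theorem sasaki_isReebFlow : (sasaki K hθ hd).IsReebFlow (translation W) where
  smooth := contMDiff_mk ((contMDiff_height.comp contMDiff_snd).add contMDiff_fst)
    (contMDiff_base.comp contMDiff_snd)
  integral := isMIntegralCurve_translation

theorem sasaki_isBoothbyWang : IsBoothbyWang (sasaki K hθ hd) (translation W) K base where
  regular := ⟨sasaki_isReebFlow K hθ hd, translation_free, translation_proper⟩
  smooth := contMDiff_base
  surjective x := ⟨mk 0 x, rfl⟩
  submersion p w := ⟨((0, w) : ℝ × E), mfderiv_base p _⟩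
  fibres p p' := by
    constructor
    · intro h
      refine ⟨((p'.height - p.height : ℝ) : FlowGroup (translation W)), ?_⟩
      rw [FlowGroup.mk_vadd, translation_apply, h, add_sub_cancel]
      rfl
    · rintro ⟨g, rfl⟩
      induction g using QuotientAddGroup.induction_on
      rfl
  holomorphic p v _ := by
    rw [mfderiv_base_eq_hor, mfderiv_base_eq_hor]
    rfl
  curvature := by
    change _ = (form θ).d
    rw [d_form hθ, hd]

end Translations

section Homogeneity

variable (K : KaehlerStructure E W) {θ : DForm E W 1}

/-- The diffeomorphism `(t, x) ↦ (t - f x + c, h x)`. -/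
noncomputable def liftDiffeo (h : W ≃ₘ^∞⟮𝓘(ℝ, E), 𝓘(ℝ, E)⟯ W) {f : W → ℝ}
    (hf : ContMDiff 𝓘(ℝ, E) 𝓘(ℝ, ℝ) ∞ f) (c : ℝ) :
    LineProd W ≃ₘ^∞⟮𝓘(ℝ, ℝ × E), 𝓘(ℝ, ℝ × E)⟯ LineProd W where
  toFun p := mk (p.height - f p.base + c) (h p.base)
  invFun p := mk (p.height + f (h.symm p.base) - c) (h.symm p.base)
  left_inv p := by
    simp only [height_mk, base_mk, Diffeomorph.symm_apply_apply]
    rw [show p.height - f p.base + c + f p.base - c = p.height by ring]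
    rfl
  right_inv p := by
    simp only [height_mk, base_mk, Diffeomorph.apply_symm_apply]
    rw [show p.height + f (h.symm p.base) - c - f (h.symm p.base) + c = p.height by ring]
    rfl
  contMDiff_toFun := contMDiff_mk
    ((contMDiff_height.sub (hf.comp contMDiff_base)).add contMDiff_const)
    (h.contMDiff.comp contMDiff_base)
  contMDiff_invFun := contMDiff_mk
    ((contMDiff_height.add (hf.comp (h.symm.contMDiff.comp contMDiff_base))).sub contMDiff_const)
    (h.symm.contMDiff.comp contMDiff_base)

variable {h : W ≃ₘ^∞⟮𝓘(ℝ, E), 𝓘(ℝ, E)⟯ W} {f : W → ℝ} (hf : ContMDiff 𝓘(ℝ, E) 𝓘(ℝ, ℝ) ∞ f) (c : ℝ)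

theorem hor_mfderiv_liftDiffeo (p : LineProd W) (v : TangentSpace 𝓘(ℝ, ℝ × E) p) :
    hor (mfderiv 𝓘(ℝ, ℝ × E) 𝓘(ℝ, ℝ × E) (liftDiffeo h hf c) p v) =
      mfderiv 𝓘(ℝ, E) 𝓘(ℝ, E) h p.base (hor v) := by
  refine (mfderiv_snd (((liftDiffeo h hf c).contMDiff p).mdifferentiableAt (by simp)) v).trans ?_
  have : (fun p => (liftDiffeo h hf c p).base) = h ∘ base := rfl
  rw [this, mfderiv_comp p ((h.contMDiff _).mdifferentiableAt (by simp))
    ((contMDiff_base p).mdifferentiableAt (by simp))]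
  exact congrArg (mfderiv 𝓘(ℝ, E) 𝓘(ℝ, E) h p.base) (mfderiv_base_eq_hor p v)

theorem vert_mfderiv_liftDiffeo (p : LineProd W) (v : TangentSpace 𝓘(ℝ, ℝ × E) p) :
    vert (mfderiv 𝓘(ℝ, ℝ × E) 𝓘(ℝ, ℝ × E) (liftDiffeo h hf c) p v) =
      vert v - funDeriv f p.base (hor v) := by
  refine (mfderiv_fst (((liftDiffeo h hf c).contMDiff p).mdifferentiableAt (by simp)) v).trans ?_
  have hh := ((contMDiff_height (E := E) p).mdifferentiableAt
    (by simp : (∞ : WithTop ℕ∞) ≠ 0)).hasMFDerivAt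
  have hb := ((contMDiff_base (E := E) p).mdifferentiableAt
    (by simp : (∞ : WithTop ℕ∞) ≠ 0)).hasMFDerivAt
  have hfb := ((hf p.base).mdifferentiableAt
    (by simp : (∞ : WithTop ℕ∞) ≠ 0)).hasMFDerivAt.comp p hb
  have h1 := ((hh.sub hfb).add (hasMFDerivAt_const c p)).mfderiv
  refine (congrArg (fun A : ℝ × E →L[ℝ] ℝ => A v) h1).trans ?_
  have h2 : mfderiv 𝓘(ℝ, ℝ × E) 𝓘(ℝ, ℝ) (height : LineProd W → ℝ) p v = vert v :=
    mfderiv_height p v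
  have h3 := congrArg (funDeriv f p.base) (mfderiv_base_eq_hor p v)
  rw [← h2, ← h3]
  exact add_zero (_ : ℝ)

/-- The shift of height by −f contributes −df, which cancels the change h^*θ − θ of the connection
form. -/
theorem form_mfderiv_liftDiffeo (hfe : DForm.ofFun f = DForm.pullback h θ - θ) (p : LineProd W)
    (v : TangentSpace 𝓘(ℝ, ℝ × E) p) :
    form θ (liftDiffeo h hf c p)
      ![mfderiv 𝓘(ℝ, ℝ × E) 𝓘(ℝ, ℝ × E) (liftDiffeo h hf c) p v] = form θ p ![v] := by
  rw [form_apply, form_apply, hor_mfderiv_liftDiffeo, vert_mfderiv_liftDiffeo]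
  have h1 : funDeriv f p.base (hor v) =
      θ (h p.base) (fun i => mfderiv 𝓘(ℝ, E) 𝓘(ℝ, E) h p.base (![hor v] i)) -
        θ p.base ![hor v] := congrArg (fun η : DForm E W 1 => η p.base ![hor v]) hfe
  have h2 : (fun i => mfderiv 𝓘(ℝ, E) 𝓘(ℝ, E) h p.base (![hor v] i)) =
      ![mfderiv 𝓘(ℝ, E) 𝓘(ℝ, E) h p.base (hor v)] := by
    funext i
    fin_cases i
    rfl
  rw [h1, h2]
  change _ - (_ - _) + θ (h p.base) ![mfderiv 𝓘(ℝ, E) 𝓘(ℝ, E) h p.base (hor v)] = _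
  ring

variable [FiniteDimensional ℝ E] [T2Space W] (hθ : θ.IsSmooth) (hd : θ.d = K.Ω)

theorem isPshIsometry_liftDiffeo (hh : K.IsHolomorphicIsometry h)
    (hfe : DForm.ofFun f = DForm.pullback h θ - θ) :
    (sasaki K hθ hd).IsPshIsometry (sasaki K hθ hd) (liftDiffeo h hf c) := by
  have hform := form_mfderiv_liftDiffeo hf c hfe
  refine ⟨?_, fun p v _ => ?_⟩
  · refine DForm.oneForm_ext fun p v => ?_
    refine Eq.trans ?_ (hform p v)
    rw [DForm.pullback_apply]
    congr 1
    funext i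
    fin_cases i
    rfl
  · refine sub_eq_zero.mp (eq_zero_of_form (θ := θ) ?_ ?_)
    · rw [DForm.oneForm_sub, hform]
      change form θ p ![liftEnd θ K.J p v] - form θ _ ![liftEnd θ K.J _ _] = 0
      rw [form_liftEnd, form_liftEnd, sub_zero]
    · rw [hor_sub, sub_eq_zero, hor_mfderiv_liftDiffeo]
      exact (hh.2 p.base (hor v)).trans
        (congrArg (K.J (h p.base)) (hor_mfderiv_liftDiffeo hf c p v)).symm

/-- An isometry h of W preserves Ω = dθ, so h^*θ − θ is closed and, W being contractible, is the df
needed to lift h. -/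
theorem sasaki_isHomogeneous [SecondCountableTopology W] [ContractibleSpace W]
    (hK : K.IsHomogeneous) : (sasaki K hθ hd).IsHomogeneous := by
  intro p p'
  obtain ⟨h, hh, hpp'⟩ := hK p.base p'.base
  have hp := hθ.pullback h.contMDiff
  obtain ⟨f, hf, hfe⟩ := (hp.sub hθ).exists_potential (by
    rw [hp.d_sub hθ, hθ.d_pullback h.contMDiff, hd, hh.1, sub_self])
  -- The constant c is solved from the requirement that the height of p go to that of p'.
  refine ⟨liftDiffeo h hf (p'.height - p.height + f p.base),
    isPshIsometry_liftDiffeo K hf _ hθ hd hh hfe, ?_⟩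
  change mk (p.height - f p.base + (p'.height - p.height + f p.base)) (h p.base) = p'
  rw [hpp', show p.height - f p.base + (p'.height - p.height + f p.base) = p'.height by ring]
  rfl

end Homogeneity

end LineProd

end SasakiGeom

theorem mainTheorem9
    {E : Type u} [NormedAddCommGroup E] [NormedSpace ℝ E] [FiniteDimensional ℝ E]
    {W : Type v} [TopologicalSpace W] [T2Space W] [SecondCountableTopology W]
    [ChartedSpace E W] [IsManifold 𝓘(ℝ, E) ∞ W] [ContractibleSpace W]
    (K : KaehlerStructure E W) (hK : K.IsHomogeneous) :
    -- existence
    (∃ (X : Type v) (_ : TopologicalSpace X) (_ : ChartedSpace (ℝ × E) X)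
        (_ : IsManifold 𝓘(ℝ, ℝ × E) ∞ X) (S : SasakiStructure (ℝ × E) X),
        T2Space X ∧ SecondCountableTopology X ∧ ContractibleSpace X ∧
        S.IsHomogeneous ∧ HasKaehlerQuotient S K) ∧
    -- the fibre (structure group) of the Boothby-Wang fibration is the real line
    (∀ (F : Type u₁) [NormedAddCommGroup F] [NormedSpace ℝ F] [FiniteDimensional ℝ F]
        (X : Type v₁) [TopologicalSpace X] [T2Space X] [SecondCountableTopology X]
        [ChartedSpace F X] [IsManifold 𝓘(ℝ, F) ∞ X] [ContractibleSpace X]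
        (S : SasakiStructure F X) (φ : Flow ℝ X) (q : X → W),
        S.IsHomogeneous → IsBoothbyWang S φ K q → Nonempty (FlowGroup φ ≃ₜ+ ℝ)) ∧
    -- uniqueness
    (∀ (F₁ : Type u₁) [NormedAddCommGroup F₁] [NormedSpace ℝ F₁] [FiniteDimensional ℝ F₁]
        (X₁ : Type v₁) [TopologicalSpace X₁] [T2Space X₁] [SecondCountableTopology X₁]
        [ChartedSpace F₁ X₁] [IsManifold 𝓘(ℝ, F₁) ∞ X₁] [ContractibleSpace X₁]
        (F₂ : Type u₂) [NormedAddCommGroup F₂] [NormedSpace ℝ F₂] [FiniteDimensional ℝ F₂]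
        (X₂ : Type v₂) [TopologicalSpace X₂] [T2Space X₂] [SecondCountableTopology X₂]
        [ChartedSpace F₂ X₂] [IsManifold 𝓘(ℝ, F₂) ∞ X₂] [ContractibleSpace X₂]
        (S₁ : SasakiStructure F₁ X₁) (S₂ : SasakiStructure F₂ X₂),
        S₁.IsHomogeneous → HasKaehlerQuotient S₁ K →
        S₂.IsHomogeneous → HasKaehlerQuotient S₂ K →
        ∃ f : X₁ ≃ₘ^∞⟮𝓘(ℝ, F₁), 𝓘(ℝ, F₂)⟯ X₂, S₁.IsPshIsometry S₂ f) := by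
  -- A single primitive of Ω serves for existence, for the fibre and for uniqueness.
  obtain ⟨θ, hθ, hd⟩ := K.smooth_Ω.exists_primitive K.closed
  refine ⟨⟨LineProd W, inferInstance, inferInstance, inferInstance, LineProd.sasaki K hθ hd,
    inferInstance, inferInstance, inferInstance, LineProd.sasaki_isHomogeneous K hθ hd hK,
    LineProd.translation W, LineProd.base, LineProd.sasaki_isBoothbyWang K hθ hd⟩, ?_, ?_⟩
  · intro F _ _ _ X _ _ _ _ _ _ S φ q _ hq
    obtain ⟨f, hf⟩ := hq.exists_potential hθ hd
    exact flowGroup_equiv_real (hq.periods_eq_bot hf)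
  · intro F₁ _ _ _ X₁ _ _ _ _ _ _ F₂ _ _ _ X₂ _ _ _ _ _ _ S₁ S₂ _ h₁ _ h₂
    obtain ⟨φ₁, q₁, h₁⟩ := h₁
    obtain ⟨φ₂, q₂, h₂⟩ := h₂
    obtain ⟨f₁, hf₁⟩ := h₁.exists_potential hθ hd
    obtain ⟨f₂, hf₂⟩ := h₂.exists_potential hθ hd
    exact h₁.exists_isPshIsometry h₂ hf₁ hf₂
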